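/- A measured weighted graph (mwg) $G=(V,w,m)$ consists of a countable set $V$, a symmetric $w:V\times V\to[0,\infty)$ vanishing on the diagonal, and $m:V\to(0,\infty)$; $G$ is assumed connected and locally finite (each $x$ has finitely many $y$ with $w(x,y)>0$), and $L^p(V)$ is taken with respect to $m$. Put $\Delta f(x)=\sum_y \frac{w(x,y)}{m(x)}(f(y)-f(x))$, $\Gamma(f,g)=\frac12(\Delta(fg)-f\Delta g-g\Delta f)$, $\Gamma_2(f,g)=\frac12(\Delta\Gamma(f,g)-\Gamma(f,\Delta g)-\Gamma(g,\Delta f))$. For $\rho:V\to\mathbb R$ and $n\in(0,\infty]$, $CD(\rho,n)$ means $\Gamma_2(f,f)\ge\rho\,\Gamma(f,f)+\frac1n(\Delta f)^2$ pointwise for all bounded $f:V\to\mathbb R$; for $\kappa>0$, $G$ is $(\kappa,n,\rho)$-spectrally positive if $CD(\rho,n)$ holds and $\frac12\langle -\Delta f,f\rangle+\langle\rho f,f\rangle\ge\kappa\langle f,f\rangle$ for all finitely supported $f$, where $\langle f,g\rangle=\sum_x m(x)f(x)g(x)$. Let $Q$ be the Dirichlet form $Q(f,g)=\frac12\sum_{x,y}w(x,y)(f(x)-f(y))(g(x)-g(y))$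 whose domain $D(Q)$ is the closure of the finitely supported functions in the norm $(Q(f,f)+\|f\|_2^2)^{1/2}$, let $L$ be the associated non-negative self-adjoint operator on $L^2(V)$ (so $L=-\Delta$ on its domain), and for $W:V\to\mathbb R$ let $L+W$ be the operator associated with the form sum $Q+W$ on $D(Q)\cap L^2(V,|W|m)$. When $-(L+W)$ generates a strongly continuous semigroup on $L^2(V)$, that semigroup is written $P_t^W=e^{-t(L+W)}$; it acts on functions in the other $L^p(V)$ by $P_t^Wf(x)=\sum_y (P_t^W1_y)(x)f(y)$. Put $P_t=P_t^0$. For $T>0$ and $W\ge0$ let $$k_T(W)=\sup_{j\in\mathbb N}\int_0^T\|P_t(j\wedge W)\|_\infty\,dt\in[0,\infty],$$ and write $x_-=-\min\{0,x\}$. **Lemma.** Let $G$ be a finite or infinite mwg, $K,T>0$, $n\in(0,\infty]$, $\rho:V\to\mathbb R$, and assume $CD(\rho,n)$. (1) If $k_T((\rho-K)_-)\le\frac12\left(1-e^{-KT/4}\right)$, then $G$ is $(K/2,n,\rho)$-spectrally positive. Further, $-(L+\rho)$ generates a strongly continuous semigroup $P_t^\rho$ on $L^2(V)$, the operator $P_t^\rho$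 maps $L^p(V)$ boundedly to $L^p(V)$ for all $t>0$ and all $p\in[1,\infty]$, and $$\|P_t^\rho\|_{\infty,\infty}\le e^{K(T-t)/2},\qquad t>0.$$ (2) If $k_T((\rho-K)_-)\le\frac14\left(1-e^{-KT/2}\right)$, then $-(L+2\rho)$ generates a strongly continuous semigroup $P_t^{2\rho}$ on $L^2(V)$, and $$\|P_t^{2\rho}\|_{\infty,\infty}\le e^{K(T-t)},\qquad t>0.$$ -/

import Mathlib

open MeasureTheory Filter Topology
open scoped ENNReal NNReal

noncomputable section

/-- A measured and weighted graph on the vertex set `V`: symmetric edge weights vanishing on the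
diagonal and a positive vertex measure; the graph is locally finite and connected. -/
structure MWG (V : Type*) where
  w : V → V → ℝ
  m : V → ℝ
  w_nonneg : ∀ x y, 0 ≤ w x y
  w_symm : ∀ x y, w x y = w y x
  w_diag : ∀ x, w x x = 0
  m_pos : ∀ x, 0 < m x
  locallyFinite : ∀ x, {y | 0 < w x y}.Finite
  connected : ∀ x y, Relation.ReflTransGen (fun a b => 0 < w a b) x y

namespace MWG

variable {V : Type*}

/-- The Laplacian `Δ f(x) = ∑_y (w(x,y) / m(x)) (f(y) - f(x))` (a finite sum, by local
finiteness). -/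
def lap (G : MWG V) (f : V → ℝ) (x : V) : ℝ :=
  ∑' y, G.w x y / G.m x * (f y - f x)

/-- The carré du champ `Γ(f,g) = (Δ(fg) - f Δg - g Δf) / 2`. -/
def Gam (G : MWG V) (f g : V → ℝ) (x : V) : ℝ :=
  1 / 2 * (G.lap (fun z => f z * g z) x - f x * G.lap g x - g x * G.lap f x)

/-- The iterated form `Γ₂(f,g) = (Δ Γ(f,g) - Γ(f,Δg) - Γ(g,Δf)) / 2`. -/
def Gam2 (G : MWG V) (f g : V → ℝ) (x : V) : ℝ :=
  1 / 2 * (G.lap (G.Gam f g) x - G.Gam f (G.lap g) x - G.Gam g (G.lap f) x)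

/-- The variable curvature dimension condition `CD(ρ,n)`, for `n ∈ (0,∞]` (with `1/∞ = 0`). -/
def CD (G : MWG V) (ρ : V → ℝ) (n : ℝ≥0∞) : Prop :=
  ∀ f : V → ℝ, (∃ C : ℝ, ∀ x, |f x| ≤ C) →
    ∀ x, ρ x * G.Gam f f x + (n⁻¹).toReal * (G.lap f x) ^ 2 ≤ G.Gam2 f f x

/-- The inner product `⟨f,g⟩ = ∑_x m(x) f(x) g(x)`. -/
def ip (G : MWG V) (f g : V → ℝ) : ℝ :=
  ∑' x, G.m x * (f x * g x)

/-- `(K,n,ρ)`-spectrally positive Ricci curvature: `CD(ρ,n)` holds and `L/2 + ρ ≥ K` in quadratic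
form sense on finitely supported functions, where `L = -Δ`. -/
def SpectrallyPositive (G : MWG V) (K : ℝ) (n : ℝ≥0∞) (ρ : V → ℝ) : Prop :=
  G.CD ρ n ∧
    ∀ f : V → ℝ, f.support.Finite →
      K * G.ip f f ≤ 1 / 2 * G.ip (fun x => -G.lap f x) f + G.ip (fun x => ρ x * f x) f

/-- The energy `½ ∑_{x,y} w(x,y) (f(x) - f(y))²` as an extended nonnegative number. -/
def energy (G : MWG V) (f : V → ℝ) : ℝ≥0∞ :=
  2⁻¹ * ∑' p : V × V, ENNReal.ofReal (G.w p.1 p.2 * (f p.1 - f p.2) ^ 2)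

/-- The bilinear form `Q(f,g) = ½ ∑_{x,y} w(x,y) (f(x) - f(y)) (g(x) - g(y))`, which is `⟨Lf,g⟩`
on finitely supported functions; the sum converges absolutely on functions of finite energy. -/
def Q (G : MWG V) (f g : V → ℝ) : ℝ :=
  1 / 2 * ∑' p : V × V, G.w p.1 p.2 * ((f p.1 - f p.2) * (g p.1 - g p.2))

variable [MeasurableSpace V]

/-- The measure on `V` with point masses `m(x)`; `L^p(V)` is the `L^p` space of this measure. -/
def vol (G : MWG V) : Measure V :=
  Measure.sum fun x => ENNReal.ofReal (G.m x) • Measure.dirac x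

/-- The domain of the (regular) Dirichlet form `Q`: the closure of the finitely supported functions
in the form norm `(Q(f,f) + ‖f‖₂²)^(1/2)`. -/
def formDom (G : MWG V) : Set (V → ℝ) :=
  {f | MemLp f 2 G.vol ∧ ∀ ε : ℝ≥0∞, 0 < ε → ∃ φ : V → ℝ, φ.support.Finite ∧
    G.energy (fun x => f x - φ x) + (eLpNorm (fun x => f x - φ x) 2 G.vol) ^ 2 < ε}

/-- The domain of the form sum `Q + W`: the functions in the domain of `Q` that are square integrable
with respect to `|W| m`. -/
def formDomPot (G : MWG V) (W : V → ℝ) : Set (V → ℝ) :=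
  {f | f ∈ G.formDom ∧ Summable fun x => G.m x * (|W x| * (f x) ^ 2)}

/-- The graph of the operator `L + W` in `L²(V)` associated with the form sum `Q + W`: `u` lies in
the operator domain and `(L + W) u = g`. For `W = 0` this is `L` itself, `L u = -Δ u`. -/
def IsSchrodinger (G : MWG V) (W : V → ℝ) (u g : Lp ℝ 2 G.vol) : Prop :=
  (u : V → ℝ) ∈ G.formDomPot W ∧
    ∀ v ∈ G.formDomPot W, G.Q u v + G.ip (fun x => W x * u x) v = G.ip g v

/-- `S` (restricted to `t ≥ 0`) is a strongly continuous semigroup of bounded operators on `L²(V)`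
with generator exactly `-(L + W)`; it is then the unique one, i.e. `S t = e^{-t(L+W)}`. -/
structure Generates (G : MWG V) (W : V → ℝ)
    (S : ℝ → Lp ℝ 2 G.vol →L[ℝ] Lp ℝ 2 G.vol) : Prop where
  zero : S 0 = ContinuousLinearMap.id ℝ _
  add : ∀ s t, 0 ≤ s → 0 ≤ t → S (s + t) = (S s).comp (S t)
  cont : ∀ f, ContinuousOn (fun t => S t f) (Set.Ici 0)
  gen : ∀ f g, G.IsSchrodinger W f g ↔
    Tendsto (fun t : ℝ => t⁻¹ • (S t f - f)) (𝓝[>] 0) (𝓝 (-g))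

open Classical in
/-- The semigroup `P_t^W = e^{-t(L+W)}` on `L²(V)` (zero if `L + W` does not generate a strongly
continuous semigroup). -/
def semigroup (G : MWG V) (W : V → ℝ) : ℝ → Lp ℝ 2 G.vol →L[ℝ] Lp ℝ 2 G.vol :=
  if h : ∃ S, G.Generates W S then h.choose else fun _ => 0

theorem vol_singleton_ne_top [DiscreteMeasurableSpace V] (G : MWG V) (x : V) :
    G.vol {x} ≠ ∞ := by
  classical
  have h : G.vol {x} = ENNReal.ofReal (G.m x) := by
    rw [vol, Measure.sum_apply _ (MeasurableSet.of_discrete), tsum_eq_single x]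
    · simp
    · intro y hy
      simp [hy]
  rw [h]
  exact ENNReal.ofReal_ne_top

variable [DiscreteMeasurableSpace V]

/-- The kernel `(x,y) ↦ (P_t^W 1_y)(x)` of `P_t^W`. -/
def kernel (G : MWG V) (W : V → ℝ) (t : ℝ) (x y : V) : ℝ :=
  (G.semigroup W t
    (indicatorConstLp 2 (MeasurableSet.of_discrete (s := {y})) (G.vol_singleton_ne_top y)
      (1 : ℝ)) : V → ℝ) x

/-- The action of `P_t^W` on functions, `(P_t^W f)(x) = ∑_y (P_t^W 1_y)(x) f(y)`. On `L²(V)` this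
is the operator `P_t^W` itself, since `f = ∑_y f(y) 1_y` in `L²(V)`; it is the usual extension of
`P_t^W` to the other `L^p(V)`, including `p = ∞`. -/
def act (G : MWG V) (W : V → ℝ) (t : ℝ) (f : V → ℝ) (x : V) : ℝ :=
  ∑' y, G.kernel W t x y * f y

/-- `P_t^W` maps `L^p(V)` to `L^p(V)` (the defining sums converging absolutely) with
`‖P_t^W‖_{p,p} ≤ C`. -/
def OpNormLE (G : MWG V) (W : V → ℝ) (t : ℝ) (p : ℝ≥0∞) (C : ℝ) : Prop :=
  0 ≤ C ∧ ∀ f : V → ℝ, MemLp f p G.vol →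
    (∀ x, Summable fun y => G.kernel W t x y * f y) ∧
    eLpNorm (G.act W t f) p G.vol ≤ ENNReal.ofReal C * eLpNorm f p G.vol

/-- The Kato constant `k_T(W) = sup_n ∫_0^T ‖P_t (n ∧ W)‖_∞ dt` of `W ≥ 0`, where `P_t = e^{-tL}`
is the heat semigroup. -/
def kato (G : MWG V) (T : ℝ) (W : V → ℝ) : ℝ≥0∞ :=
  ⨆ n : ℕ, ∫⁻ t in Set.Ioc 0 T, eLpNorm (G.act 0 t (fun x => min (n : ℝ) (W x))) ∞ G.vol

end MWG

end

/-!
The heat semigroup of `Δ - U` is the increasing limit of the Dirichlet heat flows on finite vertex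
sets, each of which is a matrix exponential obeying a comparison principle. Write `W` for
`a (ρ - K)₋`, `c` for `aK` and `κ` for `(1 - e^{-cT/4}) / 2`, so that `aρ ≥ c - W` and the
hypothesis says that the integral over `[0, T]` of the heat flow of `W` is at most `κ`; here `a` is
`1` or `2`. For every `θ` with `θκ < 1`,
`v t = e^{-bt} (1 + θ / (1 - θκ) ∫₀ᵗ P_s W ds)` satisfies `∂ₜ v ≥ Δ v + θ W v - b v` on `[0, T]`,
and this supersolution is used twice.

With `θ = 1` and `b = c`, comparison with `v` bounds the flow of `1` under `Δ - aρ` by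
`e^{-ct} / (1 - κ)` up to time `T`, hence by `e^{-ct} (1 - κ)^{-n-1}` if `n T ≤ t ≤ (n + 1) T`,
which is at most `e^{c(T-t)/2}`. This bounds the row sums of the kernel, by symmetry also the column
sums, and Schur's test gives the bound on every `L^p`.

With `θ = 2` and `b = c/4` one has `v T ≤ 1 = v 0`, so that `∫₀ᵀ v` is a positive function `H` with
`-Δ H ≥ (2 W - c/4) H`. Picone's inequality turns it into the form inequality
`2 W ≤ Q + c/4`, that is, into spectral positivity and coercivity of `Q + aρ`. The latter makes
`L + aρ` a closed operator, and a closed symmetric operator that is bounded below and contains the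
generator of a semigroup is that generator.
-/

section Schur

variable {α β E : Type*} [MeasurableSpace α] [MeasurableSpace β] {μ : Measure α} {ν : Measure β}

theorem rpow_lintegral_le_measure_univ_rpow_mul {f : α → ℝ≥0∞} (hf : AEMeasurable f μ) {r : ℝ}
    (hr : 1 ≤ r) : (∫⁻ x, f x ∂μ) ^ r ≤ μ Set.univ ^ (r - 1) * ∫⁻ x, f x ^ r ∂μ := by
  have hr0 : 0 < r := zero_lt_one.trans_le hr
  have h := eLpNorm'_le_eLpNorm'_mul_rpow_measure_univ zero_lt_one hr hf.aestronglyMeasurable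
  simp only [eLpNorm', enorm_eq_self, ENNReal.rpow_one, div_one] at h
  have h' := ENNReal.rpow_le_rpow h hr0.le
  rwa [ENNReal.mul_rpow_of_nonneg _ _ hr0.le, ← ENNReal.rpow_mul, ← ENNReal.rpow_mul, sub_mul,
    one_div_mul_cancel hr0.ne', ENNReal.rpow_one, one_mul, mul_comm] at h'

variable {k : α → β → ℝ≥0∞} {C : ℝ≥0∞}

theorem lintegral_rpow_lintegral_mul_le_of_schur [SFinite μ] [SFinite ν]
    (hk : Measurable (Function.uncurry k)) (hrow : ∀ᵐ x ∂μ, ∫⁻ y, k x y ∂ν ≤ C)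
    (hcol : ∀ᵐ y ∂ν, ∫⁻ x, k x y ∂μ ≤ C) {f : β → ℝ≥0∞} (hf : Measurable f) {r : ℝ}
    (hr : 1 ≤ r) :
    ∫⁻ x, (∫⁻ y, k x y * f y ∂ν) ^ r ∂μ ≤ C ^ r * ∫⁻ y, f y ^ r ∂ν := by
  have hkx : ∀ x, Measurable (k x) := fun x => hk.of_uncurry_left
  have hky : ∀ y, Measurable fun x => k x y := fun y => hk.of_uncurry_right
  have hfr : Measurable fun y => f y ^ r := hf.pow_const r
  -- Jensen's inequality for the measure with density `k x`, of total mass at most `C`.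
  have hjensen : ∀ᵐ x ∂μ,
      (∫⁻ y, k x y * f y ∂ν) ^ r ≤ C ^ (r - 1) * ∫⁻ y, k x y * f y ^ r ∂ν := by
    filter_upwards [hrow] with x hx
    have h := rpow_lintegral_le_measure_univ_rpow_mul (μ := ν.withDensity (k x))
      hf.aemeasurable hr
    rw [withDensity_apply _ MeasurableSet.univ, Measure.restrict_univ,
      lintegral_withDensity_eq_lintegral_mul _ (hkx x) hf,
      lintegral_withDensity_eq_lintegral_mul _ (hkx x) hfr] at h
    exact h.trans (mul_le_mul_left (ENNReal.rpow_le_rpow hx (sub_nonneg.2 hr)) _)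
  have hjoint : Measurable (Function.uncurry fun x y => k x y * f y ^ r) :=
    hk.mul (hfr.comp measurable_snd)
  calc ∫⁻ x, (∫⁻ y, k x y * f y ∂ν) ^ r ∂μ
      ≤ ∫⁻ x, C ^ (r - 1) * ∫⁻ y, k x y * f y ^ r ∂ν ∂μ := lintegral_mono_ae hjensen
    _ = C ^ (r - 1) * ∫⁻ y, (∫⁻ x, k x y ∂μ) * f y ^ r ∂ν := by
        rw [lintegral_const_mul _ hjoint.lintegral_prod_right,
          lintegral_lintegral_swap hjoint.aemeasurable]
        simp_rw [fun y => lintegral_mul_const (μ := μ) (f y ^ r) (hky y)]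
    _ ≤ C ^ (r - 1) * ∫⁻ y, C * f y ^ r ∂ν := by
        gcongr 1
        exact lintegral_mono_ae (hcol.mono fun y hy => mul_le_mul_left hy _)
    _ = C ^ r * ∫⁻ y, f y ^ r ∂ν := by
        rw [lintegral_const_mul _ hfr, ← mul_assoc]
        congr 1
        simpa using (ENNReal.rpow_add_of_nonneg (x := C) (r - 1) 1 (sub_nonneg.2 hr)
          zero_le_one).symm

theorem eLpNorm_lintegral_mul_enorm_le_of_schur [SFinite μ] [SFinite ν] [NormedAddCommGroup E]
    (hk : Measurable (Function.uncurry k)) (hrow : ∀ᵐ x ∂μ, ∫⁻ y, k x y ∂ν ≤ C)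
    (hcol : ∀ᵐ y ∂ν, ∫⁻ x, k x y ∂μ ≤ C) {p : ℝ≥0∞} (hp : 1 ≤ p) {f : β → E}
    (hf : StronglyMeasurable f) :
    eLpNorm (fun x => ∫⁻ y, k x y * ‖f y‖ₑ ∂ν) p μ ≤ C * eLpNorm f p ν := by
  rcases eq_or_ne p ∞ with rfl | hp_top
  · rw [eLpNorm_exponent_top]
    refine essSup_le_of_ae_le _ (hrow.mono fun x hx => ?_)
    calc ‖∫⁻ y, k x y * ‖f y‖ₑ ∂ν‖ₑ = ∫⁻ y, k x y * ‖f y‖ₑ ∂ν := enorm_eq_self _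
      _ ≤ ∫⁻ y, k x y * eLpNorm f ∞ ν ∂ν :=
          lintegral_mono_ae <| (ae_le_eLpNormEssSup (f := f)).mono fun y hy =>
            mul_le_mul_right hy _
      _ ≤ C * eLpNorm f ∞ ν := by
          rw [lintegral_mul_const _ hk.of_uncurry_left]
          exact mul_le_mul_left hx _
  · have hp0 : p ≠ 0 := (zero_lt_one.trans_le hp).ne'
    have hr : 1 ≤ p.toReal := by simpa using ENNReal.toReal_mono hp_top hp
    have hr0 : 0 < p.toReal := zero_lt_one.trans_le hr
    rw [eLpNorm_eq_lintegral_rpow_enorm_toReal hp0 hp_top,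
      eLpNorm_eq_lintegral_rpow_enorm_toReal hp0 hp_top]
    have h := lintegral_rpow_lintegral_mul_le_of_schur hk hrow hcol hf.enorm hr
    refine (ENNReal.rpow_le_rpow h (one_div_nonneg.2 hr0.le)).trans_eq ?_
    rw [ENNReal.mul_rpow_of_nonneg _ _ (one_div_nonneg.2 hr0.le), ← ENNReal.rpow_mul,
      mul_one_div_cancel hr0.ne', ENNReal.rpow_one]

end Schur

section ExpPositivity

theorem exp_smul_nonneg_of_nonneg {E : Type*} [NormedAddCommGroup E] [NormedSpace ℝ E]
    [CompleteSpace E] [PartialOrder E] [IsOrderedAddMonoid E] [OrderClosedTopology E]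
    [PosSMulMono ℝ E] {A : E →L[ℝ] E} (hA : ∀ g, 0 ≤ g → 0 ≤ A g) {t : ℝ} (ht : 0 ≤ t) {f : E}
    (hf : 0 ≤ f) : 0 ≤ NormedSpace.exp (t • A) f := by
  have hpow : ∀ n : ℕ, 0 ≤ (A ^ n) f := by
    intro n
    induction n with
    | zero => simpa using hf
    | succ n ih =>
      rw [pow_succ']
      exact hA _ ih
  have hseries := (NormedSpace.exp_series_hasSum_exp' (𝕂 := ℝ) (t • A)).mapL
    (ContinuousLinearMap.apply ℝ E f)
  refine hseries.nonneg fun n => ?_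
  simp only [ContinuousLinearMap.apply_apply, smul_apply, smul_pow]
  exact smul_nonneg (by positivity) (smul_nonneg (by positivity) (hpow n))

theorem exp_add_smul_of_normedSpace {E : Type*} [NormedAddCommGroup E] [NormedSpace ℝ E]
    [CompleteSpace E] (A : E →L[ℝ] E) (s t : ℝ) :
    NormedSpace.exp ((s + t) • A) = NormedSpace.exp (s • A) * NormedSpace.exp (t • A) := by
  let := NormedAlgebra.restrictScalars ℚ ℝ (E →L[ℝ] E)
  rw [add_smul, NormedSpace.exp_add_of_commute (((Commute.refl A).smul_left s).smul_right t)]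

theorem exp_smul_nonneg_of_add_smul_nonneg {E : Type*} [NormedAddCommGroup E] [NormedSpace ℝ E]
    [CompleteSpace E] [PartialOrder E] [IsOrderedAddMonoid E] [OrderClosedTopology E]
    [PosSMulMono ℝ E] {A : E →L[ℝ] E} {c : ℝ} (hA : ∀ g, 0 ≤ g → 0 ≤ A g + c • g) {t : ℝ}
    (ht : 0 ≤ t) {f : E} (hf : 0 ≤ f) : 0 ≤ NormedSpace.exp (t • A) f := by
  let := NormedAlgebra.restrictScalars ℚ ℝ (E →L[ℝ] E)
  have hsplit : t • A = algebraMap ℝ (E →L[ℝ] E) (-(t * c)) + t • (A + c • 1) := by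
    rw [Algebra.algebraMap_eq_smul_one]
    module
  rw [hsplit, NormedSpace.exp_add_of_commute (Algebra.commute_algebraMap_left _ _),
    ← NormedSpace.algebraMap_exp_comm, Algebra.algebraMap_eq_smul_one, ← Real.exp_eq_exp_ℝ]
  simp only [smul_mul_assoc, one_mul, smul_apply]
  exact smul_nonneg (Real.exp_pos _).le (exp_smul_nonneg_of_nonneg hA ht hf)

theorem nonneg_of_apply_le_deriv {ι : Type*} [Finite ι] {A : (ι → ℝ) →L[ℝ] (ι → ℝ)} {c T : ℝ}
    (hA : ∀ g, 0 ≤ g → 0 ≤ A g + c • g) {r r' : ℝ → ι → ℝ}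
    (hr : ∀ t ∈ Set.Icc 0 T, HasDerivAt r (r' t) t) (hle : ∀ t ∈ Set.Icc 0 T, A (r t) ≤ r' t)
    (h0 : 0 ≤ r 0) : ∀ t ∈ Set.Icc 0 T, 0 ≤ r t := by
  intro t ht i
  cases nonempty_fintype ι
  -- The function `s ↦ e^{(t-s)A} r(s)` is increasing.
  set q : ℝ → ℝ := fun s => NormedSpace.exp ((t - s) • A) (r s) i with hq
  have hIcc : ∀ s ∈ Set.Icc 0 t, s ∈ Set.Icc 0 T := fun s hs => ⟨hs.1, hs.2.trans ht.2⟩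
  have hderiv : ∀ s ∈ Set.Icc 0 t,
      HasDerivAt q (NormedSpace.exp ((t - s) • A) (r' s - A (r s)) i) s := by
    intro s hs
    have hexp : HasDerivAt (fun s : ℝ => NormedSpace.exp ((t - s) • A))
        ((-1 : ℝ) • (NormedSpace.exp ((t - s) • A) * A)) s :=
      (hasDerivAt_exp_smul_const A (t - s)).scomp s ((hasDerivAt_id s).const_sub t)
    refine (hasDerivAt_pi.1 (hexp.clm_apply (hr s (hIcc s hs))) i).congr_deriv ?_
    change (-1 : ℝ) * NormedSpace.exp ((t - s) • A) (A (r s)) i + _ = _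
    rw [map_sub, Pi.sub_apply]
    ring
  have hmono : MonotoneOn q (Set.Icc 0 t) := by
    refine monotoneOn_of_deriv_nonneg (convex_Icc 0 t)
      (fun s hs => (hderiv s hs).continuousAt.continuousWithinAt)
      (fun s hs => (hderiv s (interior_subset hs)).differentiableAt.differentiableWithinAt)
      fun s hs => ?_
    have hs' := interior_subset hs
    rw [(hderiv s hs').deriv]
    exact exp_smul_nonneg_of_add_smul_nonneg hA (sub_nonneg.2 hs'.2)
      (sub_nonneg.2 (hle s (hIcc s hs'))) i
  calc (0 : ℝ) ≤ q 0 := exp_smul_nonneg_of_add_smul_nonneg hA (sub_nonneg.2 ht.1) h0 i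
    _ ≤ q t := hmono (Set.left_mem_Icc.2 ht.1) (Set.right_mem_Icc.2 ht.1) ht.1
    _ = r t i := by simp [hq]

end ExpPositivity

theorem le_exp_mul_of_deriv_le {f f' : ℝ → ℝ} {c t : ℝ}
    (hf : ∀ s ∈ Set.Icc 0 t, HasDerivAt f (f' s) s) (hle : ∀ s ∈ Set.Icc 0 t, f' s ≤ c * f s)
    (ht : 0 ≤ t) : f t ≤ Real.exp (c * t) * f 0 := by
  have h := le_gronwallBound_of_liminf_deriv_right_le (f := f) (f' := f') (δ := f 0) (K := c)
    (ε := 0) (a := 0) (b := t) (fun s hs => (hf s hs).continuousAt.continuousWithinAt)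
    (fun s hs r hr => (hf s ⟨hs.1, hs.2.le⟩).hasDerivWithinAt.liminf_right_slope_le hr) le_rfl
    (fun s hs => by simpa using hle s ⟨hs.1, hs.2.le⟩) t (Set.right_mem_Icc.2 ht)
  rwa [sub_zero, gronwallBound_ε0, mul_comm] at h

section StrongContinuity

variable {E : Type*} [NormedAddCommGroup E] [NormedSpace ℝ E]

theorem tendsto_apply_of_mem_closure {κ : Type*} {l : Filter κ} {S : κ → E →L[ℝ] E} {M : ℝ}
    (hM : ∀ᶠ k in l, ‖S k‖ ≤ M) {D : Set E} (hD : ∀ g ∈ D, Tendsto (fun k => S k g) l (𝓝 g))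
    {f : E} (hf : f ∈ closure D) : Tendsto (fun k => S k f) l (𝓝 f) := by
  rw [Metric.tendsto_nhds]
  intro ε hε
  have hM' : 0 < |M| + 2 := by positivity
  obtain ⟨g, hgD, hg⟩ := Metric.mem_closure_iff.1 hf (ε / (|M| + 2)) (by positivity)
  filter_upwards [Metric.tendsto_nhds.1 (hD g hgD) (ε / (|M| + 2)) (by positivity), hM]
    with k hk hkM
  rw [dist_eq_norm, lt_div_iff₀' hM'] at hg hk
  have hfg : ‖S k (f - g)‖ ≤ |M| * ‖f - g‖ :=
    (S k).le_of_opNorm_le (hkM.trans (le_abs_self M)) _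
  have hsplit : S k f - f = S k (f - g) + (S k g - g) + (g - f) := by
    rw [map_sub]
    abel
  rw [dist_eq_norm, hsplit]
  calc ‖S k (f - g) + (S k g - g) + (g - f)‖ ≤ |M| * ‖f - g‖ + ‖S k g - g‖ + ‖f - g‖ :=
        norm_add₃_le.trans (by rw [norm_sub_rev g f]; gcongr)
    _ < ε := by nlinarith [abs_nonneg M]

theorem continuousOn_of_semigroup {S : ℝ → E →L[ℝ] E} {l : ℝ}
    (hadd : ∀ s t, 0 ≤ s → 0 ≤ t → S (s + t) = (S s).comp (S t))
    (hS : ∀ t, 0 ≤ t → ‖S t‖ ≤ Real.exp (l * t)) {f : E}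
    (h0 : Tendsto (fun t => S t f) (𝓝[≥] 0) (𝓝 f)) :
    ContinuousOn (fun t => S t f) (Set.Ici 0) := by
  intro a ha
  have hinc : ∀ s r, 0 ≤ s → s ≤ r → s ≤ a →
      ‖S r f - S s f‖ ≤ Real.exp (|l| * a) * ‖S |r - s| f - f‖ := by
    intro s r hs hsr hsa
    have hcomp : S r f = S s (S (r - s) f) := by
      rw [← ContinuousLinearMap.comp_apply, ← hadd _ _ hs (sub_nonneg.2 hsr), add_sub_cancel]
    rw [abs_of_nonneg (sub_nonneg.2 hsr), hcomp, ← map_sub]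
    refine (S s).le_of_opNorm_le ((hS s hs).trans (Real.exp_le_exp.2 ?_)) _
    exact mul_le_mul (le_abs_self l) hsa hs (abs_nonneg l)
  have habs : Tendsto (fun t : ℝ => |t - a|) (𝓝[Set.Ici 0] a) (𝓝[≥] 0) := by
    refine tendsto_nhdsWithin_iff.2 ⟨?_, Eventually.of_forall fun t => Set.mem_Ici.2 (abs_nonneg _)⟩
    have hcont : Continuous fun t : ℝ => |t - a| := by fun_prop
    simpa using (hcont.tendsto a).mono_left nhdsWithin_le_nhds
  rw [ContinuousWithinAt, tendsto_iff_norm_sub_tendsto_zero]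
  have hlim := ((tendsto_iff_norm_sub_tendsto_zero.1 h0).comp habs).const_mul
    (Real.exp (|l| * a))
  rw [mul_zero] at hlim
  refine squeeze_zero' (Eventually.of_forall fun t => norm_nonneg _) ?_ hlim
  filter_upwards [self_mem_nhdsWithin] with t ht
  rcases le_total a t with h | h
  · exact hinc a t ha h le_rfl
  · have := hinc t a ht h h
    rwa [norm_sub_rev, abs_sub_comm] at this

end StrongContinuity

theorem eq_zero_of_inner_deriv_right_le {E : Type*} [NormedAddCommGroup E] [InnerProductSpace ℝ E]
    {u u' : ℝ → E} {l t : ℝ} (hcont : ContinuousOn u (Set.Icc 0 t))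
    (hderiv : ∀ s ∈ Set.Ico 0 t, HasDerivWithinAt u (u' s) (Set.Ici s) s)
    (hle : ∀ s ∈ Set.Ico 0 t, inner ℝ (u s) (u' s) ≤ l * ‖u s‖ ^ 2) (h0 : u 0 = 0)
    (ht : 0 ≤ t) : u t = 0 := by
  have hgronwall := le_gronwallBound_of_liminf_deriv_right_le (f := fun s => ‖u s‖ ^ 2)
    (f' := fun s => 2 * inner ℝ (u s) (u' s)) (δ := 0) (K := 2 * l) (ε := 0) (a := 0) (b := t)
    (hcont.norm.pow 2) (fun s hs r hr => (hderiv s hs).norm_sq.liminf_right_slope_le hr)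
    (by simp [h0]) (fun s hs => by linarith [hle s hs]) t (Set.right_mem_Icc.2 ht)
  rw [gronwallBound_ε0_δ0] at hgronwall
  exact norm_eq_zero.1 (pow_eq_zero_iff two_ne_zero |>.1 (hgronwall.antisymm (sq_nonneg _)))

section EllTwo

variable {ι : Type*}

theorem summable_iff_tsum_ofReal_ne_top {f : ι → ℝ} (hf : ∀ i, 0 ≤ f i) :
    Summable f ↔ ∑' i, ENNReal.ofReal (f i) ≠ ∞ :=
  ⟨Summable.tsum_ofReal_ne_top, fun h => by
    simpa only [ENNReal.toReal_ofReal (hf _)] using ENNReal.summable_toReal h⟩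

theorem memℓp_two_iff_summable_sq {a : ι → ℝ} : Memℓp a 2 ↔ Summable fun i => a i ^ 2 := by
  rw [memℓp_gen_iff (by norm_num)]
  simp

theorem lp_summable_sq (a : lp (fun _ : ι => ℝ) 2) : Summable fun i => a i ^ 2 :=
  memℓp_two_iff_summable_sq.1 (lp.memℓp a)

theorem lp_norm_sq_eq_tsum (a : lp (fun _ : ι => ℝ) 2) : ‖a‖ ^ 2 = ∑' i, a i ^ 2 := by
  rw [← real_inner_self_eq_norm_sq, lp.inner_eq_tsum]
  simp [sq]

theorem ofReal_lp_norm_sq (a : lp (fun _ : ι => ℝ) 2) :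
    ENNReal.ofReal (‖a‖ ^ 2) = ∑' i, ENNReal.ofReal (a i ^ 2) := by
  rw [lp_norm_sq_eq_tsum,
    ENNReal.ofReal_tsum_of_nonneg (fun i => sq_nonneg (a i)) (lp_summable_sq a)]

theorem lp_inner_eq_tsum_mul (a b : lp (fun _ : ι => ℝ) 2) :
    inner ℝ a b = ∑' i, a i * b i := by
  rw [lp.inner_eq_tsum]
  simp [mul_comm]

theorem lp_summable_mul (a b : lp (fun _ : ι => ℝ) 2) : Summable fun i => a i * b i := by
  simpa [mul_comm] using lp.summable_inner (𝕜 := ℝ) a b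

theorem lp_inner_eq_tsum_inl_add_tsum_inr {α β : Type*}
    (a b : lp (fun _ : α ⊕ β => ℝ) 2) :
    inner ℝ a b = ∑' x, a (Sum.inl x) * b (Sum.inl x) + ∑' p, a (Sum.inr p) * b (Sum.inr p) := by
  have hsum := lp_summable_mul a b
  rw [lp_inner_eq_tsum_mul, Summable.tsum_sum (hsum.comp_injective Sum.inl_injective)
    (hsum.comp_injective Sum.inr_injective)]

theorem tendsto_inner_of_norm_le_of_mem_closure {H κ : Type*} [NormedAddCommGroup H]
    [InnerProductSpace ℝ H] {l : Filter κ} {a : κ → H} {b q : H} {C : ℝ}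
    (hC : ∀ k, ‖a k‖ ≤ C) {D : Set H} (hD : q ∈ closure D)
    (h : ∀ r ∈ D, Tendsto (fun k => inner ℝ (a k) r) l (𝓝 (inner ℝ b r))) :
    Tendsto (fun k => inner ℝ (a k) q) l (𝓝 (inner ℝ b q)) := by
  rw [Metric.tendsto_nhds]
  intro ε hε
  have hM : 0 < |C| + ‖b‖ + 1 := by positivity
  obtain ⟨r, hrD, hr⟩ := Metric.mem_closure_iff.1 hD (ε / 2 / (|C| + ‖b‖ + 1)) (by positivity)
  filter_upwards [Metric.tendsto_nhds.1 (h r hrD) (ε / 2) (by positivity)] with k hk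
  rw [Real.dist_eq] at hk ⊢
  rw [dist_eq_norm, lt_div_iff₀' hM] at hr
  have hab : ‖a k - b‖ ≤ |C| + ‖b‖ + 1 := by
    linarith [norm_sub_le (a k) b, hC k, le_abs_self C]
  calc |inner ℝ (a k) q - inner ℝ b q|
      = |(inner ℝ (a k) r - inner ℝ b r) + inner ℝ (a k - b) (q - r)| := by
        rw [inner_sub_left, inner_sub_right, inner_sub_right]
        ring_nf
    _ ≤ |inner ℝ (a k) r - inner ℝ b r| + ‖a k - b‖ * ‖q - r‖ :=
        (abs_add_le _ _).trans (by gcongr; exact abs_real_inner_le_norm _ _)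
    _ ≤ |inner ℝ (a k) r - inner ℝ b r| + (|C| + ‖b‖ + 1) * ‖q - r‖ := by gcongr
    _ < ε := by linarith

theorem tendsto_lp_inner_of_tendsto_coord {κ : Type*} {l : Filter κ}
    {a : κ → lp (fun _ : ι => ℝ) 2} {b : lp (fun _ : ι => ℝ) 2} {C : ℝ} (hC : ∀ k, ‖a k‖ ≤ C)
    (h : ∀ i, Tendsto (fun k => a k i) l (𝓝 (b i))) (q : lp (fun _ : ι => ℝ) 2) :
    Tendsto (fun k => inner ℝ (a k) q) l (𝓝 (inner ℝ b q)) := by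
  classical
  have hq : q ∈ closure (Set.range fun s : Finset ι => ∑ i ∈ s, lp.single 2 i (q i)) :=
    mem_closure_of_tendsto (lp.hasSum_single (by norm_num) q)
      (Eventually.of_forall fun s => Set.mem_range_self s)
  refine tendsto_inner_of_norm_le_of_mem_closure hC hq ?_
  rintro _ ⟨s, rfl⟩
  simp only [inner_sum, lp.inner_single_right]
  exact tendsto_finsetSum _ fun i _ => (h i).inner tendsto_const_nhds

theorem mem_topologicalClosure_of_tendsto_coord {κ : Type*} {l : Filter κ} [l.NeBot]
    {M : Submodule ℝ (lp (fun _ : ι => ℝ) 2)} {a : κ → lp (fun _ : ι => ℝ) 2}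
    {b : lp (fun _ : ι => ℝ) 2} {C : ℝ} (hM : ∀ k, a k ∈ M.topologicalClosure)
    (hC : ∀ k, ‖a k‖ ≤ C) (h : ∀ i, Tendsto (fun k => a k i) l (𝓝 (b i))) :
    b ∈ M.topologicalClosure := by
  simp only [← Submodule.orthogonal_orthogonal_eq_closure, Submodule.mem_orthogonal'] at hM ⊢
  intro q hq
  refine tendsto_nhds_unique (tendsto_lp_inner_of_tendsto_coord hC h q) ?_
  exact tendsto_const_nhds.congr fun k => (hM k q hq).symm

theorem mul_sq_le_sq_of_abs_le_one {s : ℝ} (hs : |s| ≤ 1) (a : ℝ) : (s * a) ^ 2 ≤ a ^ 2 := by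
  rw [mul_pow]
  exact mul_le_of_le_one_left (sq_nonneg a) ((sq_le_one_iff_abs_le_one s).2 hs)

theorem memℓp_two_mul_of_abs_le_one {s : ι → ℝ} (hs : ∀ i, |s i| ≤ 1) {a : ι → ℝ}
    (ha : Memℓp a 2) : Memℓp (fun i => s i * a i) 2 :=
  memℓp_two_iff_summable_sq.2 <| Summable.of_nonneg_of_le (fun _ => sq_nonneg _)
    (fun i => mul_sq_le_sq_of_abs_le_one (hs i) _) (memℓp_two_iff_summable_sq.1 ha)

/-- Multiplication by a function bounded by `1`, as an operator on `ℓ²`. -/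
noncomputable def diagOp (s : ι → ℝ) (hs : ∀ i, |s i| ≤ 1) :
    lp (fun _ : ι => ℝ) 2 →L[ℝ] lp (fun _ : ι => ℝ) 2 :=
  LinearMap.mkContinuous
    { toFun := fun a => ⟨fun i => s i * a i, memℓp_two_mul_of_abs_le_one hs (lp.memℓp a)⟩
      map_add' := fun a b => by
        ext i
        exact mul_add _ _ _
      map_smul' := fun c a => by
        ext i
        simp [mul_left_comm] } 1 fun a => by
    rw [one_mul]
    refine le_of_sq_le_sq ?_ (norm_nonneg _)
    rw [lp_norm_sq_eq_tsum, lp_norm_sq_eq_tsum]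
    exact (lp_summable_sq _).tsum_le_tsum (fun i => mul_sq_le_sq_of_abs_le_one (hs i) _)
      (lp_summable_sq a)

theorem diagOp_apply (s : ι → ℝ) (hs : ∀ i, |s i| ≤ 1) (a : lp (fun _ : ι => ℝ) 2) (i : ι) :
    diagOp s hs a i = s i * a i := rfl

end EllTwo

namespace MWG

section LTwo

variable {V : Type*} (G : MWG V)

theorem mul_sq_nonneg (f : V → ℝ) (x : V) : 0 ≤ G.m x * f x ^ 2 :=
  mul_nonneg (G.m_pos x).le (sq_nonneg _)

theorem summable_mul_of_sq {f g : V → ℝ} (hf : Summable fun x => G.m x * f x ^ 2)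
    (hg : Summable fun x => G.m x * g x ^ 2) : Summable fun x => G.m x * (f x * g x) := by
  refine Summable.of_norm_bounded (hf.add hg) fun x => ?_
  rw [Real.norm_eq_abs, abs_mul, abs_of_pos (G.m_pos x), ← mul_add]
  refine mul_le_mul_of_nonneg_left ?_ (G.m_pos x).le
  rw [abs_le]
  constructor <;> nlinarith [sq_nonneg (f x + g x), sq_nonneg (f x - g x)]

variable [MeasurableSpace V] [DiscreteMeasurableSpace V]

theorem vol_singleton (x : V) : G.vol {x} = ENNReal.ofReal (G.m x) := by
  classical
  rw [vol, Measure.sum_apply _ (MeasurableSet.of_discrete), tsum_eq_single x]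
  · simp
  · intro y hy
    simp [hy]

theorem vol_real_singleton (x : V) : G.vol.real {x} = G.m x := by
  rw [Measure.real, vol_singleton, ENNReal.toReal_ofReal (G.m_pos x).le]

theorem ae_vol_iff {p : V → Prop} : (∀ᵐ x ∂G.vol, p x) ↔ ∀ x, p x := by
  refine ⟨fun h x => ?_, Eventually.of_forall⟩
  by_contra hx
  have hnull : G.vol {x} = 0 := measure_mono_null (Set.singleton_subset_iff.2 hx) (ae_iff.1 h)
  rw [vol_singleton, ENNReal.ofReal_eq_zero] at hnull
  exact hnull.not_gt (G.m_pos x)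

theorem ae_eq_vol_iff {α : Type*} {f g : V → α} : f =ᵐ[G.vol] g ↔ f = g := by
  rw [Filter.EventuallyEq, ae_vol_iff, funext_iff]

theorem aestronglyMeasurable_vol (f : V → ℝ) : AEStronglyMeasurable f G.vol :=
  (Measurable.of_discrete).aestronglyMeasurable

theorem coe_toLp {f : V → ℝ} (hf : MemLp f 2 G.vol) : (hf.toLp f : V → ℝ) = f :=
  G.ae_eq_vol_iff.1 hf.coeFn_toLp

theorem coe_add_Lp (f g : Lp ℝ 2 G.vol) : ((f + g : Lp ℝ 2 G.vol) : V → ℝ) = f + g :=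
  G.ae_eq_vol_iff.1 (Lp.coeFn_add f g)

theorem coe_sub_Lp (f g : Lp ℝ 2 G.vol) : ((f - g : Lp ℝ 2 G.vol) : V → ℝ) = f - g :=
  G.ae_eq_vol_iff.1 (Lp.coeFn_sub f g)

theorem coe_smul_Lp (c : ℝ) (f : Lp ℝ 2 G.vol) : ((c • f : Lp ℝ 2 G.vol) : V → ℝ) = c • ⇑f :=
  G.ae_eq_vol_iff.1 (Lp.coeFn_smul c f)

/-- The indicator function of a vertex as an element of `L²`. -/
noncomputable def delta (y : V) : Lp ℝ 2 G.vol :=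
  indicatorConstLp 2 (MeasurableSet.of_discrete (s := {y})) (G.vol_singleton_ne_top y) (1 : ℝ)

theorem coe_delta (y : V) : (G.delta y : V → ℝ) = Set.indicator {y} fun _ => 1 :=
  G.ae_eq_vol_iff.1 indicatorConstLp_coeFn

theorem delta_apply_self (y : V) : G.delta y y = 1 := by simp [coe_delta]

theorem delta_apply_ne {x y : V} (h : x ≠ y) : G.delta y x = 0 := by simp [coe_delta, h]

variable [Countable V]

theorem lintegral_vol (f : V → ℝ≥0∞) :
    ∫⁻ x, f x ∂G.vol = ∑' x, ENNReal.ofReal (G.m x) * f x := by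
  rw [vol, lintegral_sum_measure]
  congr 1
  ext x
  rw [lintegral_smul_measure, lintegral_dirac, smul_eq_mul]

theorem eLpNorm_two_sq (f : V → ℝ) :
    eLpNorm f 2 G.vol ^ 2 = ∑' x, ENNReal.ofReal (G.m x * f x ^ 2) := by
  rw [eLpNorm_eq_lintegral_rpow_enorm_toReal (by norm_num) (by norm_num), ← ENNReal.rpow_natCast,
    ← ENNReal.rpow_mul, lintegral_vol]
  simp only [ENNReal.toReal_ofNat, Nat.cast_ofNat, one_div, ne_eq, OfNat.ofNat_ne_zero,
    not_false_eq_true, inv_mul_cancel₀, ENNReal.rpow_one, ENNReal.rpow_ofNat]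
  refine tsum_congr fun x => ?_
  rw [ENNReal.ofReal_mul (G.m_pos x).le, ← sq_abs (f x), ENNReal.ofReal_pow (abs_nonneg _),
    Real.enorm_eq_ofReal_abs]

theorem memLp_two_iff (f : V → ℝ) : MemLp f 2 G.vol ↔ Summable fun x => G.m x * f x ^ 2 := by
  have hfin : eLpNorm f 2 G.vol < ∞ ↔ eLpNorm f 2 G.vol ^ 2 ≠ ∞ := by
    simp [lt_top_iff_ne_top]
  rw [MemLp, and_iff_right (G.aestronglyMeasurable_vol f), hfin, eLpNorm_two_sq,
    summable_iff_tsum_ofReal_ne_top (G.mul_sq_nonneg f)]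

theorem summable_sq_Lp (f : Lp ℝ 2 G.vol) : Summable fun x => G.m x * f x ^ 2 :=
  (G.memLp_two_iff f).1 (Lp.memLp f)

theorem inner_Lp (f g : Lp ℝ 2 G.vol) : inner ℝ f g = G.ip f g := by
  rw [L2.inner_def, ip]
  rw [integral_countable (L2.integrable_inner f g)]
  congr 1
  ext x
  rw [vol_real_singleton]
  simp [mul_comm]

theorem norm_sq_Lp (f : Lp ℝ 2 G.vol) : ‖f‖ ^ 2 = ∑' x, G.m x * f x ^ 2 := by
  rw [← real_inner_self_eq_norm_sq, inner_Lp, ip]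
  simp_rw [sq]

theorem sq_le_norm_Lp (f : Lp ℝ 2 G.vol) (x : V) : G.m x * f x ^ 2 ≤ ‖f‖ ^ 2 := by
  rw [norm_sq_Lp]
  exact (G.summable_sq_Lp f).le_tsum x fun y _ => G.mul_sq_nonneg f y

theorem abs_le_norm_Lp (f : Lp ℝ 2 G.vol) (x : V) : |f x| ≤ ‖f‖ / √(G.m x) := by
  rw [le_div_iff₀ (Real.sqrt_pos.2 (G.m_pos x))]
  refine abs_le_of_sq_le_sq' ?_ (norm_nonneg _) |>.2
  rw [mul_pow, Real.sq_sqrt (G.m_pos x).le, sq_abs, mul_comm]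
  exact G.sq_le_norm_Lp f x

/-- Evaluation at a vertex, as a continuous functional on `L²`. -/
noncomputable def evalLp (x : V) : Lp ℝ 2 G.vol →L[ℝ] ℝ :=
  LinearMap.mkContinuous
    { toFun := fun f => f x
      map_add' := fun f g => by rw [coe_add_Lp]; rfl
      map_smul' := fun c f => by rw [coe_smul_Lp]; rfl } (1 / √(G.m x)) fun f => by
        simpa [div_eq_inv_mul] using G.abs_le_norm_Lp f x

theorem evalLp_apply (x : V) (f : Lp ℝ 2 G.vol) : G.evalLp x f = f x := rfl

theorem inner_delta (f : Lp ℝ 2 G.vol) (y : V) : inner ℝ f (G.delta y) = G.m y * f y := by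
  rw [inner_Lp, ip, tsum_eq_single y]
  · rw [delta_apply_self, mul_one]
  · intro x hx
    rw [delta_apply_ne G hx, mul_zero, mul_zero]

theorem coe_finsetSum_delta (f : V → ℝ) (s : Finset V) (x : V) [Decidable (x ∈ s)] :
    ((∑ y ∈ s, f y • G.delta y : Lp ℝ 2 G.vol) : V → ℝ) x = if x ∈ s then f x else 0 := by
  classical
  rw [← evalLp_apply, map_sum]
  simp only [map_smul, evalLp_apply, smul_eq_mul]
  split_ifs with h
  · rw [Finset.sum_eq_single x]
    · rw [delta_apply_self, mul_one]
    · intro y _ hy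
      rw [delta_apply_ne G hy.symm, mul_zero]
    · exact fun h' => absurd h h'
  · refine Finset.sum_eq_zero fun y hy => ?_
    rw [delta_apply_ne G (by rintro rfl; exact h hy), mul_zero]

theorem norm_sum_delta_sub_sq (f : Lp ℝ 2 G.vol) (s : Finset V) :
    ‖∑ y ∈ s, f y • G.delta y - f‖ ^ 2
      = ∑' x, G.m x * f x ^ 2 - ∑ x ∈ s, G.m x * f x ^ 2 := by
  classical
  have hs : HasSum (fun x => if x ∈ s then G.m x * f x ^ 2 else 0)
      (∑ x ∈ s, if x ∈ s then G.m x * f x ^ 2 else 0) :=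
    hasSum_sum_of_ne_finset_zero fun x hx => if_neg hx
  rw [Finset.sum_congr rfl fun x hx => if_pos hx] at hs
  rw [norm_sq_Lp, ← ((G.summable_sq_Lp f).hasSum.sub hs).tsum_eq]
  refine tsum_congr fun x => ?_
  rw [coe_sub_Lp, Pi.sub_apply, coe_finsetSum_delta]
  split_ifs <;> ring

theorem hasSum_delta (f : Lp ℝ 2 G.vol) : HasSum (fun y => f y • G.delta y) f := by
  rw [HasSum, tendsto_iff_norm_sub_tendsto_zero]
  have hsq : Tendsto (fun s : Finset V => ‖∑ y ∈ s, f y • G.delta y - f‖ ^ 2) atTop (𝓝 0) := by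
    simp_rw [norm_sum_delta_sub_sq]
    rw [← sub_self (∑' x, G.m x * f x ^ 2)]
    exact (G.summable_sq_Lp f).hasSum.const_sub _
  simpa [Real.sqrt_sq] using hsq.sqrt

theorem hasSum_clm_apply (S : Lp ℝ 2 G.vol →L[ℝ] Lp ℝ 2 G.vol) (f : Lp ℝ 2 G.vol) (x : V) :
    HasSum (fun y => S (G.delta y) x * f y) (S f x) := by
  have h := (G.hasSum_delta f).mapL ((G.evalLp x).comp S)
  simpa [evalLp_apply, coe_smul_Lp, mul_comm] using h

theorem clm_ext {S R : Lp ℝ 2 G.vol →L[ℝ] Lp ℝ 2 G.vol}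
    (h : ∀ x y, S (G.delta y) x = R (G.delta y) x) : S = R := by
  ext1 f
  refine Lp.ext <| Eventually.of_forall fun x => (G.hasSum_clm_apply S f x).unique ?_
  simp_rw [h]
  exact G.hasSum_clm_apply R f x

end LTwo

section Laplacian

variable {V : Type*} (G : MWG V)

/-- The neighbours of a vertex, a finite set by local finiteness. -/
noncomputable def nbr (x : V) : Finset V := (G.locallyFinite x).toFinset

theorem w_eq_zero_of_notMem_nbr {x y : V} (h : y ∉ G.nbr x) : G.w x y = 0 := by
  have hnot_pos : ¬ 0 < G.w x y := by simpa [nbr] using h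
  exact le_antisymm (not_lt.1 hnot_pos) (G.w_nonneg x y)

theorem lap_eq_sum (f : V → ℝ) (x : V) :
    G.lap f x = ∑ y ∈ G.nbr x, G.w x y / G.m x * (f y - f x) :=
  tsum_eq_sum fun y hy => by rw [G.w_eq_zero_of_notMem_nbr hy, zero_div, zero_mul]

theorem lap_add (f g : V → ℝ) (x : V) : G.lap (f + g) x = G.lap f x + G.lap g x := by
  simp only [lap_eq_sum, ← Finset.sum_add_distrib, Pi.add_apply]
  exact Finset.sum_congr rfl fun y _ => by ring

theorem lap_smul (c : ℝ) (f : V → ℝ) (x : V) : G.lap (c • f) x = c * G.lap f x := by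
  simp only [lap_eq_sum, Finset.mul_sum, Pi.smul_apply, smul_eq_mul]
  exact Finset.sum_congr rfl fun y _ => by ring

theorem lap_sub (f g : V → ℝ) (x : V) : G.lap (f - g) x = G.lap f x - G.lap g x := by
  simp only [lap_eq_sum, ← Finset.sum_sub_distrib, Pi.sub_apply]
  exact Finset.sum_congr rfl fun y _ => by ring

theorem lap_const (c : ℝ) (x : V) : G.lap (fun _ => c) x = 0 := by simp [lap]

theorem lap_le_lap {f g : V → ℝ} {x : V} (hx : f x = g x) (h : ∀ y, f y ≤ g y) :
    G.lap f x ≤ G.lap g x := by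
  simp only [lap_eq_sum]
  refine Finset.sum_le_sum fun y _ => ?_
  exact mul_le_mul_of_nonneg_left (by linarith [h y]) (div_nonneg (G.w_nonneg x y) (G.m_pos x).le)

theorem tendsto_lap {ι : Type*} {l : Filter ι} {f : ι → V → ℝ} {g : V → ℝ}
    (h : ∀ x, Tendsto (fun i => f i x) l (𝓝 (g x))) (x : V) :
    Tendsto (fun i => G.lap (f i) x) l (𝓝 (G.lap g x)) := by
  simp only [lap_eq_sum]
  exact tendsto_finsetSum _ fun y _ => ((h y).sub (h x)).const_mul _

end Laplacian

section DirichletHeat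

variable {V : Type*} {F : Finset V}

/-- Extension by zero of a function on a finite set of vertices. -/
noncomputable def extendZero (F : Finset V) : (F → ℝ) →ₗ[ℝ] V → ℝ :=
  Function.ExtendByZero.linearMap ℝ Subtype.val

theorem extendZero_mem (f : F → ℝ) {x : V} (h : x ∈ F) : extendZero F f x = f ⟨x, h⟩ :=
  Subtype.val_injective.extend_apply f (0 : V → ℝ) ⟨x, h⟩

theorem extendZero_notMem (f : F → ℝ) {x : V} (h : x ∉ F) : extendZero F f x = 0 :=
  Function.extend_apply' f (0 : V → ℝ) x fun ⟨y, hy⟩ => h (hy ▸ y.2)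

theorem extendZero_nonneg {f : F → ℝ} (hf : 0 ≤ f) (x : V) : 0 ≤ extendZero F f x := by
  by_cases h : x ∈ F
  · exact (extendZero_mem f h).symm ▸ hf ⟨x, h⟩
  · exact (extendZero_notMem f h).ge

variable (G : MWG V)

/-- The operator `Δ - U` on a finite set with Dirichlet boundary condition. -/
noncomputable def dirGen (U : V → ℝ) (F : Finset V) : (F → ℝ) →L[ℝ] (F → ℝ) :=
  LinearMap.toContinuousLinearMap
    { toFun := fun f x => G.lap (extendZero F f) x - U x * f x
      map_add' := fun f g => by
        ext x
        simp only [map_add, lap_add, Pi.add_apply]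
        ring
      map_smul' := fun c f => by
        ext x
        simp only [map_smul, lap_smul, Pi.smul_apply, smul_eq_mul, RingHom.id_apply]
        ring }

theorem dirGen_apply (U : V → ℝ) (F : Finset V) (f : F → ℝ) (x : F) :
    G.dirGen U F f x = G.lap (extendZero F f) x - U x * f x := rfl

theorem exists_dirGen_add_smul_nonneg (U : V → ℝ) (F : Finset V) :
    ∃ c : ℝ, ∀ g : F → ℝ, 0 ≤ g → 0 ≤ G.dirGen U F g + c • g := by
  -- It suffices that `c` exceeds the diagonal entries of `U - Δ`.
  obtain ⟨c, hc⟩ := (Set.finite_range fun x : F =>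
    ∑ y ∈ G.nbr x, G.w x y / G.m x + U x).bddAbove
  refine ⟨c, fun g hg x => ?_⟩
  have hsplit : (G.dirGen U F g + c • g) x
      = ∑ y ∈ G.nbr x, G.w x y / G.m x * extendZero F g y
        + (c - (∑ y ∈ G.nbr x, G.w x y / G.m x + U x)) * g x := by
    simp only [Pi.add_apply, Pi.smul_apply, smul_eq_mul, dirGen_apply, lap_eq_sum, mul_sub,
      Finset.sum_sub_distrib, ← Finset.sum_mul, extendZero_mem _ x.2]
    ring
  rw [Pi.zero_apply, hsplit]
  exact add_nonneg (Finset.sum_nonneg fun y _ => mul_nonneg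
    (div_nonneg (G.w_nonneg _ _) (G.m_pos _).le) (extendZero_nonneg hg y))
    (mul_nonneg (sub_nonneg.2 (hc (Set.mem_range_self x))) (hg x))

theorem nonneg_of_supersolution {U : V → ℝ} {T : ℝ} {v v' : ℝ → V → ℝ}
    (hoff : ∀ t ∈ Set.Icc 0 T, ∀ x ∉ F, 0 ≤ v t x)
    (hd : ∀ t ∈ Set.Icc 0 T, ∀ x ∈ F, HasDerivAt (fun s => v s x) (v' t x) t)
    (hsup : ∀ t ∈ Set.Icc 0 T, ∀ x ∈ F, G.lap (v t) x - U x * v t x ≤ v' t x)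
    (h0 : ∀ x ∈ F, 0 ≤ v 0 x) :
    ∀ t ∈ Set.Icc 0 T, ∀ x ∈ F, 0 ≤ v t x := by
  obtain ⟨c, hc⟩ := G.exists_dirGen_add_smul_nonneg U F
  have hv : ∀ t ∈ Set.Icc 0 T, 0 ≤ fun y : F => v t y := by
    refine nonneg_of_apply_le_deriv hc (r' := fun t y => v' t y)
      (fun t ht => hasDerivAt_pi.2 fun y => hd t ht y y.2) (fun t ht y => ?_) fun y => h0 y y.2
    refine le_trans ?_ (hsup t ht y y.2)
    rw [dirGen_apply]
    refine sub_le_sub_right (G.lap_le_lap (extendZero_mem _ y.2) fun z => ?_) _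
    by_cases hz : z ∈ F
    · rw [extendZero_mem _ hz]
    · rw [extendZero_notMem _ hz]
      exact hoff t ht z hz
  exact fun t ht x hx => hv t ht ⟨x, hx⟩

/-- The solution of `∂ₜ u = Δ u - U u` on `F` with `u = 0` off `F` and initial value `f` on `F`. -/
noncomputable def heat (U : V → ℝ) (F : Finset V) (t : ℝ) (f : V → ℝ) : V → ℝ :=
  extendZero F (NormedSpace.exp (t • G.dirGen U F) fun y : F => f y)

variable {G} {U : V → ℝ}

theorem heat_notMem (t : ℝ) (f : V → ℝ) {x : V} (hx : x ∉ F) : G.heat U F t f x = 0 :=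
  extendZero_notMem _ hx

theorem heat_zero (f : V → ℝ) {x : V} (hx : x ∈ F) : G.heat U F 0 f x = f x := by
  simp [heat, extendZero_mem _ hx]

theorem hasDerivAt_heat (t : ℝ) (f : V → ℝ) {x : V} (hx : x ∈ F) :
    HasDerivAt (fun s => G.heat U F s f x)
      (G.lap (G.heat U F t f) x - U x * G.heat U F t f x) t := by
  have hexp := (hasDerivAt_exp_smul_const' (G.dirGen U F) t).clm_apply
    (hasDerivAt_const t fun y : F => f y)
  have hcoord := hasDerivAt_pi.1 hexp ⟨x, hx⟩
  have hheat : (fun s => G.heat U F s f x)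
      = fun s => NormedSpace.exp (s • G.dirGen U F) (fun y : F => f y) ⟨x, hx⟩ := by
    ext s
    rw [heat, extendZero_mem _ hx]
  rw [hheat]
  refine hcoord.congr_deriv ?_
  simp [dirGen_apply, heat, extendZero_mem _ hx]

theorem continuous_heat (f : V → ℝ) (x : V) : Continuous fun s => G.heat U F s f x := by
  by_cases hx : x ∈ F
  · exact continuous_iff_continuousAt.2 fun t => (hasDerivAt_heat t f hx).continuousAt
  · simp only [heat_notMem _ _ hx]
    exact continuous_const

theorem heat_add (t : ℝ) (f g : V → ℝ) :
    G.heat U F t (f + g) = G.heat U F t f + G.heat U F t g := by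
  rw [heat, heat, heat, ← map_add, ← map_add]
  rfl

theorem heat_smul (t c : ℝ) (f : V → ℝ) : G.heat U F t (c • f) = c • G.heat U F t f := by
  rw [heat, heat, ← map_smul, ← map_smul]
  rfl

theorem heat_congr (t : ℝ) {f g : V → ℝ} (h : ∀ x ∈ F, f x = g x) :
    G.heat U F t f = G.heat U F t g := by
  have : (fun y : F => f y) = fun y : F => g y := funext fun y => h y y.2
  rw [heat, heat, this]

theorem heat_comp (t s : ℝ) (f : V → ℝ) :
    G.heat U F (t + s) f = G.heat U F t (G.heat U F s f) := by
  have : (fun y : F => extendZero F (NormedSpace.exp (s • G.dirGen U F) fun y : F => f y) y)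
      = NormedSpace.exp (s • G.dirGen U F) fun y : F => f y :=
    funext fun y => extendZero_mem _ y.2
  rw [heat, heat, heat, this, exp_add_smul_of_normedSpace]
  rfl

theorem heat_nonneg {t : ℝ} (ht : 0 ≤ t) {f : V → ℝ} (hf : ∀ x ∈ F, 0 ≤ f x) (x : V) :
    0 ≤ G.heat U F t f x := by
  obtain ⟨c, hc⟩ := G.exists_dirGen_add_smul_nonneg U F
  exact extendZero_nonneg (exp_smul_nonneg_of_add_smul_nonneg hc ht fun y => hf y y.2) x

theorem heat_sub (t : ℝ) (f g : V → ℝ) :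
    G.heat U F t (f - g) = G.heat U F t f - G.heat U F t g := by
  rw [sub_eq_add_neg, ← neg_one_smul ℝ g, heat_add, heat_smul, neg_one_smul, sub_eq_add_neg]

theorem heat_le_heat {t : ℝ} (ht : 0 ≤ t) {f g : V → ℝ} (h : ∀ x ∈ F, f x ≤ g x) (x : V) :
    G.heat U F t f x ≤ G.heat U F t g x := by
  have := heat_nonneg (G := G) (U := U) ht (f := g - f) (fun x hx => sub_nonneg.2 (h x hx)) x
  rw [heat_sub] at this
  simpa using this

theorem heat_le_of_supersolution {T : ℝ} {f : V → ℝ} {v v' : ℝ → V → ℝ}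
    (hoff : ∀ t ∈ Set.Icc 0 T, ∀ x ∉ F, 0 ≤ v t x)
    (hd : ∀ t ∈ Set.Icc 0 T, ∀ x ∈ F, HasDerivAt (fun s => v s x) (v' t x) t)
    (hsup : ∀ t ∈ Set.Icc 0 T, ∀ x ∈ F, G.lap (v t) x - U x * v t x ≤ v' t x)
    (h0 : ∀ x ∈ F, f x ≤ v 0 x) {t : ℝ} (ht : t ∈ Set.Icc 0 T) (x : V) :
    G.heat U F t f x ≤ v t x := by
  by_cases hx : x ∈ F
  · have := G.nonneg_of_supersolution (U := U) (F := F) (T := T)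
      (v := fun s => v s - G.heat U F s f)
      (v' := fun s y => v' s y - (G.lap (G.heat U F s f) y - U y * G.heat U F s f y))
      (fun s hs y hy => by simpa [heat_notMem _ _ hy] using hoff s hs y hy)
      (fun s hs y hy => (hd s hs y hy).sub (hasDerivAt_heat s f hy))
      (fun s hs y hy => by
        have := hsup s hs y hy
        simp only [lap_sub, Pi.sub_apply]
        linarith)
      (fun y hy => by simpa [heat_zero f hy] using h0 y hy) t ht x hx
    simpa using this
  · rw [heat_notMem _ _ hx]
    exact hoff t ht x hx

theorem heat_mono_set {F' : Finset V} (hF : F ⊆ F') {t : ℝ} (ht : 0 ≤ t) {f : V → ℝ}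
    (hf : ∀ x ∈ F', 0 ≤ f x) (x : V) : G.heat U F t f x ≤ G.heat U F' t f x :=
  heat_le_of_supersolution (T := t) (v := fun s => G.heat U F' s f)
    (v' := fun s y => G.lap (G.heat U F' s f) y - U y * G.heat U F' s f y)
    (fun s hs y _ => heat_nonneg hs.1 hf y)
    (fun s _ y hy => hasDerivAt_heat s f (hF hy)) (fun _ _ _ _ => le_rfl)
    (fun y hy => by rw [heat_zero f (hF hy)]) ⟨ht, le_rfl⟩ x

end DirichletHeat

section IntegrationByParts

variable {V : Type*} (G : MWG V)

theorem ip_eq_sum {F : Finset V} (f : V → ℝ) {φ : V → ℝ} (hφ : ∀ x ∉ F, φ x = 0) :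
    G.ip f φ = ∑ x ∈ F, G.m x * (f x * φ x) :=
  tsum_eq_sum fun x hx => by rw [hφ x hx, mul_zero, mul_zero]

theorem Q_comm (f g : V → ℝ) : G.Q f g = G.Q g f := by
  rw [Q, Q]
  congr 2
  ext p
  ring

theorem Q_eq_sum {F : Finset V} (f : V → ℝ) {φ : V → ℝ} (hφ : ∀ x ∉ F, φ x = 0) :
    G.Q f φ = ∑ x ∈ F, G.m x * (-G.lap f x * φ x) := by
  classical
  set N : Finset V := F.biUnion G.nbr
  -- By symmetry of `w`, the summand of `Q f φ` at `(x, y)` is `h (x, y) + h (y, x)`.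
  set h : V × V → ℝ := fun p => G.w p.1 p.2 * ((f p.1 - f p.2) * φ p.1) with hh
  have hsum : HasSum h (∑ p ∈ F ×ˢ N, h p) := by
    refine hasSum_sum_of_ne_finset_zero fun p hp => ?_
    by_cases hpF : p.1 ∈ F
    · have hnbr : p.2 ∉ G.nbr p.1 := fun hmem =>
        hp (Finset.mem_product.2 ⟨hpF, Finset.mem_biUnion.2 ⟨_, hpF, hmem⟩⟩)
      simp only [hh, G.w_eq_zero_of_notMem_nbr hnbr, zero_mul]
    · simp only [hh, hφ _ hpF, mul_zero]
  have hlap : ∑ p ∈ F ×ˢ N, h p = ∑ x ∈ F, G.m x * (-G.lap f x * φ x) := by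
    rw [Finset.sum_product]
    refine Finset.sum_congr rfl fun x hx => ?_
    rw [← Finset.sum_subset (Finset.subset_biUnion_of_mem G.nbr hx) fun y _ hy => by
      simp only [hh, G.w_eq_zero_of_notMem_nbr hy, zero_mul], lap_eq_sum,
      ← Finset.sum_neg_distrib, Finset.sum_mul, Finset.mul_sum]
    refine Finset.sum_congr rfl fun y _ => ?_
    have := (G.m_pos x).ne'
    simp only [hh]
    field_simp
    ring
  have hswap : HasSum (fun p : V × V => h p.swap) (∑ p ∈ F ×ˢ N, h p) :=
    (Equiv.prodComm V V).hasSum_iff.2 hsum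
  have hsplit : ∀ p : V × V,
      G.w p.1 p.2 * ((f p.1 - f p.2) * (φ p.1 - φ p.2)) = h p + h p.swap := by
    intro p
    simp only [hh, Prod.fst_swap, Prod.snd_swap, G.w_symm p.2 p.1]
    ring
  rw [Q, ← hlap]
  simp_rw [hsplit, (hsum.add hswap).tsum_eq]
  ring

theorem notMem_support_toFinset {φ : V → ℝ} (h : φ.support.Finite) :
    ∀ x ∉ h.toFinset, φ x = 0 := fun x hx => by simpa using hx

/-- The form `Q + U`. -/
noncomputable def schroForm (U : V → ℝ) (f g : V → ℝ) : ℝ := G.Q f g + G.ip (fun x => U x * f x) g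

theorem schroForm_comm (U f g : V → ℝ) : G.schroForm U f g = G.schroForm U g f := by
  rw [schroForm, schroForm, Q_comm, ip, ip]
  congr 2
  ext x
  ring

theorem schroForm_eq_sum {F : Finset V} (U f : V → ℝ) {φ : V → ℝ} (hφ : ∀ x ∉ F, φ x = 0) :
    G.schroForm U f φ = ∑ x ∈ F, G.m x * ((-G.lap f x + U x * f x) * φ x) := by
  rw [schroForm, G.Q_eq_sum f hφ, G.ip_eq_sum _ hφ, ← Finset.sum_add_distrib]
  exact Finset.sum_congr rfl fun x _ => by ring

theorem tendsto_schroForm {ι : Type*} {l : Filter ι} {f : ι → V → ℝ} {g : V → ℝ} (U : V → ℝ)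
    (h : ∀ x, Tendsto (fun i => f i x) l (𝓝 (g x))) {φ : V → ℝ} (hφ : φ.support.Finite) :
    Tendsto (fun i => G.schroForm U (f i) φ) l (𝓝 (G.schroForm U g φ)) := by
  simp only [G.schroForm_eq_sum U _ (notMem_support_toFinset hφ)]
  exact tendsto_finsetSum _ fun x _ =>
    ((((G.tendsto_lap h x).neg).add ((h x).const_mul _)).mul_const _).const_mul _

/-- The form `Q + U` is bounded below by `-l` on finitely supported functions. -/
def LowerBound (U : V → ℝ) (l : ℝ) : Prop :=
  ∀ φ : V → ℝ, φ.support.Finite → -(l * G.ip φ φ) ≤ G.schroForm U φ φ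

variable {G} {U : V → ℝ} {F : Finset V}

theorem heat_symm (t : ℝ) (f g : V → ℝ) :
    ∑ x ∈ F, G.m x * (G.heat U F t f x * g x) = ∑ x ∈ F, G.m x * (f x * G.heat U F t g x) := by
  -- With `⟨·, ·⟩` the sum over `F`, the function `s ↦ ⟨e^{sA} f, e^{(t-s)A} g⟩` is constant.
  set q : ℝ → ℝ := fun s =>
    ∑ x ∈ F, G.m x * (G.heat U F s f x * G.heat U F (t - s) g x)
  have hderiv : ∀ s, HasDerivAt q 0 s := by
    intro s
    have hprod : HasDerivAt q (∑ x ∈ F, G.m x *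
        ((G.lap (G.heat U F s f) x - U x * G.heat U F s f x) * G.heat U F (t - s) g x +
          G.heat U F s f x * (-(G.lap (G.heat U F (t - s) g) x
            - U x * G.heat U F (t - s) g x)))) s := by
      refine HasDerivAt.fun_sum fun x hx => ((hasDerivAt_heat s f hx).mul ?_).const_mul _
      simpa [Function.comp_def] using (hasDerivAt_heat (t - s) g hx (G := G) (U := U)).scomp s
        ((hasDerivAt_id s).const_sub t)
    have hcomm := G.schroForm_comm U (G.heat U F s f) (G.heat U F (t - s) g)
    rw [G.schroForm_eq_sum (F := F) U _ fun x hx => heat_notMem _ _ hx,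
      G.schroForm_eq_sum (F := F) U _ fun x hx => heat_notMem _ _ hx, ← sub_eq_zero,
      ← Finset.sum_sub_distrib] at hcomm
    refine hprod.congr_deriv ?_
    rw [← neg_eq_zero, ← Finset.sum_neg_distrib, ← hcomm]
    exact Finset.sum_congr rfl fun x _ => by ring
  calc ∑ x ∈ F, G.m x * (G.heat U F t f x * g x) = q t :=
        Finset.sum_congr rfl fun x hx => by rw [sub_self, heat_zero g hx]
    _ = q 0 :=
        is_const_of_deriv_eq_zero (fun s => (hderiv s).differentiableAt)
          (fun s => (hderiv s).deriv) t 0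
    _ = ∑ x ∈ F, G.m x * (f x * G.heat U F t g x) :=
        Finset.sum_congr rfl fun x hx => by rw [sub_zero, heat_zero f hx]

theorem hasDerivAt_sum_heat_sq (t : ℝ) (f : V → ℝ) :
    HasDerivAt (fun s => ∑ x ∈ F, G.m x * G.heat U F s f x ^ 2)
      (-2 * G.schroForm U (G.heat U F t f) (G.heat U F t f)) t := by
  have hsum : HasDerivAt (fun s => ∑ x ∈ F, G.m x * G.heat U F s f x ^ 2)
      (∑ x ∈ F, G.m x * (2 * G.heat U F t f x *
        (G.lap (G.heat U F t f) x - U x * G.heat U F t f x))) t := by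
    refine HasDerivAt.fun_sum fun x hx => HasDerivAt.const_mul _ ?_
    simpa using (hasDerivAt_heat t f hx (G := G) (U := U)).fun_pow 2
  refine hsum.congr_deriv ?_
  rw [G.schroForm_eq_sum (F := F) U _ fun x hx => heat_notMem _ _ hx, Finset.mul_sum]
  exact Finset.sum_congr rfl fun x _ => by ring

theorem support_heat_finite (t : ℝ) (f : V → ℝ) : (G.heat U F t f).support.Finite :=
  F.finite_toSet.subset fun x hx => by
    by_contra h
    exact hx (heat_notMem t f h)

theorem heat_sq_le {l : ℝ} (hl : G.LowerBound U l) {t : ℝ} (ht : 0 ≤ t) (f : V → ℝ) :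
    ∑ x ∈ F, G.m x * G.heat U F t f x ^ 2
      ≤ Real.exp (2 * l * t) * ∑ x ∈ F, G.m x * f x ^ 2 := by
  have hgrow := le_exp_mul_of_deriv_le (c := 2 * l) (t := t)
    (fun s _ => hasDerivAt_sum_heat_sq (G := G) (U := U) (F := F) s f) (fun s _ => ?_) ht
  · have hinit : ∑ x ∈ F, G.m x * G.heat U F 0 f x ^ 2 = ∑ x ∈ F, G.m x * f x ^ 2 :=
      Finset.sum_congr rfl fun x hx => by rw [heat_zero f hx]
    rwa [hinit] at hgrow
  · have hform := hl (G.heat U F s f) (support_heat_finite s f)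
    rw [G.ip_eq_sum (F := F) _ fun x hx => heat_notMem _ _ hx] at hform
    simp only [sq]
    linarith

end IntegrationByParts

section MinimalKernel

variable {V : Type*} (G : MWG V)

/-- The Dirichlet heat kernel of `Δ - U` on a finite set. -/
noncomputable def dirKernel (U : V → ℝ) (F : Finset V) (t : ℝ) (x y : V) : ℝ :=
  G.heat U F t (Set.indicator {y} fun _ => 1) x

/-- The minimal heat kernel of `Δ - U`: the increasing limit of the Dirichlet kernels. -/
noncomputable def minKernel (U : V → ℝ) (t : ℝ) (x y : V) : ℝ :=
  ⨆ F : Finset V, G.dirKernel U F t x y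

variable {G} {U : V → ℝ} {F : Finset V} {l t : ℝ}

theorem dirKernel_notMem_left {x y : V} (hx : x ∉ F) : G.dirKernel U F t x y = 0 :=
  heat_notMem _ _ hx

theorem heat_const_zero (t : ℝ) : G.heat U F t 0 = 0 := by
  simpa using heat_smul (G := G) (U := U) (F := F) t 0 0

theorem dirKernel_notMem_right {x y : V} (hy : y ∉ F) : G.dirKernel U F t x y = 0 := by
  rw [dirKernel, heat_congr (g := 0), heat_const_zero, Pi.zero_apply]
  intro z hz
  have : z ≠ y := by
    rintro rfl
    exact hy hz
  simp [this]

theorem heat_eq_sum (t : ℝ) (f : V → ℝ) (x : V) :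
    G.heat U F t f x = ∑ y ∈ F, G.dirKernel U F t x y * f y := by
  let heatHom : (V → ℝ) →ₗ[ℝ] (V → ℝ) :=
    { toFun := G.heat U F t, map_add' := heat_add t, map_smul' := heat_smul t }
  have hf : G.heat U F t f = heatHom (∑ y ∈ F, f y • Set.indicator {y} fun _ => (1 : ℝ)) := by
    refine heat_congr t fun z hz => ?_
    rw [Finset.sum_apply, Finset.sum_eq_single z]
    · simp
    · intro y _ hy
      simp [hy.symm]
    · exact fun h => absurd hz h
  rw [hf, map_sum, Finset.sum_apply]
  refine Finset.sum_congr rfl fun y _ => ?_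
  rw [map_smul, Pi.smul_apply, smul_eq_mul, mul_comm]
  rfl

theorem heat_eq_tsum (t : ℝ) (f : V → ℝ) (x : V) :
    G.heat U F t f x = ∑' y, G.dirKernel U F t x y * f y := by
  rw [heat_eq_sum]
  exact (tsum_eq_sum fun y hy => by rw [dirKernel_notMem_right hy, zero_mul]).symm

theorem dirKernel_nonneg (ht : 0 ≤ t) (x y : V) : 0 ≤ G.dirKernel U F t x y :=
  heat_nonneg ht (fun _ _ => Set.indicator_nonneg (fun _ _ => zero_le_one) _) x

theorem dirKernel_mono (ht : 0 ≤ t) (x y : V) :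
    Monotone fun F : Finset V => G.dirKernel U F t x y := fun _ _ hF =>
  heat_mono_set hF ht (fun _ _ => Set.indicator_nonneg (fun _ _ => zero_le_one) _) x

theorem dirKernel_symm (t : ℝ) (x y : V) :
    G.m x * G.dirKernel U F t x y = G.m y * G.dirKernel U F t y x := by
  by_cases hx : x ∈ F
  · by_cases hy : y ∈ F
    · have h := heat_symm (G := G) (U := U) (F := F) t (Set.indicator {y} fun _ => 1)
        (Set.indicator {x} fun _ => 1)
      rw [Finset.sum_eq_single x, Finset.sum_eq_single y] at h
      · simpa [dirKernel] using h
      · intro z _ hz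
        simp [hz]
      · exact fun h => absurd hy h
      · intro z _ hz
        simp [hz]
      · exact fun h => absurd hx h
    · rw [dirKernel_notMem_left hy, dirKernel_notMem_right hy, mul_zero, mul_zero]
  · rw [dirKernel_notMem_left hx, dirKernel_notMem_right hx, mul_zero, mul_zero]

theorem sum_dirKernel_sq_le (hl : G.LowerBound U l) (ht : 0 ≤ t) (y : V) (s : Finset V) :
    ∑ x ∈ s, G.m x * G.dirKernel U F t x y ^ 2 ≤ Real.exp (2 * l * t) * G.m y := by
  classical
  have hinit : ∑ x ∈ F, G.m x * (Set.indicator {y} (fun _ => (1 : ℝ)) x) ^ 2 ≤ G.m y := by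
    calc ∑ x ∈ F, G.m x * (Set.indicator {y} (fun _ => (1 : ℝ)) x) ^ 2
        ≤ ∑ x ∈ insert y F, G.m x * (Set.indicator {y} (fun _ => (1 : ℝ)) x) ^ 2 :=
          Finset.sum_le_sum_of_subset_of_nonneg (Finset.subset_insert _ _) fun x _ _ =>
            G.mul_sq_nonneg _ x
      _ = G.m y := by
          rw [Finset.sum_eq_single y]
          · simp
          · intro z _ hz
            simp [hz]
          · simp
  calc ∑ x ∈ s, G.m x * G.dirKernel U F t x y ^ 2
      ≤ ∑ x ∈ s ∪ F, G.m x * G.dirKernel U F t x y ^ 2 :=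
        Finset.sum_le_sum_of_subset_of_nonneg Finset.subset_union_left fun x _ _ =>
          G.mul_sq_nonneg (G.dirKernel U F t · y) x
    _ = ∑ x ∈ F, G.m x * G.dirKernel U F t x y ^ 2 :=
        (Finset.sum_subset Finset.subset_union_right fun x _ hx => by
          rw [dirKernel_notMem_left hx, sq, zero_mul, mul_zero]).symm
    _ ≤ Real.exp (2 * l * t) * G.m y :=
        (heat_sq_le hl ht _).trans (mul_le_mul_of_nonneg_left hinit (Real.exp_pos _).le)

theorem bddAbove_dirKernel (hl : G.LowerBound U l) (ht : 0 ≤ t) (x y : V) :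
    BddAbove (Set.range fun F : Finset V => G.dirKernel U F t x y) := by
  refine ⟨√(Real.exp (2 * l * t) * G.m y / G.m x), ?_⟩
  rintro _ ⟨F, rfl⟩
  refine Real.le_sqrt_of_sq_le ?_
  rw [le_div_iff₀ (G.m_pos x), mul_comm]
  simpa using sum_dirKernel_sq_le (F := F) hl ht y {x}

theorem tendsto_dirKernel (hl : G.LowerBound U l) (ht : 0 ≤ t) (x y : V) :
    Tendsto (fun F : Finset V => G.dirKernel U F t x y) atTop (𝓝 (G.minKernel U t x y)) :=
  tendsto_atTop_ciSup (dirKernel_mono ht x y) (bddAbove_dirKernel hl ht x y)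

theorem dirKernel_le_minKernel (hl : G.LowerBound U l) (ht : 0 ≤ t)
    (F : Finset V) (x y : V) : G.dirKernel U F t x y ≤ G.minKernel U t x y :=
  le_ciSup (bddAbove_dirKernel hl ht x y) F

theorem minKernel_nonneg (hl : G.LowerBound U l) (ht : 0 ≤ t) (x y : V) :
    0 ≤ G.minKernel U t x y :=
  (dirKernel_nonneg ht x y).trans (dirKernel_le_minKernel hl ht ∅ x y)

theorem minKernel_symm (hl : G.LowerBound U l) (ht : 0 ≤ t) (x y : V) :
    G.m x * G.minKernel U t x y = G.m y * G.minKernel U t y x := by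
  refine tendsto_nhds_unique ((tendsto_dirKernel hl ht x y).const_mul _) ?_
  simp_rw [dirKernel_symm t x y]
  exact (tendsto_dirKernel hl ht y x).const_mul _

theorem summable_minKernel_sq (hl : G.LowerBound U l) (ht : 0 ≤ t) (y : V) :
    Summable fun x => G.m x * G.minKernel U t x y ^ 2 := by
  refine summable_of_sum_le (c := Real.exp (2 * l * t) * G.m y)
    (fun x => G.mul_sq_nonneg (G.minKernel U t · y) x) fun s => ?_
  refine le_of_tendsto (tendsto_finsetSum s fun x _ =>
    ((tendsto_dirKernel hl ht x y).pow 2).const_mul (G.m x)) ?_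
  exact Eventually.of_forall fun F => sum_dirKernel_sq_le hl ht y s

theorem summable_minKernel_mul (hl : G.LowerBound U l) (ht : 0 ≤ t) {f : V → ℝ}
    (hf : Summable fun x => G.m x * f x ^ 2) (x : V) :
    Summable fun y => G.minKernel U t x y * f y := by
  refine ((G.summable_mul_of_sq (summable_minKernel_sq hl ht x) hf).mul_left (G.m x)⁻¹).congr
    fun y => ?_
  have := minKernel_symm hl ht x y
  rw [← mul_assoc (G.m y), ← this]
  have := (G.m_pos x).ne'
  field_simp

theorem tendsto_heat (hl : G.LowerBound U l) (ht : 0 ≤ t) {f : V → ℝ}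
    (hf : Summable fun x => G.m x * f x ^ 2) (x : V) :
    Tendsto (fun F : Finset V => G.heat U F t f x) atTop
      (𝓝 (∑' y, G.minKernel U t x y * f y)) := by
  simp_rw [heat_eq_tsum]
  refine tendsto_tsum_of_dominated_convergence (summable_minKernel_mul hl ht hf x).norm
    (fun y => (tendsto_dirKernel hl ht x y).mul_const _) (Eventually.of_forall fun F y => ?_)
  rw [norm_mul, norm_mul, Real.norm_of_nonneg (dirKernel_nonneg ht x y),
    Real.norm_of_nonneg (minKernel_nonneg hl ht x y)]
  exact mul_le_mul_of_nonneg_right (dirKernel_le_minKernel hl ht F x y) (norm_nonneg _)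

theorem sum_sq_tsum_minKernel_le (hl : G.LowerBound U l) (ht : 0 ≤ t) {f : V → ℝ}
    (hf : Summable fun x => G.m x * f x ^ 2) (s : Finset V) :
    ∑ x ∈ s, G.m x * (∑' y, G.minKernel U t x y * f y) ^ 2
      ≤ Real.exp (2 * l * t) * ∑' x, G.m x * f x ^ 2 := by
  refine le_of_tendsto (tendsto_finsetSum s fun x _ =>
    ((tendsto_heat hl ht hf x).pow 2).const_mul (G.m x)) ?_
  filter_upwards [eventually_ge_atTop s] with F hF
  calc _ ≤ ∑ x ∈ F, G.m x * G.heat U F t f x ^ 2 :=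
        Finset.sum_le_sum_of_subset_of_nonneg hF fun x _ _ =>
          G.mul_sq_nonneg (G.heat U F t f) x
    _ ≤ _ := (heat_sq_le hl ht f).trans (mul_le_mul_of_nonneg_left
        (hf.sum_le_tsum F fun x _ => G.mul_sq_nonneg f x) (Real.exp_pos _).le)

theorem summable_sq_tsum_minKernel (hl : G.LowerBound U l) (ht : 0 ≤ t) {f : V → ℝ}
    (hf : Summable fun x => G.m x * f x ^ 2) :
    Summable fun x => G.m x * (∑' y, G.minKernel U t x y * f y) ^ 2 :=
  summable_of_sum_le (G.mul_sq_nonneg _) (sum_sq_tsum_minKernel_le hl ht hf)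

theorem minKernel_zero (hl : G.LowerBound U l) (x y : V) :
    G.minKernel U 0 x y = Set.indicator {y} (fun _ => 1) x := by
  refine tendsto_nhds_unique (tendsto_dirKernel hl le_rfl x y) (tendsto_const_nhds.congr' ?_)
  filter_upwards [eventually_ge_atTop {x}] with F hF
  rw [dirKernel, heat_zero _ (hF (Finset.mem_singleton_self x))]

theorem minKernel_add (hl : G.LowerBound U l) {s : ℝ} (ht : 0 ≤ t) (hs : 0 ≤ s)
    (x y : V) :
    G.minKernel U (t + s) x y = ∑' z, G.minKernel U t x z * G.minKernel U s z y := by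
  refine tendsto_nhds_unique (tendsto_dirKernel hl (add_nonneg ht hs) x y) ?_
  have hcomp : ∀ F : Finset V, G.dirKernel U F (t + s) x y
      = ∑' z, G.dirKernel U F t x z * G.dirKernel U F s z y := fun F => by
    rw [dirKernel, heat_comp, heat_eq_tsum]
    rfl
  simp_rw [hcomp]
  refine tendsto_tsum_of_dominated_convergence
    (summable_minKernel_mul hl ht (summable_minKernel_sq hl hs y) x)
    (fun z => (tendsto_dirKernel hl ht x z).mul (tendsto_dirKernel hl hs z y))
    (Eventually.of_forall fun F z => ?_)
  rw [Real.norm_of_nonneg (mul_nonneg (dirKernel_nonneg ht x z) (dirKernel_nonneg hs z y))]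
  exact mul_le_mul (dirKernel_le_minKernel hl ht F x z) (dirKernel_le_minKernel hl hs F z y)
    (dirKernel_nonneg hs z y) (minKernel_nonneg hl ht x z)

end MinimalKernel

section HeatOp

variable {V : Type*} {G : MWG V} {U : V → ℝ} {l t : ℝ} [Countable V] [MeasurableSpace V]
  [DiscreteMeasurableSpace V]

theorem exists_heatOp (hl : G.LowerBound U l) (ht : 0 ≤ t) :
    ∃ S : Lp ℝ 2 G.vol →L[ℝ] Lp ℝ 2 G.vol, (∀ f x, S f x = ∑' y, G.minKernel U t x y * f y) ∧
      ‖S‖ ≤ Real.exp (l * t) := by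
  have hmem : ∀ f : Lp ℝ 2 G.vol, MemLp (fun x => ∑' y, G.minKernel U t x y * f y) 2 G.vol :=
    fun f => (G.memLp_two_iff _).2 (summable_sq_tsum_minKernel hl ht (G.summable_sq_Lp f))
  have hcoe : ∀ f x, (hmem f).toLp _ x = ∑' y, G.minKernel U t x y * f y := fun f x => by
    rw [coe_toLp]
  let S : Lp ℝ 2 G.vol →ₗ[ℝ] Lp ℝ 2 G.vol :=
    { toFun := fun f => (hmem f).toLp _
      map_add' := fun f g => Lp.ext <| Eventually.of_forall fun x => by
        rw [G.coe_add_Lp ((hmem f).toLp _), Pi.add_apply, hcoe, hcoe, hcoe,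
          ← (summable_minKernel_mul hl ht (G.summable_sq_Lp f) x).tsum_add
            (summable_minKernel_mul hl ht (G.summable_sq_Lp g) x), coe_add_Lp]
        simp only [Pi.add_apply, mul_add]
      map_smul' := fun c f => Lp.ext <| Eventually.of_forall fun x => by
        rw [G.coe_smul_Lp _ ((hmem f).toLp _), Pi.smul_apply, hcoe, hcoe, RingHom.id_apply,
          smul_eq_mul, ← tsum_mul_left, coe_smul_Lp]
        refine tsum_congr fun y => ?_
        rw [Pi.smul_apply, smul_eq_mul, mul_left_comm] }
  have hS : ∀ f, ‖S f‖ ≤ Real.exp (l * t) * ‖f‖ := fun f => by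
    refine le_of_sq_le_sq ?_ (by positivity)
    have hexp : Real.exp (l * t) ^ 2 = Real.exp (2 * l * t) := by
      rw [← Real.exp_nat_mul]
      push_cast
      ring_nf
    rw [mul_pow, hexp, norm_sq_Lp, norm_sq_Lp]
    simp_rw [show ∀ x, S f x = ∑' y, G.minKernel U t x y * f y from hcoe f]
    exact (summable_sq_tsum_minKernel hl ht (G.summable_sq_Lp f)).tsum_le_of_sum_le
      (sum_sq_tsum_minKernel_le hl ht (G.summable_sq_Lp f))
  exact ⟨S.mkContinuous _ hS, hcoe, S.mkContinuous_norm_le (Real.exp_pos _).le hS⟩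

variable (G) in
open Classical in
/-- The minimal semigroup of `Δ - U` on `L²` (zero if its kernel does not act on `L²`). -/
noncomputable def heatOp (U : V → ℝ) (t : ℝ) : Lp ℝ 2 G.vol →L[ℝ] Lp ℝ 2 G.vol :=
  if h : ∃ S : Lp ℝ 2 G.vol →L[ℝ] Lp ℝ 2 G.vol,
    ∀ f x, S f x = ∑' y, G.minKernel U t x y * f y then h.choose else 0

theorem heatOp_apply (hl : G.LowerBound U l) (ht : 0 ≤ t) (f : Lp ℝ 2 G.vol) (x : V) :
    G.heatOp U t f x = ∑' y, G.minKernel U t x y * f y := by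
  have h := (exists_heatOp hl ht).imp fun _ hS => hS.1
  rw [heatOp, dif_pos h]
  exact h.choose_spec f x

theorem tendsto_heat_heatOp (hl : G.LowerBound U l) (ht : 0 ≤ t) (f : Lp ℝ 2 G.vol) (x : V) :
    Tendsto (fun F : Finset V => G.heat U F t f x) atTop (𝓝 (G.heatOp U t f x)) := by
  rw [heatOp_apply hl ht]
  exact tendsto_heat hl ht (G.summable_sq_Lp f) x

theorem heatOp_delta (hl : G.LowerBound U l) (ht : 0 ≤ t) (x y : V) :
    G.heatOp U t (G.delta y) x = G.minKernel U t x y := by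
  rw [heatOp_apply hl ht, tsum_eq_single y]
  · rw [delta_apply_self, mul_one]
  · intro z hz
    rw [delta_apply_ne G hz, mul_zero]

theorem norm_heatOp_le (hl : G.LowerBound U l) (ht : 0 ≤ t) :
    ‖G.heatOp U t‖ ≤ Real.exp (l * t) := by
  obtain ⟨S, hS, hnorm⟩ := exists_heatOp hl ht
  rwa [G.clm_ext fun x y => (heatOp_apply hl ht (G.delta y) x).trans (hS (G.delta y) x).symm]

theorem heatOp_zero (hl : G.LowerBound U l) : G.heatOp U 0 = ContinuousLinearMap.id ℝ _ := by
  refine G.clm_ext fun x y => ?_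
  rw [heatOp_delta hl le_rfl, minKernel_zero hl, ContinuousLinearMap.id_apply, coe_delta]

theorem heatOp_add (hl : G.LowerBound U l) {s : ℝ} (ht : 0 ≤ t) (hs : 0 ≤ s) :
    G.heatOp U (t + s) = (G.heatOp U t).comp (G.heatOp U s) := by
  refine G.clm_ext fun x y => ?_
  rw [heatOp_delta hl (add_nonneg ht hs), minKernel_add hl ht hs, ContinuousLinearMap.comp_apply,
    heatOp_apply hl ht]
  simp_rw [heatOp_delta hl hs]

theorem heatOp_symm (hl : G.LowerBound U l) (ht : 0 ≤ t) (f g : Lp ℝ 2 G.vol) :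
    inner ℝ (G.heatOp U t f) g = inner ℝ f (G.heatOp U t g) := by
  have hadj : ContinuousLinearMap.adjoint (G.heatOp U t) = G.heatOp U t := by
    refine G.clm_ext fun x y => mul_left_cancel₀ (G.m_pos x).ne' ?_
    rw [← inner_delta, ContinuousLinearMap.adjoint_inner_left, real_inner_comm, inner_delta,
      heatOp_delta hl ht, heatOp_delta hl ht, minKernel_symm hl ht]
  conv_lhs => rw [← hadj]
  rw [ContinuousLinearMap.adjoint_inner_left]

theorem norm_sq_delta (y : V) : ‖G.delta y‖ ^ 2 = G.m y := by
  rw [← real_inner_self_eq_norm_sq, inner_delta, delta_apply_self, mul_one]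

theorem tendsto_heatOp_delta (hl : G.LowerBound U l) (y : V) :
    Tendsto (fun t => G.heatOp U t (G.delta y)) (𝓝[≥] 0) (𝓝 (G.delta y)) := by
  rw [tendsto_iff_norm_sub_tendsto_zero]
  -- Expand `‖P_t 1_y - 1_y‖²` and bound `⟨P_t 1_y, 1_y⟩` below by the Dirichlet flow on `{y}`.
  set b : ℝ → ℝ := fun t =>
    (Real.exp (l * t) ^ 2 + 1 - 2 * G.dirKernel U {y} t y y) * G.m y with hb
  have hb0 : Tendsto b (𝓝[≥] 0) (𝓝 0) := by
    have hcont : Continuous b := by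
      have : Continuous fun t => G.dirKernel U {y} t y y := continuous_heat _ _
      fun_prop
    have hval : b 0 = 0 := by
      simp only [hb, dirKernel, heat_zero _ (Finset.mem_singleton_self y),
        Set.indicator_of_mem (Set.mem_singleton y), mul_zero, Real.exp_zero]
      ring
    simpa only [hval] using (hcont.tendsto 0).mono_left (nhdsWithin_le_nhds (s := Set.Ici 0))
  have hsq : Tendsto (fun t => ‖G.heatOp U t (G.delta y) - G.delta y‖ ^ 2) (𝓝[≥] 0) (𝓝 0) := by
    refine squeeze_zero' (Eventually.of_forall fun t => sq_nonneg _) ?_ hb0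
    filter_upwards [self_mem_nhdsWithin] with t ht
    have hnorm : ‖G.heatOp U t (G.delta y)‖ ^ 2 ≤ Real.exp (l * t) ^ 2 * G.m y := by
      rw [← norm_sq_delta y, ← mul_pow]
      gcongr
      exact (G.heatOp U t).le_of_opNorm_le (norm_heatOp_le hl ht) _
    rw [norm_sub_sq_real, inner_delta, heatOp_delta hl ht, norm_sq_delta, hb]
    nlinarith [mul_le_mul_of_nonneg_left (dirKernel_le_minKernel hl ht {y} y y) (G.m_pos y).le]
  simpa [Real.sqrt_sq] using hsq.sqrt

theorem tendsto_heatOp_zero (hl : G.LowerBound U l) (f : Lp ℝ 2 G.vol) :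
    Tendsto (fun t => G.heatOp U t f) (𝓝[≥] 0) (𝓝 f) := by
  have hbound : ∀ᶠ t : ℝ in 𝓝[≥] 0, ‖G.heatOp U t‖ ≤ Real.exp |l| := by
    filter_upwards [nhdsWithin_le_nhds (Iic_mem_nhds zero_lt_one), self_mem_nhdsWithin]
      with t (ht1 : t ≤ 1) (ht0 : 0 ≤ t)
    refine (norm_heatOp_le hl ht0).trans (Real.exp_le_exp.2 ?_)
    nlinarith [le_abs_self l, abs_nonneg l]
  have hdense : f ∈ closure (Set.range fun s : Finset V => ∑ y ∈ s, f y • G.delta y) :=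
    mem_closure_of_tendsto (G.hasSum_delta f)
      (Eventually.of_forall fun s => Set.mem_range_self s)
  refine tendsto_apply_of_mem_closure hbound ?_ hdense
  rintro _ ⟨s, rfl⟩
  simp only [map_sum, map_smul]
  exact tendsto_finsetSum _ fun y _ => (tendsto_heatOp_delta hl y).const_smul _

theorem continuousOn_heatOp (hl : G.LowerBound U l) (f : Lp ℝ 2 G.vol) :
    ContinuousOn (fun t => G.heatOp U t f) (Set.Ici 0) :=
  continuousOn_of_semigroup (fun _ _ hs ht => heatOp_add hl hs ht)
    (fun _ ht => norm_heatOp_le hl ht) (tendsto_heatOp_zero hl f)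

end HeatOp

end MWG

/-- The value `a` truncated to the interval `[-|r|, |r|]`. -/
def clampAbs (r a : ℝ) : ℝ := max (-|r|) (min a |r|)

theorem abs_clampAbs_le (r a : ℝ) : |clampAbs r a| ≤ |r| := by
  rw [clampAbs, abs_le]
  refine ⟨le_max_left _ _, max_le ?_ (min_le_right _ _)⟩
  linarith [abs_nonneg r]

theorem clampAbs_self (r : ℝ) : clampAbs r r = r := by
  rw [clampAbs, min_eq_left (le_abs_self r), max_eq_right (neg_abs_le r)]

theorem clampAbs_zero_right (r : ℝ) : clampAbs r 0 = 0 := by simp [clampAbs]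

theorem continuous_clampAbs (r : ℝ) : Continuous (clampAbs r) := by
  unfold clampAbs
  fun_prop

theorem sq_clampAbs_sub_clampAbs_le (r s a b : ℝ) :
    (clampAbs r a - clampAbs s b) ^ 2 ≤ (a - b) ^ 2 + (r - s) ^ 2 := by
  have hmax : |clampAbs r a - clampAbs s b| ≤ max |a - b| |r - s| := by
    refine (abs_max_sub_max_le_max _ _ _ _).trans (max_le ?_ ?_)
    · rw [neg_sub_neg, abs_sub_comm]
      exact (abs_abs_sub_abs_le_abs_sub r s).trans (le_max_right _ _)
    · exact (abs_min_sub_min_le_max _ _ _ _).trans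
        (max_le_max_left _ (abs_abs_sub_abs_le_abs_sub r s))
  rcases le_max_iff.1 hmax with h | h
  · linarith [sq_le_sq.2 h, sq_nonneg (r - s)]
  · linarith [sq_le_sq.2 h, sq_nonneg (a - b)]

namespace MWG

section FormDomain

variable {V : Type*} (G : MWG V)

/-- The isometric embedding of the form domain with the norm `Q + ∑ m (1 + |U|) f²` in `ℓ²`. -/
noncomputable def emb (U f : V → ℝ) : V ⊕ V × V → ℝ :=
  Sum.elim (fun x => √(G.m x * (1 + |U x|)) * f x)
    (fun p => √(G.w p.1 p.2 / 2) * (f p.1 - f p.2))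

theorem emb_inl (U f : V → ℝ) (x : V) :
    G.emb U f (Sum.inl x) = √(G.m x * (1 + |U x|)) * f x := rfl

theorem emb_inr (U f : V → ℝ) (p : V × V) :
    G.emb U f (Sum.inr p) = √(G.w p.1 p.2 / 2) * (f p.1 - f p.2) := rfl

theorem emb_inl_sq (U f : V → ℝ) (x : V) :
    G.emb U f (Sum.inl x) ^ 2 = G.m x * ((1 + |U x|) * f x ^ 2) := by
  rw [emb_inl, mul_pow, Real.sq_sqrt, mul_assoc]
  have := G.m_pos x
  positivity

theorem emb_inr_sq (U f : V → ℝ) (p : V × V) :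
    G.emb U f (Sum.inr p) ^ 2 = G.w p.1 p.2 / 2 * (f p.1 - f p.2) ^ 2 := by
  rw [emb_inr, mul_pow, Real.sq_sqrt]
  exact div_nonneg (G.w_nonneg _ _) zero_le_two

theorem emb_add (U f g : V → ℝ) (i : V ⊕ V × V) :
    G.emb U (f + g) i = G.emb U f i + G.emb U g i := by
  cases i <;> simp only [emb_inl, emb_inr, Pi.add_apply] <;> ring

theorem emb_sub (U f g : V → ℝ) (i : V ⊕ V × V) :
    G.emb U (f - g) i = G.emb U f i - G.emb U g i := by
  cases i <;> simp only [emb_inl, emb_inr, Pi.sub_apply] <;> ring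

theorem emb_smul (U : V → ℝ) (c : ℝ) (f : V → ℝ) (i : V ⊕ V × V) :
    G.emb U (c • f) i = c * G.emb U f i := by
  cases i <;> simp only [emb_inl, emb_inr, Pi.smul_apply, smul_eq_mul] <;> ring

theorem tendsto_emb {κ : Type*} {l : Filter κ} {f : κ → V → ℝ} {g : V → ℝ} (U : V → ℝ)
    (h : ∀ x, Tendsto (fun k => f k x) l (𝓝 (g x))) (i : V ⊕ V × V) :
    Tendsto (fun k => G.emb U (f k) i) l (𝓝 (G.emb U g i)) := by
  cases i with
  | inl x => exact (h x).const_mul _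
  | inr p => exact ((h p.1).sub (h p.2)).const_mul _

theorem energy_eq_tsum_emb (U f : V → ℝ) :
    G.energy f = ∑' p, ENNReal.ofReal (G.emb U f (Sum.inr p) ^ 2) := by
  rw [energy, ← ENNReal.tsum_mul_left]
  refine tsum_congr fun p => ?_
  rw [emb_inr_sq, div_mul_eq_mul_div, ENNReal.ofReal_div_of_pos two_pos, ENNReal.ofReal_ofNat,
    ENNReal.div_eq_inv_mul]

theorem tsum_ofReal_emb_sq (U f : V → ℝ) :
    ∑' i, ENNReal.ofReal (G.emb U f i ^ 2) =
      ∑' x, ENNReal.ofReal (G.emb U f (Sum.inl x) ^ 2) + G.energy f := by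
  rw [Summable.tsum_sum ENNReal.summable ENNReal.summable, G.energy_eq_tsum_emb U]

theorem memℓp_emb_iff {U f : V → ℝ} : Memℓp (G.emb U f) 2 ↔
    (Summable fun x => G.emb U f (Sum.inl x) ^ 2) ∧ G.energy f ≠ ∞ := by
  rw [memℓp_two_iff_summable_sq, summable_iff_tsum_ofReal_ne_top fun i => sq_nonneg _,
    summable_iff_tsum_ofReal_ne_top fun x => sq_nonneg _, tsum_ofReal_emb_sq, ENNReal.add_ne_top]

theorem energy_le_of_sq_le {f g h : V → ℝ} (a b : ℝ≥0)
    (hfg : ∀ x y, (h x - h y) ^ 2 ≤ a * (f x - f y) ^ 2 + b * (g x - g y) ^ 2) :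
    G.energy h ≤ a * G.energy f + b * G.energy g := by
  simp only [energy]
  rw [mul_left_comm, mul_left_comm (b : ℝ≥0∞), ← mul_add, ← ENNReal.tsum_mul_left (a := a),
    ← ENNReal.tsum_mul_left (a := b), ← ENNReal.tsum_add]
  gcongr with p
  have hw := G.w_nonneg p.1 p.2
  rw [← ENNReal.ofReal_coe_nnreal, ← ENNReal.ofReal_coe_nnreal, ← ENNReal.ofReal_mul a.coe_nonneg,
    ← ENNReal.ofReal_mul b.coe_nonneg, ← ENNReal.ofReal_add (by positivity) (by positivity)]
  refine ENNReal.ofReal_le_ofReal ((mul_le_mul_of_nonneg_left (hfg p.1 p.2) hw).trans_eq ?_)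
  ring

theorem summable_w_mul_of_finite {φ : V → ℝ} (hφ : φ.support.Finite) {k : V × V → ℝ}
    (hk : ∀ p : V × V, φ p.1 = 0 → φ p.2 = 0 → k p = 0) :
    Summable fun p : V × V => G.w p.1 p.2 * k p := by
  classical
  set N : Finset (V × V) := hφ.toFinset.biUnion fun x => (G.nbr x).image fun y => (x, y)
  refine summable_of_ne_finset_zero (s := N ∪ N.image Prod.swap) fun p hp => ?_
  rw [Finset.mem_union, not_or] at hp
  by_cases hw : G.w p.1 p.2 = 0
  · rw [hw, zero_mul]
  have hfst : φ p.1 = 0 := by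
    by_contra h
    refine hp.1 (Finset.mem_biUnion.2 ⟨p.1, by simpa using h, ?_⟩)
    exact Finset.mem_image.2 ⟨p.2, by_contra fun h' => hw (G.w_eq_zero_of_notMem_nbr h'), rfl⟩
  have hsnd : φ p.2 = 0 := by
    by_contra h
    refine hp.2 (Finset.mem_image.2 ⟨p.swap, ?_, Prod.swap_swap p⟩)
    refine Finset.mem_biUnion.2 ⟨p.2, by simpa using h, ?_⟩
    rw [G.w_symm] at hw
    exact Finset.mem_image.2 ⟨p.1, by_contra fun h' => hw (G.w_eq_zero_of_notMem_nbr h'), rfl⟩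
  rw [hk p hfst hsnd, mul_zero]

theorem energy_ne_top_of_finite {φ : V → ℝ} (hφ : φ.support.Finite) : G.energy φ ≠ ∞ :=
  ENNReal.mul_ne_top (by simp) (G.summable_w_mul_of_finite hφ
    (k := fun p => (φ p.1 - φ p.2) ^ 2) fun p hfst hsnd => by simp [hfst, hsnd]).tsum_ofReal_ne_top

theorem memℓp_emb_of_finite (U : V → ℝ) {φ : V → ℝ} (hφ : φ.support.Finite) :
    Memℓp (G.emb U φ) 2 := by
  refine G.memℓp_emb_iff.2 ⟨?_, G.energy_ne_top_of_finite hφ⟩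
  refine summable_of_ne_finset_zero (s := hφ.toFinset) fun x hx => ?_
  rw [emb_inl, notMem_support_toFinset hφ x hx]
  ring

/-- The finitely supported functions, embedded in `ℓ²`. -/
noncomputable def finCore (U : V → ℝ) : Submodule ℝ (lp (fun _ : V ⊕ V × V => ℝ) 2) where
  carrier := {a | ∃ φ : V → ℝ, φ.support.Finite ∧ ∀ i, a i = G.emb U φ i}
  add_mem' := by
    rintro a b ⟨φ, hφ, ha⟩ ⟨ψ, hψ, hb⟩
    refine ⟨φ + ψ, (hφ.union hψ).subset (Function.support_add _ _), fun i => ?_⟩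
    rw [emb_add, ← ha, ← hb]
    rfl
  zero_mem' := by
    refine ⟨0, by simp, fun i => ?_⟩
    cases i <;> simp [emb]
  smul_mem' := by
    rintro c a ⟨φ, hφ, ha⟩
    refine ⟨c • φ, hφ.subset (Function.support_const_smul_subset _ _), fun i => ?_⟩
    rw [emb_smul, ← ha]
    rfl

theorem norm_emb_clampAbs_le {U f φ : V → ℝ} (hf : Memℓp (G.emb U f) 2)
    (hφ : G.energy (fun x => f x - φ x) ≤ 1) {a : lp (fun _ : V ⊕ V × V => ℝ) 2}
    (ha : ∀ i, a i = G.emb U (fun x => clampAbs (f x) (φ x)) i) :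
    ‖a‖ ≤ √(∑' x, ENNReal.ofReal (G.emb U f (Sum.inl x) ^ 2)
      + (2 + 3 * G.energy f)).toReal := by
  obtain ⟨hmass, henergy⟩ := G.memℓp_emb_iff.1 hf
  refine Real.le_sqrt_of_sq_le ((ENNReal.ofReal_le_iff_le_toReal ?_).1 ?_)
  · exact ENNReal.add_ne_top.2 ⟨hmass.tsum_ofReal_ne_top,
      ENNReal.add_ne_top.2 ⟨by simp, ENNReal.mul_ne_top (by simp) henergy⟩⟩
  simp_rw [ofReal_lp_norm_sq, ha, tsum_ofReal_emb_sq]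
  refine add_le_add (ENNReal.tsum_le_tsum fun x => ENNReal.ofReal_le_ofReal ?_) ?_
  · rw [emb_inl_sq, emb_inl_sq]
    have := G.m_pos x
    gcongr ?_ * (?_ * ?_)
    exact sq_le_sq.2 (abs_clampAbs_le _ _)
  · calc G.energy (fun x => clampAbs (f x) (φ x))
        ≤ (2 : ℝ≥0) * G.energy (fun x => f x - φ x) + (3 : ℝ≥0) * G.energy f := by
          refine G.energy_le_of_sq_le 2 3 fun x y => (sq_clampAbs_sub_clampAbs_le _ _ _ _).trans ?_
          push_cast
          nlinarith [sq_nonneg ((f x - φ x) - (f y - φ y) + (f x - f y))]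
      _ ≤ 2 + 3 * G.energy f := by
          push_cast
          gcongr
          exact mul_le_of_le_one_right' hφ

variable [MeasurableSpace V] [DiscreteMeasurableSpace V] [Countable V]

theorem ofReal_mul_sq_le_eLpNorm_sq (f : V → ℝ) (x : V) :
    ENNReal.ofReal (G.m x * f x ^ 2) ≤ eLpNorm f 2 G.vol ^ 2 := by
  rw [eLpNorm_two_sq]
  exact ENNReal.le_tsum x

theorem tendsto_of_tendsto_eLpNorm_sub {κ : Type*} {l : Filter κ} {φ : κ → V → ℝ} {f : V → ℝ}
    (h : Tendsto (fun k => eLpNorm (fun x => f x - φ k x) 2 G.vol ^ 2) l (𝓝 0)) (x : V) :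
    Tendsto (fun k => φ k x) l (𝓝 (f x)) := by
  have hofReal : Tendsto (fun k => ENNReal.ofReal (G.m x * (f x - φ k x) ^ 2)) l (𝓝 0) :=
    tendsto_of_tendsto_of_tendsto_of_le_of_le tendsto_const_nhds h (fun _ => zero_le) fun k =>
      G.ofReal_mul_sq_le_eLpNorm_sq (fun x => f x - φ k x) x
  have hreal := ((ENNReal.tendsto_toReal ENNReal.zero_ne_top).comp hofReal).const_mul (G.m x)⁻¹
  have hsq : Tendsto (fun k => (f x - φ k x) ^ 2) l (𝓝 0) := by
    refine (hreal.congr fun k => ?_).trans_eq (by simp)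
    rw [Function.comp_apply, ENNReal.toReal_ofReal (G.mul_sq_nonneg (fun x => f x - φ k x) x),
      inv_mul_cancel_left₀ (G.m_pos x).ne']
  have habs : Tendsto (fun k => |f x - φ k x|) l (𝓝 0) := by
    simpa [Real.sqrt_sq_eq_abs] using hsq.sqrt
  simpa using ((tendsto_zero_iff_abs_tendsto_zero _).2 habs).const_sub (f x)

theorem exists_seq_tendsto_of_mem_formDom {f : V → ℝ} (hf : f ∈ G.formDom) :
    ∃ φ : ℕ → V → ℝ, (∀ k, (φ k).support.Finite) ∧
      (∀ k, G.energy (fun x => f x - φ k x) ≤ 1) ∧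
      ∀ x, Tendsto (fun k => φ k x) atTop (𝓝 (f x)) := by
  choose φ hφ happrox using fun k : ℕ =>
    hf.2 ((k + 1 : ℕ) : ℝ≥0∞)⁻¹ (ENNReal.inv_pos.2 (ENNReal.natCast_ne_top _))
  refine ⟨φ, hφ, fun k => ?_, G.tendsto_of_tendsto_eLpNorm_sub ?_⟩
  · refine (le_self_add.trans (happrox k).le).trans (ENNReal.inv_le_one.2 ?_)
    exact_mod_cast k.succ_pos
  · exact tendsto_of_tendsto_of_tendsto_of_le_of_le tendsto_const_nhds
      ((tendsto_add_atTop_iff_nat 1).2 ENNReal.tendsto_inv_nat_nhds_zero) (fun _ => zero_le)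
      fun k => le_add_self.trans (happrox k).le

theorem memℓp_emb_of_mem_formDomPot {U f : V → ℝ} (hf : f ∈ G.formDomPot U) :
    Memℓp (G.emb U f) 2 := by
  obtain ⟨φ, hφ, henergy, -⟩ := G.exists_seq_tendsto_of_mem_formDom hf.1
  refine G.memℓp_emb_iff.2
    ⟨(((G.memLp_two_iff f).1 hf.1.1).add hf.2).congr fun x => ?_, ne_top_of_le_ne_top ?_
      (G.energy_le_of_sq_le (f := fun x => f x - φ 0 x) (g := φ 0) 2 2 fun x y => ?_)⟩
  · rw [emb_inl_sq]
    ring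
  · exact ENNReal.add_ne_top.2
      ⟨ENNReal.mul_ne_top (by simp) (ne_top_of_le_ne_top (by simp) (henergy 0)),
        ENNReal.mul_ne_top (by simp) (G.energy_ne_top_of_finite (hφ 0))⟩
  · push_cast
    nlinarith [sq_nonneg ((f x - φ 0 x) - (f y - φ 0 y) - (φ 0 x - φ 0 y))]

-- Approximants of `f` need not converge in the weighted norm, but once truncated to `[-|f|, |f|]`
-- they stay bounded in it, so they converge weakly.
theorem emb_mem_closure_finCore {U f : V → ℝ} (hf : f ∈ G.formDomPot U) :
    (⟨_, G.memℓp_emb_of_mem_formDomPot hf⟩ : lp (fun _ : V ⊕ V × V => ℝ) 2)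
      ∈ (G.finCore U).topologicalClosure := by
  obtain ⟨φ, hφ, henergy, htendsto⟩ := G.exists_seq_tendsto_of_mem_formDom hf.1
  have hfin : ∀ k, (fun x => clampAbs (f x) (φ k x)).support.Finite := fun k =>
    (hφ k).subset fun x hx h => hx (by simp only [h, clampAbs_zero_right])
  refine mem_topologicalClosure_of_tendsto_coord (l := atTop)
    (a := fun k => ⟨_, G.memℓp_emb_of_finite U (hfin k)⟩)
    (fun k => Submodule.le_topologicalClosure _ ⟨_, hfin k, fun i => rfl⟩)
    (fun k => G.norm_emb_clampAbs_le (G.memℓp_emb_of_mem_formDomPot hf) (henergy k) fun _ => rfl)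
    (G.tendsto_emb U fun x => ?_)
  have hclamp := ((continuous_clampAbs (f x)).tendsto (f x)).comp (htendsto x)
  rwa [clampAbs_self] at hclamp

theorem energy_add_eLpNorm_sq_le (U f : V → ℝ) :
    G.energy f + eLpNorm f 2 G.vol ^ 2 ≤ ∑' i, ENNReal.ofReal (G.emb U f i ^ 2) := by
  rw [tsum_ofReal_emb_sq, add_comm, eLpNorm_two_sq]
  gcongr with x
  rw [emb_inl_sq]
  have := G.m_pos x
  gcongr
  nlinarith [mul_nonneg (abs_nonneg (U x)) (sq_nonneg (f x))]

theorem mem_formDom_of_mem_closure_finCore {U f : V → ℝ} {a : lp (fun _ : V ⊕ V × V => ℝ) 2}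
    (ha : a ∈ (G.finCore U).topologicalClosure) (haf : ∀ i, a i = G.emb U f i) :
    f ∈ G.formDom := by
  have hnorm : ∀ (b : lp (fun _ : V ⊕ V × V => ℝ) 2) (g : V → ℝ), (∀ i, b i = G.emb U g i) →
      G.energy g + eLpNorm g 2 G.vol ^ 2 ≤ ENNReal.ofReal (‖b‖ ^ 2) := fun b g hb => by
    simp_rw [ofReal_lp_norm_sq, hb]
    exact G.energy_add_eLpNorm_sq_le U g
  refine ⟨⟨G.aestronglyMeasurable_vol f, ?_⟩, fun ε hε => ?_⟩
  · have hlt := (le_add_self.trans (hnorm a f haf)).trans_lt ENNReal.ofReal_lt_top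
    exact lt_top_iff_ne_top.2 (ENNReal.pow_ne_top_iff.1 hlt.ne |>.resolve_right two_ne_zero)
  · obtain ⟨δ, hδ, hδε⟩ := ENNReal.lt_iff_exists_nnreal_btwn.1 hε
    obtain ⟨b, ⟨φ, hφ, hbφ⟩, hab⟩ :=
      Metric.mem_closure_iff.1 ha (√δ) (Real.sqrt_pos.2 (by exact_mod_cast hδ))
    refine ⟨φ, hφ, (hnorm (a - b) (f - φ) fun i => ?_).trans_lt (lt_of_le_of_lt ?_ hδε)⟩
    · rw [emb_sub, ← haf, ← hbφ]
      rfl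
    · rw [← ENNReal.ofReal_coe_nnreal]
      refine ENNReal.ofReal_le_ofReal ?_
      rw [← Real.sq_sqrt δ.coe_nonneg, ← dist_eq_norm]
      exact pow_le_pow_left₀ dist_nonneg hab.le 2

theorem mem_formDomPot_iff {U f : V → ℝ} : f ∈ G.formDomPot U ↔
    ∃ a ∈ (G.finCore U).topologicalClosure, ∀ i, a i = G.emb U f i := by
  refine ⟨fun hf => ⟨_, G.emb_mem_closure_finCore hf, fun _ => rfl⟩, ?_⟩
  rintro ⟨a, ha, haf⟩
  refine ⟨G.mem_formDom_of_mem_closure_finCore ha haf, ?_⟩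
  have hmass := (G.memℓp_emb_iff.1 (funext haf ▸ lp.memℓp a)).1
  refine hmass.of_nonneg_of_le (fun x => ?_) fun x => ?_ <;> have := G.m_pos x
  · positivity
  · rw [emb_inl_sq]
    gcongr
    linarith

end FormDomain

section BoundedForm

variable {V : Type*} (G : MWG V)

/-- The multiplier on `ℓ²` that represents the form `Q + U` under `MWG.emb`. -/
noncomputable def formMult (U : V → ℝ) : V ⊕ V × V → ℝ :=
  Sum.elim (fun x => U x / (1 + |U x|)) fun _ => 1

/-- The multiplier on `ℓ²` that represents the `L²` inner product under `MWG.emb`. -/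
noncomputable def massMult (U : V → ℝ) : V ⊕ V × V → ℝ :=
  Sum.elim (fun x => 1 / (1 + |U x|)) fun _ => 0

theorem abs_formMult_le_one (U : V → ℝ) (i : V ⊕ V × V) : |formMult U i| ≤ 1 := by
  cases i with
  | inl x =>
    have hpos : 0 < 1 + |U x| := by positivity
    rw [formMult, Sum.elim_inl, abs_div, abs_of_pos hpos, div_le_one hpos]
    linarith
  | inr p => simp [formMult]

theorem abs_massMult_le_one (U : V → ℝ) (i : V ⊕ V × V) : |massMult U i| ≤ 1 := by
  cases i with
  | inl x =>
    have hpos : 0 < 1 + |U x| := by positivity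
    rw [massMult, Sum.elim_inl, abs_of_pos (by positivity), div_le_one hpos]
    linarith [abs_nonneg (U x)]
  | inr p => simp [massMult]

/-- The form `Q + U` as a bounded operator on `ℓ²`. -/
noncomputable def formOp (U : V → ℝ) :
    lp (fun _ : V ⊕ V × V => ℝ) 2 →L[ℝ] lp (fun _ : V ⊕ V × V => ℝ) 2 :=
  diagOp (formMult U) (abs_formMult_le_one U)

/-- The `L²` inner product as a bounded operator on `ℓ²`. -/
noncomputable def massOp (U : V → ℝ) :
    lp (fun _ : V ⊕ V × V => ℝ) 2 →L[ℝ] lp (fun _ : V ⊕ V × V => ℝ) 2 :=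
  diagOp (massMult U) (abs_massMult_le_one U)

theorem schroForm_eq_inner {U f g : V → ℝ} {a b : lp (fun _ : V ⊕ V × V => ℝ) 2}
    (ha : ∀ i, a i = G.emb U f i) (hb : ∀ i, b i = G.emb U g i) :
    G.schroForm U f g = inner ℝ a (formOp U b) := by
  rw [lp_inner_eq_tsum_inl_add_tsum_inr, schroForm, Q, ip, add_comm, ← tsum_mul_left]
  simp only [formOp, diagOp_apply, ha, hb, emb_inl, emb_inr, formMult, Sum.elim_inl, Sum.elim_inr]
  congr 1
  · refine tsum_congr fun x => ?_
    have hpos : 0 < 1 + |U x| := by positivity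
    have hsqrt := Real.mul_self_sqrt (mul_pos (G.m_pos x) hpos).le
    field_simp
    linear_combination (-f x * U x * g x) * hsqrt
  · refine tsum_congr fun p => ?_
    have hsqrt := Real.mul_self_sqrt (div_nonneg (G.w_nonneg p.1 p.2) zero_le_two)
    linear_combination (-(f p.1 - f p.2) * (g p.1 - g p.2)) * hsqrt

theorem ip_eq_inner {U f g : V → ℝ} {a b : lp (fun _ : V ⊕ V × V => ℝ) 2}
    (ha : ∀ i, a i = G.emb U f i) (hb : ∀ i, b i = G.emb U g i) :
    G.ip f g = inner ℝ a (massOp U b) := by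
  rw [lp_inner_eq_tsum_inl_add_tsum_inr, ip]
  simp only [massOp, diagOp_apply, ha, hb, emb_inl, massMult, Sum.elim_inl, Sum.elim_inr,
    zero_mul, mul_zero, tsum_zero, add_zero]
  refine tsum_congr fun x => ?_
  have hpos : 0 < 1 + |U x| := by positivity
  have hsqrt := Real.mul_self_sqrt (mul_pos (G.m_pos x) hpos).le
  field_simp
  linear_combination (-f x * g x) * hsqrt

theorem exists_ip_eq_inner (U : V → ℝ) {g : V → ℝ} (hg : Summable fun x => G.m x * g x ^ 2) :
    ∃ c : lp (fun _ : V ⊕ V × V => ℝ) 2, ∀ (f : V → ℝ) (a : lp (fun _ : V ⊕ V × V => ℝ) 2),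
      (∀ i, a i = G.emb U f i) → G.ip g f = inner ℝ c a := by
  have hpos : ∀ x, 0 < G.m x * (1 + |U x|) := fun x => mul_pos (G.m_pos x) (by positivity)
  set c : V ⊕ V × V → ℝ := Sum.elim (fun x => G.m x * g x / √(G.m x * (1 + |U x|))) fun _ => 0
  have hc : Memℓp c 2 := by
    refine memℓp_two_iff_summable_sq.2 (Summable.sum _ ?_ (summable_zero.congr fun p => ?_))
    · refine Summable.of_nonneg_of_le (fun x => sq_nonneg _) (fun x => ?_) hg
      simp only [c, Function.comp_apply, Sum.elim_inl]
      rw [div_pow, Real.sq_sqrt (hpos x).le, div_le_iff₀ (hpos x)]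
      linarith [mul_nonneg (mul_nonneg (sq_nonneg (G.m x)) (abs_nonneg (U x))) (sq_nonneg (g x))]
    · simp [c]
  refine ⟨⟨c, hc⟩, fun f a ha => ?_⟩
  rw [lp_inner_eq_tsum_inl_add_tsum_inr, ip]
  simp only [ha, emb_inl, c, Sum.elim_inl, Sum.elim_inr, zero_mul, tsum_zero, add_zero]
  refine tsum_congr fun x => ?_
  have hsqrt := (Real.sqrt_pos.2 (hpos x)).ne'
  field_simp

/-- The form `Q + U + l` controls the form norm on finitely supported functions. -/
structure Coercive (U : V → ℝ) (l C : ℝ) : Prop where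
  l_nonneg : 0 ≤ l
  C_pos : 0 < C
  le : ∀ φ : V → ℝ, φ.support.Finite →
    ∑' i, G.emb U φ i ^ 2 ≤ C * (G.schroForm U φ φ + l * G.ip φ φ)

variable {G} {U : V → ℝ} {l C : ℝ}

theorem Coercive.lowerBound (h : G.Coercive U l C) : G.LowerBound U l := fun φ hφ => by
  have hnonneg := (tsum_nonneg fun i => sq_nonneg (G.emb U φ i)).trans (h.le φ hφ)
  linarith [nonneg_of_mul_nonneg_right hnonneg h.C_pos]

theorem Coercive.norm_sq_le (h : G.Coercive U l C) {f : V → ℝ}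
    {a : lp (fun _ : V ⊕ V × V => ℝ) 2} (ha : a ∈ (G.finCore U).topologicalClosure)
    (haf : ∀ i, a i = G.emb U f i) :
    ‖a‖ ^ 2 ≤ C * (G.schroForm U f f + l * G.ip f f) := by
  rw [G.schroForm_eq_inner haf haf, G.ip_eq_inner haf haf]
  have hclosed : IsClosed {b : lp (fun _ : V ⊕ V × V => ℝ) 2 | ‖b‖ ^ 2 ≤
      C * (inner ℝ b (formOp U b) + l * inner ℝ b (massOp U b))} :=
    isClosed_le (by fun_prop) (by fun_prop)
  refine closure_minimal ?_ hclosed ha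
  rintro b ⟨φ, hφ, hb⟩
  rw [Set.mem_ofPred_eq, ← G.schroForm_eq_inner hb hb, ← G.ip_eq_inner hb hb,
    lp_norm_sq_eq_tsum]
  simp_rw [hb]
  exact h.le φ hφ

theorem ip_eq_sum_support (g : V → ℝ) {φ : V → ℝ} (hφ : φ.support.Finite) :
    G.ip g φ = ∑ x ∈ hφ.toFinset, G.m x * (g x * φ x) :=
  G.ip_eq_sum g (notMem_support_toFinset hφ)

variable [Countable V] [MeasurableSpace V] [DiscreteMeasurableSpace V]

theorem mem_formDomPot_of_finite (U : V → ℝ) {φ : V → ℝ} (hφ : φ.support.Finite) :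
    φ ∈ G.formDomPot U :=
  G.mem_formDomPot_iff.2 ⟨⟨_, G.memℓp_emb_of_finite U hφ⟩,
    Submodule.le_topologicalClosure _ ⟨φ, hφ, fun _ => rfl⟩, fun _ => rfl⟩

theorem Coercive.schroForm_self_ge (h : G.Coercive U l C) {f : V → ℝ}
    (hf : f ∈ G.formDomPot U) : -(l * G.ip f f) ≤ G.schroForm U f f := by
  obtain ⟨a, ha, haf⟩ := G.mem_formDomPot_iff.1 hf
  have hnonneg := (sq_nonneg _).trans (h.norm_sq_le ha haf)
  linarith [nonneg_of_mul_nonneg_right hnonneg h.C_pos]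

theorem isSchrodinger_of_finite_support {u g : Lp ℝ 2 G.vol} (hu : (u : V → ℝ) ∈ G.formDomPot U)
    (h : ∀ φ : V → ℝ, φ.support.Finite → G.schroForm U u φ = G.ip g φ) :
    G.IsSchrodinger U u g := by
  refine ⟨hu, fun v hv => ?_⟩
  change G.schroForm U u v = G.ip g v
  obtain ⟨a, -, hau⟩ := G.mem_formDomPot_iff.1 hu
  obtain ⟨b, hb, hbv⟩ := G.mem_formDomPot_iff.1 hv
  obtain ⟨c, hc⟩ := G.exists_ip_eq_inner U (G.summable_sq_Lp g)
  rw [G.schroForm_eq_inner hau hbv, hc v b hbv]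
  have hclosed : IsClosed {b : lp (fun _ : V ⊕ V × V => ℝ) 2 |
      inner ℝ a (formOp U b) = inner ℝ c b} := isClosed_eq (by fun_prop) (by fun_prop)
  refine closure_minimal ?_ hclosed hb
  rintro d ⟨φ, hφ, hd⟩
  rw [Set.mem_ofPred_eq, ← G.schroForm_eq_inner hau hd, ← hc φ d hd]
  exact h φ hφ

theorem mem_formDomPot_of_tendsto {κ : Type*} {L : Filter κ} [L.NeBot] {f : κ → V → ℝ}
    {g : V → ℝ} {a : κ → lp (fun _ : V ⊕ V × V => ℝ) 2} {B : ℝ}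
    (ha : ∀ k, a k ∈ (G.finCore U).topologicalClosure) (haf : ∀ k i, a k i = G.emb U (f k) i)
    (hB : ∀ k, ‖a k‖ ≤ B) (h : ∀ x, Tendsto (fun k => f k x) L (𝓝 (g x))) :
    g ∈ G.formDomPot U := by
  have htendsto : ∀ i, Tendsto (fun k => a k i) L (𝓝 (G.emb U g i)) := fun i => by
    simp_rw [haf]
    exact G.tendsto_emb U h i
  have hmem : Memℓp (G.emb U g) 2 :=
    lp.memℓp_of_tendsto (l := L) (F := a)
      (isBounded_iff_forall_norm_le.2 ⟨B, Set.forall_mem_range.2 hB⟩) (tendsto_pi_nhds.2 htendsto)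
  exact G.mem_formDomPot_iff.2
    ⟨⟨_, hmem⟩, mem_topologicalClosure_of_tendsto_coord ha hB htendsto, fun _ => rfl⟩

theorem tendsto_Lp_apply {κ : Type*} {L : Filter κ} {u : κ → Lp ℝ 2 G.vol} {v : Lp ℝ 2 G.vol}
    (h : Tendsto u L (𝓝 v)) (x : V) : Tendsto (fun k => u k x) L (𝓝 (v x)) :=
  ((G.evalLp x).continuous.tendsto v).comp h

theorem IsSchrodinger.schroForm_self_le {u g : Lp ℝ 2 G.vol} (h : G.IsSchrodinger U u g) :
    G.schroForm U u u ≤ ‖g‖ * ‖u‖ := by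
  have hform : G.schroForm U u u = inner ℝ g u := (h.2 _ h.1).trans (G.inner_Lp g u).symm
  exact hform.trans_le (real_inner_le_norm _ _)

theorem Coercive.isSchrodinger_of_tendsto (h : G.Coercive U l C) {u g : ℕ → Lp ℝ 2 G.vol}
    {u₀ g₀ : Lp ℝ 2 G.vol} (hs : ∀ k, G.IsSchrodinger U (u k) (g k))
    (hu : Tendsto u atTop (𝓝 u₀)) (hg : Tendsto g atTop (𝓝 g₀)) : G.IsSchrodinger U u₀ g₀ := by
  choose a ha hau using fun k => G.mem_formDomPot_iff.1 (hs k).1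
  obtain ⟨Bu, hBu⟩ := hu.norm.bddAbove_range
  obtain ⟨Bg, hBg⟩ := hg.norm.bddAbove_range
  replace hBu : ∀ k, ‖u k‖ ≤ Bu := Set.forall_mem_range.1 hBu
  replace hBg : ∀ k, ‖g k‖ ≤ Bg := Set.forall_mem_range.1 hBg
  refine isSchrodinger_of_finite_support (mem_formDomPot_of_tendsto (L := atTop) ha hau
    (B := √(C * (Bg * Bu + l * Bu ^ 2))) (fun k => ?_) fun x => tendsto_Lp_apply hu x) ?_
  · have hC := h.C_pos
    have hl := h.l_nonneg
    have hBg0 := (norm_nonneg _).trans (hBg k)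
    refine Real.le_sqrt_of_sq_le ((h.norm_sq_le (ha k) (hau k)).trans ?_)
    rw [← inner_Lp, real_inner_self_eq_norm_sq]
    gcongr
    · exact (hs k).schroForm_self_le.trans
        (mul_le_mul (hBg k) (hBu k) (norm_nonneg _) hBg0)
    · exact hBu k
  · intro φ hφ
    refine tendsto_nhds_unique (G.tendsto_schroForm U (fun x => tendsto_Lp_apply hu x) hφ) ?_
    have hweak : ∀ k, G.schroForm U (u k) φ = G.ip (g k) φ := fun k =>
      (hs k).2 φ (mem_formDomPot_of_finite U hφ)
    simp_rw [hweak, ip_eq_sum_support _ hφ]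
    exact tendsto_finsetSum _ fun x _ => ((tendsto_Lp_apply hg x).mul_const _).const_mul _

end BoundedForm

section TimeIntegral

variable {V : Type*} {G : MWG V} {U : V → ℝ} {l C s t : ℝ} {F : Finset V}

theorem intervalIntegrable_lap {u : ℝ → V → ℝ} {a b : ℝ}
    (hu : ∀ x, IntervalIntegrable (fun s => u s x) volume a b) (x : V) :
    IntervalIntegrable (fun s => G.lap (u s) x) volume a b := by
  simp only [lap_eq_sum]
  simpa only [Finset.sum_fn] using IntervalIntegrable.sum (G.nbr x)
    (f := fun y s => G.w x y / G.m x * (u s y - u s x))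
    fun y _ => ((hu y).sub (hu x)).const_mul _

theorem lap_integral {u : ℝ → V → ℝ} {a b : ℝ}
    (hu : ∀ x, IntervalIntegrable (fun s => u s x) volume a b) (x : V) :
    G.lap (fun y => ∫ s in a..b, u s y) x = ∫ s in a..b, G.lap (u s) x := by
  simp only [lap_eq_sum]
  rw [intervalIntegral.integral_finsetSum fun y _ => ((hu y).sub (hu x)).const_mul _]
  refine Finset.sum_congr rfl fun y _ => ?_
  rw [intervalIntegral.integral_const_mul, intervalIntegral.integral_sub (hu y) (hu x)]

variable (G) in
/-- The time integral over `[0, t]` of the Dirichlet heat flow on `F` started at `f`. -/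
noncomputable def heatInt (U : V → ℝ) (F : Finset V) (t : ℝ) (f : V → ℝ) (x : V) : ℝ :=
  ∫ s in (0 : ℝ)..t, G.heat U F s f x

theorem heatInt_notMem (t : ℝ) (f : V → ℝ) {x : V} (hx : x ∉ F) : G.heatInt U F t f x = 0 := by
  simp [heatInt, heat_notMem _ _ hx]

theorem support_heatInt_finite (t : ℝ) (f : V → ℝ) : (G.heatInt U F t f).support.Finite :=
  F.finite_toSet.subset fun _ hx => by_contra fun h => hx (heatInt_notMem t f h)

theorem intervalIntegrable_heat (f : V → ℝ) (x : V) (a b : ℝ) :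
    IntervalIntegrable (fun s => G.heat U F s f x) volume a b :=
  (continuous_heat f x).intervalIntegrable a b

theorem neg_lap_heatInt_add_mul (t : ℝ) (f : V → ℝ) {x : V} (hx : x ∈ F) :
    -G.lap (G.heatInt U F t f) x + U x * G.heatInt U F t f x = f x - G.heat U F t f x := by
  have hint := fun y => intervalIntegrable_heat (G := G) (U := U) (F := F) f y 0 t
  have hftc := intervalIntegral.integral_eq_sub_of_hasDerivAt (a := 0) (b := t)
    (fun s _ => hasDerivAt_heat (G := G) (U := U) s f hx)
    ((intervalIntegrable_lap hint x).sub ((hint x).const_mul _))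
  rw [intervalIntegral.integral_sub (intervalIntegrable_lap hint x) ((hint x).const_mul _),
    intervalIntegral.integral_const_mul, ← lap_integral hint, heat_zero f hx] at hftc
  change -G.lap (fun y => ∫ s in (0 : ℝ)..t, G.heat U F s f y) x +
    U x * ∫ s in (0 : ℝ)..t, G.heat U F s f x = _
  linarith

theorem sum_mul_le_sqrt_mul_sqrt (F : Finset V) (g h : V → ℝ) :
    ∑ x ∈ F, G.m x * (g x * h x)
      ≤ √(∑ x ∈ F, G.m x * g x ^ 2) * √(∑ x ∈ F, G.m x * h x ^ 2) := by
  have hsqrt : ∀ x, √(G.m x) ^ 2 = G.m x := fun x => Real.sq_sqrt (G.m_pos x).le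
  have hcs := Real.sum_mul_le_sqrt_mul_sqrt F (fun x => √(G.m x) * g x) fun x => √(G.m x) * h x
  simp only [mul_pow, hsqrt] at hcs
  refine le_of_eq_of_le (Finset.sum_congr rfl fun x _ => ?_) hcs
  linear_combination (-(g x * h x)) * hsqrt x

variable [Countable V] [MeasurableSpace V] [DiscreteMeasurableSpace V]

theorem sum_sq_le_norm_sq (F : Finset V) (f : Lp ℝ 2 G.vol) :
    ∑ x ∈ F, G.m x * f x ^ 2 ≤ ‖f‖ ^ 2 := by
  rw [norm_sq_Lp]
  exact (G.summable_sq_Lp f).sum_le_tsum F fun x _ => G.mul_sq_nonneg f x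

theorem sqrt_sum_heat_sq_le (hl0 : 0 ≤ l) (hl : G.LowerBound U l) (hs : 0 ≤ s) (hst : s ≤ t)
    (f : Lp ℝ 2 G.vol) :
    √(∑ x ∈ F, G.m x * G.heat U F s f x ^ 2) ≤ Real.exp (l * t) * ‖f‖ := by
  refine (Real.sqrt_le_left (by positivity)).2 ((heat_sq_le hl hs f).trans ?_)
  rw [mul_pow, ← Real.exp_nat_mul, Nat.cast_ofNat, mul_assoc]
  gcongr
  · exact Finset.sum_nonneg fun x _ => G.mul_sq_nonneg f x
  · exact sum_sq_le_norm_sq F f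

theorem abs_heat_le (hl0 : 0 ≤ l) (hl : G.LowerBound U l) (hs : 0 ≤ s) (hst : s ≤ t)
    (f : Lp ℝ 2 G.vol) (x : V) :
    |G.heat U F s f x| ≤ Real.exp (l * t) * ‖f‖ / √(G.m x) := by
  by_cases hx : x ∈ F
  · rw [le_div_iff₀ (Real.sqrt_pos.2 (G.m_pos x)), mul_comm, ← Real.sqrt_sq_eq_abs,
      ← Real.sqrt_mul (G.m_pos x).le]
    refine (Real.sqrt_le_sqrt ?_).trans (sqrt_sum_heat_sq_le (F := F) hl0 hl hs hst f)
    exact Finset.single_le_sum (f := fun x => G.m x * G.heat U F s f x ^ 2)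
      (fun y _ => G.mul_sq_nonneg _ y) hx
  · rw [heat_notMem _ _ hx, abs_zero]
    positivity

theorem sum_mul_heatInt_le (hl0 : 0 ≤ l) (hl : G.LowerBound U l) (ht : 0 ≤ t)
    (g : V → ℝ) (f : Lp ℝ 2 G.vol) :
    ∑ x ∈ F, G.m x * (g x * G.heatInt U F t f x)
      ≤ √(∑ x ∈ F, G.m x * g x ^ 2) * (t * (Real.exp (l * t) * ‖f‖)) := by
  calc ∑ x ∈ F, G.m x * (g x * G.heatInt U F t f x)
      = ∫ s in (0 : ℝ)..t, ∑ x ∈ F, G.m x * (g x * G.heat U F s f x) := by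
        rw [intervalIntegral.integral_finsetSum fun x _ =>
          ((intervalIntegrable_heat f x 0 t).const_mul _).const_mul _]
        simp only [intervalIntegral.integral_const_mul, heatInt]
    _ ≤ ∫ _s in (0 : ℝ)..t, √(∑ x ∈ F, G.m x * g x ^ 2) * (Real.exp (l * t) * ‖f‖) := by
        have hcont : Continuous fun s => ∑ x ∈ F, G.m x * (g x * G.heat U F s f x) :=
          continuous_finsetSum _ fun x _ => ((continuous_heat f x).const_mul _).const_mul _
        refine intervalIntegral.integral_mono_on ht (hcont.intervalIntegrable 0 t)
          intervalIntegrable_const fun s hs => (sum_mul_le_sqrt_mul_sqrt F _ _).trans ?_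
        exact mul_le_mul_of_nonneg_left (sqrt_sum_heat_sq_le hl0 hl hs.1 hs.2 f)
          (Real.sqrt_nonneg _)
    _ = √(∑ x ∈ F, G.m x * g x ^ 2) * (t * (Real.exp (l * t) * ‖f‖)) := by
        rw [intervalIntegral.integral_const, sub_zero, smul_eq_mul, mul_left_comm]

theorem ip_heatInt_le (hl0 : 0 ≤ l) (hl : G.LowerBound U l) (ht : 0 ≤ t) (f : Lp ℝ 2 G.vol) :
    G.ip (G.heatInt U F t f) (G.heatInt U F t f) ≤ (t * (Real.exp (l * t) * ‖f‖)) ^ 2 := by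
  have hdual := sum_mul_heatInt_le (F := F) hl0 hl ht (G.heatInt U F t f) f
  rw [G.ip_eq_sum _ fun x hx => heatInt_notMem t f hx]
  simp only [← sq] at hdual ⊢
  have hnonneg : 0 ≤ ∑ x ∈ F, G.m x * G.heatInt U F t f x ^ 2 :=
    Finset.sum_nonneg fun x _ => G.mul_sq_nonneg _ x
  refine (Real.sqrt_le_left (by positivity)).1 (le_of_not_gt fun hlt => hdual.not_gt ?_)
  calc _ < √_ * √_ := mul_lt_mul_of_pos_left hlt (lt_of_le_of_lt (by positivity) hlt)
    _ = _ := Real.mul_self_sqrt hnonneg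

theorem schroForm_heatInt_le (hl0 : 0 ≤ l) (hl : G.LowerBound U l) (ht : 0 ≤ t)
    (f : Lp ℝ 2 G.vol) :
    G.schroForm U (G.heatInt U F t f) (G.heatInt U F t f)
      ≤ (‖f‖ + Real.exp (l * t) * ‖f‖) * (t * (Real.exp (l * t) * ‖f‖)) := by
  have hinit := sum_mul_heatInt_le (F := F) hl0 hl ht f f
  have hflow := sum_mul_heatInt_le (F := F) hl0 hl ht (fun x => -G.heat U F t f x) f
  simp only [neg_sq] at hflow
  calc G.schroForm U (G.heatInt U F t f) (G.heatInt U F t f)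
      = ∑ x ∈ F, G.m x * (f x * G.heatInt U F t f x)
        + ∑ x ∈ F, G.m x * (-G.heat U F t f x * G.heatInt U F t f x) := by
        rw [G.schroForm_eq_sum U _ fun x hx => heatInt_notMem t f hx, ← Finset.sum_add_distrib]
        refine Finset.sum_congr rfl fun x hx => ?_
        rw [neg_lap_heatInt_add_mul t f hx]
        ring
    _ ≤ ‖f‖ * (t * (Real.exp (l * t) * ‖f‖))
        + Real.exp (l * t) * ‖f‖ * (t * (Real.exp (l * t) * ‖f‖)) := by
        refine add_le_add (hinit.trans ?_) (hflow.trans ?_) <;> gcongr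
        · exact (Real.sqrt_le_left (norm_nonneg f)).2 (sum_sq_le_norm_sq F f)
        · exact sqrt_sum_heat_sq_le hl0 hl ht le_rfl f
    _ = _ := (add_mul _ _ _).symm

theorem intervalIntegrable_heatOp (hl : G.LowerBound U l) (ht : 0 ≤ t)
    (f : Lp ℝ 2 G.vol) : IntervalIntegrable (fun s => G.heatOp U s f) volume 0 t := by
  refine ContinuousOn.intervalIntegrable ((continuousOn_heatOp hl f).mono ?_)
  rw [Set.uIcc_of_le ht]
  exact fun s hs => hs.1

theorem tendsto_heatInt (hl0 : 0 ≤ l) (hl : G.LowerBound U l) (ht : 0 ≤ t)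
    (f : Lp ℝ 2 G.vol) (x : V) :
    Tendsto (fun F : Finset V => G.heatInt U F t f x) atTop
      (𝓝 ((∫ s in (0 : ℝ)..t, G.heatOp U s f : Lp ℝ 2 G.vol) x)) := by
  have heval : (∫ s in (0 : ℝ)..t, G.heatOp U s f : Lp ℝ 2 G.vol) x
      = ∫ s in (0 : ℝ)..t, G.heatOp U s f x := by
    rw [← evalLp_apply, ← ContinuousLinearMap.intervalIntegral_comp_comm _
      (intervalIntegrable_heatOp hl ht f)]
    rfl
  rw [heval]
  refine intervalIntegral.tendsto_integral_filter_of_dominated_convergence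
    (fun _ => Real.exp (l * t) * ‖f‖ / √(G.m x)) ?_ ?_ intervalIntegrable_const ?_
  · exact Eventually.of_forall fun F => (continuous_heat _ x).aestronglyMeasurable
  · refine Eventually.of_forall fun F => Eventually.of_forall fun s hs => ?_
    rw [Set.uIoc_of_le ht] at hs
    exact abs_heat_le hl0 hl hs.1.le hs.2 f x
  · refine Eventually.of_forall fun s hs => ?_
    rw [Set.uIoc_of_le ht] at hs
    exact tendsto_heat_heatOp hl hs.1.le f x

theorem tendsto_schroForm_heatInt (hl : G.LowerBound U l) (ht : 0 ≤ t) (f : Lp ℝ 2 G.vol)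
    {φ : V → ℝ} (hφ : φ.support.Finite) :
    Tendsto (fun F : Finset V => G.schroForm U (G.heatInt U F t f) φ) atTop
      (𝓝 (G.ip ((f - G.heatOp U t f : Lp ℝ 2 G.vol) : V → ℝ) φ)) := by
  have hsum : Tendsto (fun F : Finset V => ∑ x ∈ hφ.toFinset,
      G.m x * ((f x - G.heat U F t f x) * φ x)) atTop
      (𝓝 (∑ x ∈ hφ.toFinset, G.m x * ((f x - G.heatOp U t f x) * φ x))) :=
    tendsto_finsetSum _ fun x _ =>
      ((tendsto_const_nhds.sub (tendsto_heat_heatOp hl ht f x)).mul_const _).const_mul _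
  rw [ip_eq_sum_support _ hφ, coe_sub_Lp]
  refine hsum.congr' ?_
  filter_upwards [eventually_ge_atTop hφ.toFinset] with F hF
  rw [G.schroForm_eq_sum U _ (notMem_support_toFinset hφ)]
  exact Finset.sum_congr rfl fun x hx => by rw [neg_lap_heatInt_add_mul t f (hF hx)]

theorem Coercive.isSchrodinger_integral (h : G.Coercive U l C) (ht : 0 ≤ t) (f : Lp ℝ 2 G.vol) :
    G.IsSchrodinger U (∫ s in (0 : ℝ)..t, G.heatOp U s f) (f - G.heatOp U t f) := by
  have hl := h.lowerBound
  have hlim := tendsto_heatInt h.l_nonneg hl ht f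
  set K : ℝ := t * (Real.exp (l * t) * ‖f‖)
  refine isSchrodinger_of_finite_support (mem_formDomPot_of_tendsto (L := atTop)
    (f := fun F => G.heatInt U F t f)
    (a := fun F => ⟨_, G.memℓp_emb_of_finite U (support_heatInt_finite t f)⟩)
    (B := √(C * ((‖f‖ + Real.exp (l * t) * ‖f‖) * K + l * K ^ 2)))
    (fun F => Submodule.le_topologicalClosure _ ⟨_, support_heatInt_finite t f, fun _ => rfl⟩)
    (fun _ _ => rfl) (fun F => Real.le_sqrt_of_sq_le ?_) hlim) fun φ hφ =>
      tendsto_nhds_unique (G.tendsto_schroForm U hlim hφ) (tendsto_schroForm_heatInt hl ht f hφ)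
  rw [lp_norm_sq_eq_tsum]
  refine (h.le _ (support_heatInt_finite t f)).trans (mul_le_mul_of_nonneg_left ?_ h.C_pos.le)
  exact add_le_add (schroForm_heatInt_le h.l_nonneg hl ht f)
    (mul_le_mul_of_nonneg_left (ip_heatInt_le h.l_nonneg hl ht f) h.l_nonneg)

end TimeIntegral

section Generation

variable {V : Type*} {G : MWG V} {U : V → ℝ} {l C : ℝ} [MeasurableSpace V]
  {S R : ℝ → Lp ℝ 2 G.vol →L[ℝ] Lp ℝ 2 G.vol}

theorem Generates.isSchrodinger_apply (hS : G.Generates U S) {f g : Lp ℝ 2 G.vol}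
    (hfg : G.IsSchrodinger U f g) {t : ℝ} (ht : 0 ≤ t) : G.IsSchrodinger U (S t f) (S t g) := by
  rw [hS.gen]
  have hlim := ((S t).continuous.tendsto (-g)).comp ((hS.gen f g).1 hfg)
  rw [map_neg] at hlim
  refine hlim.congr' ?_
  filter_upwards [self_mem_nhdsWithin] with s hs
  rw [Function.comp_apply, map_smul, map_sub, ← ContinuousLinearMap.comp_apply,
    ← ContinuousLinearMap.comp_apply, ← hS.add t s ht (le_of_lt hs),
    ← hS.add s t (le_of_lt hs) ht, add_comm]

theorem Generates.hasDerivWithinAt (hS : G.Generates U S) {f g : Lp ℝ 2 G.vol}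
    (hfg : G.IsSchrodinger U f g) {t : ℝ} (ht : 0 ≤ t) :
    HasDerivWithinAt (fun s => S s f) (-S t g) (Set.Ici t) t := by
  rw [← hasDerivWithinAt_Ioi_iff_Ici, hasDerivWithinAt_iff_tendsto_slope' (by simp)]
  have hshift : Tendsto (fun s : ℝ => s - t) (𝓝[>] t) (𝓝[>] 0) := by
    refine tendsto_nhdsWithin_iff.2 ⟨?_, ?_⟩
    · have hcont : Continuous fun s : ℝ => s - t := by fun_prop
      simpa using (hcont.tendsto t).mono_left nhdsWithin_le_nhds
    · filter_upwards [self_mem_nhdsWithin] with s hs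
      exact Set.mem_Ioi.2 (sub_pos.2 hs)
  refine (((hS.gen _ _).1 (hS.isSchrodinger_apply hfg ht)).comp hshift).congr' ?_
  filter_upwards [self_mem_nhdsWithin] with s hs
  rw [Function.comp_apply, slope_def_module, ← ContinuousLinearMap.comp_apply,
    ← hS.add _ _ (sub_nonneg.2 (le_of_lt hs)) ht, sub_add_cancel]

variable [Countable V] [DiscreteMeasurableSpace V]

theorem smul_mem_formDomPot {f : V → ℝ} (hf : f ∈ G.formDomPot U) (c : ℝ) :
    c • f ∈ G.formDomPot U := by
  obtain ⟨a, ha, haf⟩ := G.mem_formDomPot_iff.1 hf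
  refine G.mem_formDomPot_iff.2 ⟨c • a, Submodule.smul_mem _ c ha, fun i => ?_⟩
  rw [emb_smul, ← haf]
  rfl

theorem sub_mem_formDomPot {f g : V → ℝ} (hf : f ∈ G.formDomPot U) (hg : g ∈ G.formDomPot U) :
    f - g ∈ G.formDomPot U := by
  obtain ⟨a, ha, haf⟩ := G.mem_formDomPot_iff.1 hf
  obtain ⟨b, hb, hbg⟩ := G.mem_formDomPot_iff.1 hg
  refine G.mem_formDomPot_iff.2 ⟨a - b, Submodule.sub_mem _ ha hb, fun i => ?_⟩
  rw [emb_sub, ← haf, ← hbg]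
  rfl

theorem IsSchrodinger.smul {u g : Lp ℝ 2 G.vol} (h : G.IsSchrodinger U u g) (c : ℝ) :
    G.IsSchrodinger U (c • u) (c • g) := by
  refine isSchrodinger_of_finite_support ?_ fun φ hφ => ?_
  · rw [coe_smul_Lp]
    exact smul_mem_formDomPot h.1 c
  · have hweak : G.schroForm U u φ = G.ip g φ := h.2 φ (mem_formDomPot_of_finite U hφ)
    rw [G.schroForm_eq_sum U _ (notMem_support_toFinset hφ), ip_eq_sum_support _ hφ] at hweak ⊢
    rw [coe_smul_Lp, coe_smul_Lp]
    simp only [lap_smul, Pi.smul_apply, smul_eq_mul]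
    calc _ = c * ∑ x ∈ hφ.toFinset, G.m x * ((-G.lap u x + U x * u x) * φ x) := by
          rw [Finset.mul_sum]
          exact Finset.sum_congr rfl fun x _ => by ring
      _ = _ := by
          rw [hweak, Finset.mul_sum]
          exact Finset.sum_congr rfl fun x _ => by ring

theorem IsSchrodinger.sub {u g v k : Lp ℝ 2 G.vol} (hu : G.IsSchrodinger U u g)
    (hv : G.IsSchrodinger U v k) : G.IsSchrodinger U (u - v) (g - k) := by
  refine isSchrodinger_of_finite_support ?_ fun φ hφ => ?_
  · rw [coe_sub_Lp]
    exact sub_mem_formDomPot hu.1 hv.1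
  · have hweak_u : G.schroForm U u φ = G.ip g φ := hu.2 φ (mem_formDomPot_of_finite U hφ)
    have hweak_v : G.schroForm U v φ = G.ip k φ := hv.2 φ (mem_formDomPot_of_finite U hφ)
    rw [G.schroForm_eq_sum U _ (notMem_support_toFinset hφ), ip_eq_sum_support _ hφ]
      at hweak_u hweak_v ⊢
    rw [coe_sub_Lp, coe_sub_Lp]
    simp only [lap_sub, Pi.sub_apply]
    calc _ = ∑ x ∈ hφ.toFinset, G.m x * ((-G.lap u x + U x * u x) * φ x)
          - ∑ x ∈ hφ.toFinset, G.m x * ((-G.lap v x + U x * v x) * φ x) := by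
          rw [← Finset.sum_sub_distrib]
          exact Finset.sum_congr rfl fun x _ => by ring
      _ = _ := by
          rw [hweak_u, hweak_v, ← Finset.sum_sub_distrib]
          exact Finset.sum_congr rfl fun x _ => by ring

theorem IsSchrodinger.inner_symm {u g v k : Lp ℝ 2 G.vol} (hu : G.IsSchrodinger U u g)
    (hv : G.IsSchrodinger U v k) : inner ℝ g v = inner ℝ k u := by
  have hgv : G.schroForm U u v = G.ip g v := hu.2 _ hv.1
  have hku : G.schroForm U v u = G.ip k u := hv.2 _ hu.1
  rw [inner_Lp, inner_Lp, ← hgv, ← hku, schroForm_comm]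

theorem Coercive.neg_mul_norm_sq_le_inner (h : G.Coercive U l C) {u g : Lp ℝ 2 G.vol}
    (hug : G.IsSchrodinger U u g) : -(l * ‖u‖ ^ 2) ≤ inner ℝ u g := by
  have hform : G.schroForm U u u = G.ip g u := hug.2 _ hug.1
  have hge := h.schroForm_self_ge hug.1
  rwa [hform, ← inner_Lp, ← inner_Lp, real_inner_self_eq_norm_sq, real_inner_comm] at hge

theorem inner_integral_heatOp (hl : G.LowerBound U l) {t : ℝ} (ht : 0 ≤ t)
    (f g : Lp ℝ 2 G.vol) :
    inner ℝ g (∫ s in (0 : ℝ)..t, G.heatOp U s f)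
      = inner ℝ f (∫ s in (0 : ℝ)..t, G.heatOp U s g) := by
  have hcomm : ∀ k₁ k₂ : Lp ℝ 2 G.vol, inner ℝ k₁ (∫ s in (0 : ℝ)..t, G.heatOp U s k₂)
      = ∫ s in (0 : ℝ)..t, inner ℝ k₁ (G.heatOp U s k₂) := fun k₁ k₂ =>
    (ContinuousLinearMap.intervalIntegral_comp_comm (innerSL ℝ k₁)
      (intervalIntegrable_heatOp hl ht k₂)).symm
  rw [hcomm, hcomm]
  refine intervalIntegral.integral_congr fun s hs => ?_
  rw [Set.uIcc_of_le ht] at hs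
  rw [← heatOp_symm hl hs.1, real_inner_comm]

theorem tendsto_average_heatOp (hl : G.LowerBound U l) (f : Lp ℝ 2 G.vol) :
    Tendsto (fun t : ℝ => t⁻¹ • ∫ s in (0 : ℝ)..t, G.heatOp U s f) (𝓝[>] 0) (𝓝 f) := by
  have hcont := continuousOn_heatOp hl f
  have hderiv : HasDerivWithinAt (fun t => ∫ s in (0 : ℝ)..t, G.heatOp U s f) (G.heatOp U 0 f)
      (Set.Ioi 0) 0 := by
    refine (intervalIntegral.integral_hasDerivWithinAt_right (s := Set.Ici 0) (t := Set.Ioi 0)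
      IntervalIntegrable.refl ?_ ?_).mono Set.Ioi_subset_Ici_self
    · exact ⟨Set.Ioi 0, self_mem_nhdsWithin,
        (hcont.mono Set.Ioi_subset_Ici_self).aestronglyMeasurable measurableSet_Ioi⟩
    · exact (hcont 0 Set.self_mem_Ici).mono Set.Ioi_subset_Ici_self
  rw [hasDerivWithinAt_iff_tendsto_slope' (by simp), heatOp_zero hl,
    ContinuousLinearMap.id_apply] at hderiv
  refine hderiv.congr fun t => ?_
  simp [slope_def_module]

theorem Coercive.heatOp_sub_eq (h : G.Coercive U l C) {f g : Lp ℝ 2 G.vol}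
    (hfg : G.IsSchrodinger U f g) {t : ℝ} (ht : 0 ≤ t) :
    G.heatOp U t f - f = -∫ s in (0 : ℝ)..t, G.heatOp U s g := by
  refine ext_inner_right ℝ fun k => ?_
  have hsymm := hfg.inner_symm (h.isSchrodinger_integral ht k)
  rw [inner_integral_heatOp h.lowerBound ht, inner_sub_left] at hsymm
  rw [inner_neg_left, inner_sub_left, heatOp_symm h.lowerBound ht,
    real_inner_comm k (∫ s in (0 : ℝ)..t, G.heatOp U s g), hsymm, neg_sub,
    real_inner_comm (G.heatOp U t k) f, real_inner_comm k f]

theorem Coercive.generates (h : G.Coercive U l C) : G.Generates U (G.heatOp U) where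
  zero := heatOp_zero h.lowerBound
  add _ _ hs ht := heatOp_add h.lowerBound hs ht
  cont := continuousOn_heatOp h.lowerBound
  gen f g := by
    constructor
    · intro hfg
      refine (tendsto_average_heatOp h.lowerBound g).neg.congr' ?_
      filter_upwards [self_mem_nhdsWithin] with t ht
      rw [h.heatOp_sub_eq hfg (le_of_lt ht), smul_neg]
    · intro hlim
      have hseq : Tendsto (fun k : ℕ => 1 / ((k : ℝ) + 1)) atTop (𝓝[>] 0) :=
        tendsto_nhdsWithin_iff.2 ⟨tendsto_one_div_add_atTop_nhds_zero_nat,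
          Eventually.of_forall fun k => Set.mem_Ioi.2 (by positivity)⟩
      refine h.isSchrodinger_of_tendsto
        (u := fun k : ℕ => (1 / ((k : ℝ) + 1))⁻¹ • ∫ s in (0 : ℝ)..(1 / ((k : ℝ) + 1)),
          G.heatOp U s f)
        (g := fun k : ℕ => (1 / ((k : ℝ) + 1))⁻¹ • (f - G.heatOp U (1 / ((k : ℝ) + 1)) f))
        (fun k => (h.isSchrodinger_integral (by positivity) f).smul _)
        ((tendsto_average_heatOp h.lowerBound f).comp hseq) ?_
      have hneg := (hlim.comp hseq).neg
      rw [neg_neg] at hneg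
      refine hneg.congr fun k => ?_
      rw [Function.comp_apply, ← smul_neg, neg_sub]

theorem Coercive.apply_eq_of_isSchrodinger (h : G.Coercive U l C) (hS : G.Generates U S)
    (hR : G.Generates U R) {f g : Lp ℝ 2 G.vol} (hfg : G.IsSchrodinger U f g) {t : ℝ}
    (ht : 0 ≤ t) : S t f = R t f := by
  refine sub_eq_zero.1 (eq_zero_of_inner_deriv_right_le (u := fun s => S s f - R s f)
    (u' := fun s => -(S s g - R s g)) (l := l)
    (((hS.cont f).sub (hR.cont f)).mono Set.Icc_subset_Ici_self) (fun s hs => ?_)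
    (fun s hs => ?_) (by simp [hS.zero, hR.zero]) ht)
  · exact ((hS.hasDerivWithinAt hfg hs.1).sub (hR.hasDerivWithinAt hfg hs.1)).congr_deriv
      (by abel)
  · have hge := h.neg_mul_norm_sq_le_inner
      ((hS.isSchrodinger_apply hfg hs.1).sub (hR.isSchrodinger_apply hfg hs.1))
    rw [inner_neg_right]
    linarith

theorem Coercive.unique (h : G.Coercive U l C) (hS : G.Generates U S) (hR : G.Generates U R)
    {t : ℝ} (ht : 0 ≤ t) : S t = R t := by
  ext1 f
  have havg := tendsto_average_heatOp h.lowerBound f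
  refine tendsto_nhds_unique (((S t).continuous.tendsto f).comp havg)
    ((((R t).continuous.tendsto f).comp havg).congr' ?_)
  filter_upwards [self_mem_nhdsWithin] with s hs
  exact (h.apply_eq_of_isSchrodinger hS hR
    ((h.isSchrodinger_integral (le_of_lt hs) f).smul s⁻¹) ht).symm

theorem Coercive.generates_semigroup (h : G.Coercive U l C) : G.Generates U (G.semigroup U) := by
  have hex : ∃ S, G.Generates U S := ⟨_, h.generates⟩
  rw [semigroup, dif_pos hex]
  exact hex.choose_spec

theorem Coercive.kernel_eq (h : G.Coercive U l C) {t : ℝ} (ht : 0 ≤ t) (x y : V) :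
    G.kernel U t x y = G.minKernel U t x y := by
  rw [← heatOp_delta h.lowerBound ht, ← h.unique h.generates_semigroup h.generates ht]
  rfl

end Generation

section Khasminskii

variable {V : Type*} {G : MWG V} {U W : V → ℝ} {F : Finset V} {T κ θ c t : ℝ}

variable (G) in
/-- The heat flow of `W` on every finite set, integrated up to time at most `T`, is bounded by
`κ`. -/
def KatoBound (T : ℝ) (W : V → ℝ) (κ : ℝ) : Prop :=
  ∀ (F : Finset V) (x : V), ∀ t ∈ Set.Icc 0 T, G.heatInt 0 F t W x ≤ κ

theorem hasDerivAt_heatInt (t : ℝ) (f : V → ℝ) (x : V) :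
    HasDerivAt (fun s => G.heatInt U F s f x) (G.heat U F t f x) t :=
  ((continuous_heat f x).integral_hasStrictDerivAt 0 t).hasDerivAt

theorem heatInt_nonneg (ht : 0 ≤ t) {f : V → ℝ} (hf : ∀ x, 0 ≤ f x) (x : V) :
    0 ≤ G.heatInt U F t f x :=
  intervalIntegral.integral_nonneg ht fun _ hs => heat_nonneg hs.1 (fun y _ => hf y) x

theorem heatInt_zero (f : V → ℝ) (x : V) : G.heatInt U F 0 f x = 0 :=
  intervalIntegral.integral_same

theorem heatInt_smul (t c : ℝ) (f : V → ℝ) (x : V) :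
    G.heatInt U F t (c • f) x = c * G.heatInt U F t f x := by
  simp [heatInt, heat_smul]

theorem KatoBound.const_smul (h : G.KatoBound T W κ) (hc : 0 ≤ c) :
    G.KatoBound T (c • W) (c * κ) := fun F x t ht => by
  rw [heatInt_smul]
  exact mul_le_mul_of_nonneg_left (h F x t ht) hc

variable (G) in
/-- The function `e^{-ct} (1 + b ∫₀ᵗ P_s W ds)`, with `P_s` the Dirichlet heat flow on `F`. If the
integral is at most `κ` and `b = θ / (1 - θκ)`, it is a supersolution of `∂ₜ = Δ + θ W - c`
on `F`. -/
noncomputable def katoSuper (F : Finset V) (W : V → ℝ) (b c t : ℝ) : V → ℝ :=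
  Real.exp (-(c * t)) • ((fun _ => 1) + b • G.heatInt 0 F t W)

theorem katoSuper_apply (b c t : ℝ) (x : V) :
    G.katoSuper F W b c t x = Real.exp (-(c * t)) * (1 + b * G.heatInt 0 F t W x) := rfl

theorem katoSuper_zero (b c : ℝ) (x : V) : G.katoSuper F W b c 0 x = 1 := by
  simp [katoSuper_apply, heatInt_zero]

theorem continuous_katoSuper (b c : ℝ) (x : V) : Continuous fun t => G.katoSuper F W b c t x := by
  have hheat : Continuous fun t => G.heatInt 0 F t W x :=
    continuous_iff_continuousAt.2 fun s => (hasDerivAt_heatInt s W x).continuousAt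
  simp only [katoSuper_apply]
  fun_prop

theorem katoSuper_pos (hW : ∀ x, 0 ≤ W x) {b : ℝ} (hb : 0 ≤ b) (ht : 0 ≤ t) (x : V) :
    0 < G.katoSuper F W b c t x := by
  have hint := heatInt_nonneg (G := G) (U := 0) (F := F) ht hW x
  rw [katoSuper_apply]
  positivity

theorem hasDerivAt_katoSuper (b c t : ℝ) {x : V} (hx : x ∈ F) :
    HasDerivAt (fun s => G.katoSuper F W b c s x)
      (G.lap (G.katoSuper F W b c t) x + Real.exp (-(c * t)) * (b * W x)
        - c * G.katoSuper F W b c t x) t := by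
  have hexp : HasDerivAt (fun s => Real.exp (-(c * s))) (Real.exp (-(c * t)) * -c) t := by
    simpa using ((hasDerivAt_id t).const_mul c).neg.exp
  refine (hexp.mul (((hasDerivAt_heatInt t W x).const_mul b).const_add 1)).congr_deriv ?_
  have hlap := neg_lap_heatInt_add_mul (G := G) (U := 0) t W hx
  rw [katoSuper_apply, katoSuper, lap_smul, lap_add, lap_const, lap_smul]
  rw [Pi.zero_apply, zero_mul, add_zero] at hlap
  linear_combination Real.exp (-(c * t)) * b * hlap

theorem KatoBound.katoSuper_le (h : G.KatoBound T W κ) (hθ : 0 ≤ θ) (hθκ : θ * κ < 1)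
    (ht : t ∈ Set.Icc 0 T) (x : V) :
    G.katoSuper F W (θ / (1 - θ * κ)) c t x ≤ Real.exp (-(c * t)) * (1 / (1 - θ * κ)) := by
  have hpos : 0 < 1 - θ * κ := by linarith
  rw [katoSuper_apply]
  gcongr
  rw [div_mul_eq_mul_div, le_div_iff₀ hpos, add_mul, div_mul_cancel₀ _ hpos.ne']
  linarith [mul_le_mul_of_nonneg_left (h F x t ht) hθ]

theorem KatoBound.mul_katoSuper_le (h : G.KatoBound T W κ) (hW : ∀ x, 0 ≤ W x) (hθ : 0 ≤ θ)
    (hθκ : θ * κ < 1) (ht : t ∈ Set.Icc 0 T) (x : V) :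
    θ * W x * G.katoSuper F W (θ / (1 - θ * κ)) c t x
      ≤ Real.exp (-(c * t)) * (θ / (1 - θ * κ) * W x) := by
  refine (mul_le_mul_of_nonneg_left (h.katoSuper_le hθ hθκ ht x)
    (mul_nonneg hθ (hW x))).trans_eq ?_
  ring

/-- **Khasminskii's lemma**, up to time `T`. -/
theorem KatoBound.heat_one_le (h : G.KatoBound T W κ) (hW : ∀ x, 0 ≤ W x) (hκ : κ < 1)
    (hU : ∀ x, c - W x ≤ U x) (ht : t ∈ Set.Icc 0 T) (x : V) :
    G.heat U F t (fun _ => 1) x ≤ Real.exp (-(c * t)) * (1 / (1 - κ)) := by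
  have hκ' : 1 * κ < 1 := by rwa [one_mul]
  have hpos : ∀ s ∈ Set.Icc 0 T, ∀ y, 0 < G.katoSuper F W (1 / (1 - 1 * κ)) c s y := fun s hs y =>
    katoSuper_pos hW (div_nonneg zero_le_one (by linarith)) hs.1 y
  have hcompare : G.heat U F t (fun _ => 1) x ≤ G.katoSuper F W (1 / (1 - 1 * κ)) c t x := by
    refine heat_le_of_supersolution (T := T) (fun s hs y _ => (hpos s hs y).le)
      (fun s _ y hy => hasDerivAt_katoSuper _ c s hy) (fun s hs y _ => ?_)
      (fun y _ => (katoSuper_zero _ _ y).ge) ht x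
    have hpot := mul_le_mul_of_nonneg_right (hU y) (hpos s hs y).le
    have hsuper := h.mul_katoSuper_le (F := F) (c := c) hW zero_le_one hκ' hs y
    linarith
  simpa only [one_mul] using hcompare.trans (h.katoSuper_le zero_le_one hκ' ht x)

/-- **Khasminskii's lemma**, for all times. -/
theorem KatoBound.heat_one_le_pow (h : G.KatoBound T W κ) (hT : 0 ≤ T) (hW : ∀ x, 0 ≤ W x)
    (hκ0 : 0 ≤ κ) (hκ : κ < 1) (hU : ∀ x, c - W x ≤ U x) (n : ℕ) (ht0 : 0 ≤ t)
    (ht : t ≤ (n + 1) * T) (x : V) :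
    G.heat U F t (fun _ => 1) x ≤ Real.exp (-(c * t)) * (1 / (1 - κ)) ^ (n + 1) := by
  have hone : 1 ≤ 1 / (1 - κ) := by
    rw [le_div_iff₀ (by linarith)]
    linarith
  induction n generalizing t x with
  | zero =>
    rw [zero_add, pow_one]
    exact h.heat_one_le hW hκ hU ⟨ht0, by simpa using ht⟩ x
  | succ n ih =>
    rcases le_total t ((n + 1) * T) with htn | htn
    · refine (ih ht0 htn x).trans (mul_le_mul_of_nonneg_left ?_ (Real.exp_pos _).le)
      exact pow_le_pow_right₀ hone (Nat.le_succ _)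
    · have hTt : T ≤ t :=
        (le_mul_of_one_le_left hT (by linarith [Nat.cast_nonneg (α := ℝ) n])).trans htn
      have htT : t - T ≤ (n + 1) * T := by
        push_cast at ht
        linarith
      set A := Real.exp (-(c * T)) * (1 / (1 - κ)) with hA
      calc G.heat U F t (fun _ => 1) x
          = G.heat U F (t - T) (G.heat U F T fun _ => 1) x := by
            rw [← heat_comp, sub_add_cancel]
        _ ≤ G.heat U F (t - T) (A • fun _ => 1) x := by
            refine heat_le_heat (sub_nonneg.2 hTt) (fun y _ => ?_) x
            rw [Pi.smul_apply, smul_eq_mul, mul_one]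
            exact h.heat_one_le hW hκ hU ⟨hT, le_rfl⟩ y
        _ = A * G.heat U F (t - T) (fun _ => 1) x := by rw [heat_smul, Pi.smul_apply, smul_eq_mul]
        _ ≤ A * (Real.exp (-(c * (t - T))) * (1 / (1 - κ)) ^ (n + 1)) := by
            gcongr
            exact ih (sub_nonneg.2 hTt) htT x
        _ = _ := by
            rw [hA, show -(c * t) = -(c * T) + -(c * (t - T)) by ring, Real.exp_add]
            ring

end Khasminskii

section FormBound

variable {V : Type*} {G : MWG V} {U W : V → ℝ} {F : Finset V} {T κ θ c : ℝ}

/-- **Picone's inequality.** -/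
theorem sum_neg_lap_mul_le_Q {H : V → ℝ} (hH : ∀ x, 0 < H x) {φ : V → ℝ} (hφ : φ.support.Finite) :
    ∑ x ∈ hφ.toFinset, G.m x * (-G.lap H x * (φ x ^ 2 / H x)) ≤ G.Q φ φ := by
  rw [← G.Q_eq_sum H (φ := fun x => φ x ^ 2 / H x) fun x hx => by
    simp [notMem_support_toFinset hφ x hx], Q, Q]
  refine mul_le_mul_of_nonneg_left ?_ (by norm_num)
  refine Summable.tsum_le_tsum (fun p => mul_le_mul_of_nonneg_left ?_ (G.w_nonneg _ _))
    (G.summable_w_mul_of_finite hφ fun p hx hy => by simp [hx, hy])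
    (G.summable_w_mul_of_finite hφ fun p hx hy => by simp [hx, hy])
  have hx := hH p.1
  have hy := hH p.2
  have hdiff : (φ p.1 - φ p.2) * (φ p.1 - φ p.2)
      - (H p.1 - H p.2) * (φ p.1 ^ 2 / H p.1 - φ p.2 ^ 2 / H p.2)
      = (φ p.1 * H p.2 - φ p.2 * H p.1) ^ 2 / (H p.1 * H p.2) := by
    field_simp
    ring
  have hsq : 0 ≤ (φ p.1 * H p.2 - φ p.2 * H p.1) ^ 2 / (H p.1 * H p.2) := by positivity
  linarith

theorem ip_mul_le_Q_of_supersolution {q H φ : V → ℝ} (hH : ∀ x, 0 < H x)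
    (hφ : φ.support.Finite) (hsuper : ∀ x ∈ φ.support, q x * H x ≤ -G.lap H x) :
    G.ip (fun x => q x * φ x) φ ≤ G.Q φ φ := by
  refine le_trans ?_ (sum_neg_lap_mul_le_Q hH hφ)
  rw [ip_eq_sum G _ (notMem_support_toFinset hφ)]
  refine Finset.sum_le_sum fun x hx => mul_le_mul_of_nonneg_left ?_ (G.m_pos x).le
  calc q x * φ x * φ x = q x * H x * (φ x ^ 2 / H x) := by
        have := (hH x).ne'
        field_simp
    _ ≤ -G.lap H x * (φ x ^ 2 / H x) :=
        mul_le_mul_of_nonneg_right (hsuper x (hφ.mem_toFinset.1 hx))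
          (div_nonneg (sq_nonneg _) (hH x).le)

theorem ip_const_mul (c : ℝ) (f g : V → ℝ) : G.ip (fun x => c * f x) g = c * G.ip f g := by
  rw [ip, ip, ← tsum_mul_left]
  exact tsum_congr fun x => by ring

theorem ip_sub_mul {q r φ : V → ℝ} (hφ : φ.support.Finite) :
    G.ip (fun x => (q x - r x) * φ x) φ
      = G.ip (fun x => q x * φ x) φ - G.ip (fun x => r x * φ x) φ := by
  rw [ip_eq_sum_support _ hφ, ip_eq_sum_support _ hφ, ip_eq_sum_support _ hφ,
    ← Finset.sum_sub_distrib]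
  exact Finset.sum_congr rfl fun x _ => by ring

theorem mul_integral_le_neg_lap_integral {u : ℝ → V → ℝ} {u' : ℝ → ℝ} {q : ℝ} {x : V}
    (hT : 0 ≤ T) (hu : ∀ y, Continuous fun s => u s y)
    (hderiv : ∀ s, HasDerivAt (fun s => u s x) (u' s) s)
    (hsuper : ∀ s ∈ Set.Icc 0 T, G.lap (u s) x + q * u s x ≤ u' s) (hend : u T x ≤ u 0 x) :
    q * ∫ s in (0 : ℝ)..T, u s x ≤ -G.lap (fun y => ∫ s in (0 : ℝ)..T, u s y) x := by
  have hint : ∀ y, IntervalIntegrable (fun s => u s y) volume 0 T := fun y =>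
    (hu y).intervalIntegrable 0 T
  have hlap := intervalIntegrable_lap (G := G) hint x
  have hle : ∫ s in (0 : ℝ)..T, (G.lap (u s) x + q * u s x) ≤ u T x - u 0 x :=
    intervalIntegral.integral_le_sub_of_hasDeriv_right_of_le hT (hu x).continuousOn
      (fun s _ => (hderiv s).hasDerivWithinAt)
      ((intervalIntegrable_iff_integrableOn_Icc_of_le hT).1 (hlap.add ((hint x).const_mul q)))
      fun s hs => hsuper s (Set.Ioo_subset_Icc_self hs)
  rw [intervalIntegral.integral_add hlap ((hint x).const_mul q),
    intervalIntegral.integral_const_mul, ← lap_integral hint] at hle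
  linarith

theorem KatoBound.form_le (h : G.KatoBound T W κ) (hT : 0 < T) (hW : ∀ x, 0 ≤ W x)
    (hθ : 0 ≤ θ) (hθκ : θ * κ < 1) (hc : 1 ≤ Real.exp (c * T) * (1 - θ * κ)) {φ : V → ℝ}
    (hφ : φ.support.Finite) :
    θ * G.ip (fun x => W x * φ x) φ ≤ G.Q φ φ + c * G.ip φ φ := by
  have hpos : 0 < 1 - θ * κ := by linarith
  set u := G.katoSuper hφ.toFinset W (θ / (1 - θ * κ)) c with hu
  have hcont : ∀ x, Continuous fun s => u s x := continuous_katoSuper _ _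
  have hend : ∀ x, u T x ≤ u 0 x := fun x => by
    rw [hu, katoSuper_zero]
    refine (h.katoSuper_le hθ hθκ ⟨hT.le, le_rfl⟩ x).trans ?_
    rwa [Real.exp_neg, ← one_div, one_div_mul_one_div, div_le_one (by positivity)]
  -- The time integral of the parabolic supersolution is an elliptic one, as `u T ≤ u 0`.
  have hPicone := ip_mul_le_Q_of_supersolution (G := G) (q := fun x => θ * W x - c)
    (H := fun x => ∫ s in (0 : ℝ)..T, u s x)
    (fun x => intervalIntegral.intervalIntegral_pos_of_pos_on ((hcont x).intervalIntegrable 0 T)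
      (fun s hs => katoSuper_pos hW (div_nonneg hθ hpos.le) hs.1.le x) hT) hφ fun x hx =>
    mul_integral_le_neg_lap_integral hT.le hcont
      (fun s => hasDerivAt_katoSuper _ c s (hφ.mem_toFinset.2 hx))
      (fun s hs => by linarith [h.mul_katoSuper_le (F := hφ.toFinset) (c := c) hW hθ hθκ hs x])
      (hend x)
  simp only [ip_sub_mul hφ, mul_assoc, ip_const_mul] at hPicone
  linarith

theorem Q_self_nonneg (f : V → ℝ) : 0 ≤ G.Q f f :=
  mul_nonneg (by norm_num) (tsum_nonneg fun p =>
    mul_nonneg (G.w_nonneg _ _) (mul_self_nonneg _))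

theorem ip_self_nonneg (f : V → ℝ) : 0 ≤ G.ip f f :=
  tsum_nonneg fun x => mul_nonneg (G.m_pos x).le (mul_self_nonneg _)

theorem ip_mul_self_le {q r φ : V → ℝ} (hqr : ∀ x, q x ≤ r x) (hφ : φ.support.Finite) :
    G.ip (fun x => q x * φ x) φ ≤ G.ip (fun x => r x * φ x) φ := by
  rw [ip_eq_sum_support _ hφ, ip_eq_sum_support _ hφ]
  refine Finset.sum_le_sum fun x _ => mul_le_mul_of_nonneg_left ?_ (G.m_pos x).le
  rw [mul_assoc, mul_assoc]
  exact mul_le_mul_of_nonneg_right (hqr x) (mul_self_nonneg _)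

theorem tsum_emb_sq_eq {φ : V → ℝ} (hφ : φ.support.Finite) :
    ∑' i, G.emb U φ i ^ 2
      = G.ip φ φ + G.ip (fun x => |U x| * φ x) φ + G.Q φ φ := by
  have hsum := memℓp_two_iff_summable_sq.1 (G.memℓp_emb_of_finite U hφ)
  have hoff := notMem_support_toFinset hφ
  rw [Summable.tsum_sum (hsum.comp_injective Sum.inl_injective)
    (hsum.comp_injective Sum.inr_injective), ip_eq_sum G _ hoff, ip_eq_sum G _ hoff, Q,
    ← tsum_mul_left, ← Finset.sum_add_distrib]
  simp only [emb_inl_sq, emb_inr_sq]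
  congr 1
  · rw [tsum_eq_sum fun x hx => by rw [hoff x hx]; ring]
    exact Finset.sum_congr rfl fun x _ => by ring
  · exact tsum_congr fun p => by ring

theorem KatoBound.coercive (h : G.KatoBound T W κ) (hT : 0 < T) (hW : ∀ x, 0 ≤ W x) {a : ℝ}
    (ha : 0 ≤ a) (hc0 : 0 ≤ c) (hκ : 2 * κ < 1) (hc : 1 ≤ Real.exp (c * T) * (1 - 2 * κ))
    (hU : ∀ x, a - W x ≤ U x) : G.Coercive U (1 + c) 4 where
  l_nonneg := by linarith
  C_pos := by norm_num
  le φ hφ := by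
    have hform := h.form_le hT hW zero_le_two hκ hc hφ
    have hQ := Q_self_nonneg (G := G) φ
    have hip := ip_self_nonneg (G := G) φ
    have habs : G.ip (fun x => (|U x| - 2 * W x) * φ x) φ ≤ G.ip (fun x => U x * φ x) φ :=
      ip_mul_self_le (fun x => sub_le_iff_le_add.2 <| abs_le.2
        ⟨by linarith [hU x], by linarith [hW x]⟩) hφ
    have hlow : G.ip (fun x => (a - W x) * φ x) φ ≤ G.ip (fun x => U x * φ x) φ :=
      ip_mul_self_le hU hφ
    simp only [ip_sub_mul hφ, mul_assoc, ip_const_mul] at habs hlow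
    have haip := mul_nonneg ha hip
    have hcip := mul_nonneg hc0 hip
    rw [tsum_emb_sq_eq hφ, schroForm]
    linarith

theorem ip_neg_lap_self {φ : V → ℝ} (hφ : φ.support.Finite) :
    G.ip (fun x => -G.lap φ x) φ = G.Q φ φ := by
  rw [G.Q_eq_sum φ (notMem_support_toFinset hφ), ip_eq_sum_support _ hφ]

theorem KatoBound.half_mul_ip_le (h : G.KatoBound T W κ) (hT : 0 < T) (hW : ∀ x, 0 ≤ W x) {a : ℝ}
    (hca : c ≤ a) (hκ : 2 * κ < 1) (hc : 1 ≤ Real.exp (c * T) * (1 - 2 * κ))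
    (hU : ∀ x, a - W x ≤ U x) {φ : V → ℝ} (hφ : φ.support.Finite) :
    a / 2 * G.ip φ φ
      ≤ 1 / 2 * G.ip (fun x => -G.lap φ x) φ + G.ip (fun x => U x * φ x) φ := by
  have hform := h.form_le hT hW zero_le_two hκ hc hφ
  have hlow : G.ip (fun x => (a - W x) * φ x) φ ≤ G.ip (fun x => U x * φ x) φ :=
    ip_mul_self_le hU hφ
  have hcip := mul_le_mul_of_nonneg_right hca (ip_self_nonneg (G := G) φ)
  simp only [ip_sub_mul hφ, ip_const_mul] at hlow
  rw [ip_neg_lap_self hφ]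
  linarith

theorem coercive_zero : G.Coercive 0 1 1 where
  l_nonneg := zero_le_one
  C_pos := zero_lt_one
  le φ hφ := by
    rw [tsum_emb_sq_eq hφ, schroForm]
    simp only [ip, Pi.zero_apply, abs_zero, zero_mul, mul_zero, tsum_zero]
    linarith

end FormBound

section RowSums

variable {V : Type*} {G : MWG V} {U W : V → ℝ} {F : Finset V} {T κ l C t : ℝ}

theorem sum_minKernel_le (hl : G.LowerBound U l) (ht : 0 ≤ t) {x : V}
    (hC : ∀ F : Finset V, G.heat U F t (fun _ => 1) x ≤ C) (s : Finset V) :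
    ∑ y ∈ s, G.minKernel U t x y ≤ C := by
  classical
  refine le_of_tendsto (tendsto_finsetSum s fun y _ => tendsto_dirKernel hl ht x y)
    (Eventually.of_forall fun F => ?_)
  calc ∑ y ∈ s, G.dirKernel U F t x y ≤ ∑ y ∈ s ∪ F, G.dirKernel U F t x y :=
        Finset.sum_le_sum_of_subset_of_nonneg Finset.subset_union_left
          fun y _ _ => dirKernel_nonneg ht x y
    _ = ∑ y ∈ F, G.dirKernel U F t x y :=
        (Finset.sum_subset Finset.subset_union_right fun y _ hy => dirKernel_notMem_right hy).symm
    _ = G.heat U F t (fun _ => 1) x := by simp only [heat_eq_sum, mul_one]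
    _ ≤ C := hC F

theorem summable_minKernel (hl : G.LowerBound U l) (ht : 0 ≤ t) {x : V}
    (hC : ∀ F : Finset V, G.heat U F t (fun _ => 1) x ≤ C) :
    Summable fun y => G.minKernel U t x y :=
  summable_of_sum_le (minKernel_nonneg hl ht x) (sum_minKernel_le hl ht hC)

theorem tsum_ofReal_minKernel_le (hl : G.LowerBound U l) (ht : 0 ≤ t) {x : V}
    (hC : ∀ F : Finset V, G.heat U F t (fun _ => 1) x ≤ C) :
    ∑' y, ENNReal.ofReal (G.minKernel U t x y) ≤ ENNReal.ofReal C := by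
  have hnonneg := minKernel_nonneg hl ht x
  rw [← ENNReal.ofReal_tsum_of_nonneg hnonneg (summable_minKernel hl ht hC)]
  exact ENNReal.ofReal_le_ofReal
    (Real.tsum_le_of_sum_le hnonneg (sum_minKernel_le hl ht hC))

theorem heat_zero_one_le (ht : 0 ≤ t) (x : V) : G.heat 0 F t (fun _ => 1) x ≤ 1 :=
  heat_le_of_supersolution (T := t) (v := fun _ _ => 1) (v' := fun _ _ => 0)
    (fun _ _ _ _ => zero_le_one) (fun _ _ _ _ => hasDerivAt_const _ _)
    (fun _ _ _ _ => by simp [lap_const]) (fun _ _ => le_rfl) ⟨ht, le_rfl⟩ x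

end RowSums

section OperatorNorms

variable {V : Type*} [MeasurableSpace V] [DiscreteMeasurableSpace V] {G : MWG V} {U W : V → ℝ}
  {F : Finset V} {T κ l C t : ℝ} {p : ℝ≥0∞}

theorem enorm_le_eLpNorm_top {ε : Type*} [ENorm ε] (f : V → ε) (x : V) :
    ‖f x‖ₑ ≤ eLpNorm f ∞ G.vol := by
  rw [eLpNorm_exponent_top]
  exact G.ae_vol_iff.1 (ae_le_eLpNormEssSup (f := f) (μ := G.vol)) x

variable [Countable V]

theorem ne_top_of_eLpNorm_ne_top (hp : p ≠ 0) {f : V → ℝ≥0∞} (hf : eLpNorm f p G.vol ≠ ∞)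
    (x : V) : f x ≠ ∞ := by
  rcases eq_or_ne p ∞ with rfl | hp_top
  · exact ne_top_of_le_ne_top hf (enorm_le_eLpNorm_top f x)
  · have hint := lintegral_rpow_enorm_lt_top_of_eLpNorm_lt_top hp hp_top hf.lt_top
    rw [lintegral_vol] at hint
    intro hx
    refine ENNReal.ne_top_of_tsum_ne_top hint.ne x ?_
    rw [hx, enorm_eq_self, ENNReal.top_rpow_of_pos (ENNReal.toReal_pos hp hp_top),
      ENNReal.mul_top (ENNReal.ofReal_pos.2 (G.m_pos x)).ne']

theorem lintegral_ofReal_div_mul_vol (a : V → ℝ) (f : V → ℝ≥0∞) :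
    ∫⁻ y, ENNReal.ofReal (a y / G.m y) * f y ∂G.vol = ∑' y, ENNReal.ofReal (a y) * f y := by
  rw [lintegral_vol]
  refine tsum_congr fun y => ?_
  rw [← mul_assoc, ← ENNReal.ofReal_mul (G.m_pos y).le, mul_div_cancel₀ _ (G.m_pos y).ne']

theorem eLpNorm_tsum_mul_enorm_le {E : Type*} [NormedAddCommGroup E] {k : V → V → ℝ}
    {C : ℝ≥0∞} (hsymm : ∀ x y, G.m x * k x y = G.m y * k y x)
    (hrow : ∀ x, ∑' y, ENNReal.ofReal (k x y) ≤ C) (hp : 1 ≤ p) (f : V → E) :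
    eLpNorm (fun x => ∑' y, ENNReal.ofReal (k x y) * ‖f y‖ₑ) p G.vol ≤ C * eLpNorm f p G.vol := by
  have : SFinite G.vol := inferInstanceAs (SFinite (Measure.sum _))
  have hdensity_symm : ∀ x y, k x y / G.m y = k y x / G.m x := fun x y => by
    rw [div_eq_div_iff (G.m_pos y).ne' (G.m_pos x).ne']
    linarith [hsymm x y]
  have hmass : ∀ x, ∫⁻ y, ENNReal.ofReal (k x y / G.m y) ∂G.vol ≤ C := fun x => by
    have hdensity := lintegral_ofReal_div_mul_vol (G := G) (k x) 1
    simp only [Pi.one_apply, mul_one] at hdensity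
    exact hdensity.trans_le (hrow x)
  simp_rw [← lintegral_ofReal_div_mul_vol (G := G) (k _)]
  refine eLpNorm_lintegral_mul_enorm_le_of_schur Measurable.of_discrete
    (Eventually.of_forall hmass) (Eventually.of_forall fun y => ?_) hp
    .of_discrete
  simp_rw [hdensity_symm _ y]
  exact hmass y

theorem Coercive.act_eq {c : ℝ} (h : G.Coercive U l c) (ht : 0 ≤ t) (f : V → ℝ) :
    G.act U t f = fun x => ∑' y, G.minKernel U t x y * f y :=
  funext fun x => tsum_congr fun y => by rw [h.kernel_eq ht]

theorem Coercive.opNormLE {c : ℝ} (h : G.Coercive U l c) (ht : 0 ≤ t) (hC : 0 ≤ C)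
    (hrow : ∀ (F : Finset V) (x : V), G.heat U F t (fun _ => 1) x ≤ C) (hp : 1 ≤ p) :
    G.OpNormLE U t p C := by
  have hl := h.lowerBound
  refine ⟨hC, fun f hf => ?_⟩
  have henorm : ∀ x y, ENNReal.ofReal (G.minKernel U t x y) * ‖f y‖ₑ
      = ‖G.minKernel U t x y * f y‖ₑ := fun x y => by
    rw [enorm_mul, Real.enorm_of_nonneg (minKernel_nonneg hl ht x y)]
  have hschur := eLpNorm_tsum_mul_enorm_le (minKernel_symm hl ht)
    (fun x => tsum_ofReal_minKernel_le hl ht fun F => hrow F x) hp f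
  simp_rw [henorm] at hschur
  have hfinite := ne_top_of_eLpNorm_ne_top (zero_lt_one.trans_le hp).ne'
    (ne_top_of_le_ne_top (ENNReal.mul_ne_top ENNReal.ofReal_ne_top hf.2.ne) hschur)
  refine ⟨fun x => ?_, ?_⟩
  · simp_rw [h.kernel_eq ht]
    exact Summable.of_enorm (hfinite x)
  · rw [h.act_eq ht]
    refine (eLpNorm_mono_enorm fun x => ?_).trans hschur
    exact enorm_tsum_le_tsum_enorm

theorem ofReal_heat_le_eLpNorm_act (ht : 0 ≤ t) {f : V → ℝ} (hf : ∀ x, 0 ≤ f x) {b : ℝ}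
    (hb : ∀ x, f x ≤ b) (F : Finset V) (x : V) :
    ENNReal.ofReal (G.heat 0 F t f x) ≤ eLpNorm (G.act 0 t f) ∞ G.vol := by
  have hl := (coercive_zero (G := G)).lowerBound
  have hkernel := minKernel_nonneg hl ht x
  have hnonneg : ∀ y, 0 ≤ G.minKernel 0 t x y * f y := fun y => mul_nonneg (hkernel y) (hf y)
  have hsum : Summable fun y => G.minKernel 0 t x y * f y :=
    Summable.of_nonneg_of_le hnonneg (fun y => mul_le_mul_of_nonneg_left (hb y) (hkernel y))
      ((summable_minKernel hl ht fun F => heat_zero_one_le ht x).mul_right b)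
  refine le_trans ?_ (enorm_le_eLpNorm_top _ x)
  rw [coercive_zero.act_eq ht, Real.enorm_of_nonneg (tsum_nonneg hnonneg), heat_eq_sum]
  refine ENNReal.ofReal_le_ofReal (le_trans ?_ (hsum.sum_le_tsum F fun y _ => hnonneg y))
  exact Finset.sum_le_sum fun y _ =>
    mul_le_mul_of_nonneg_right (dirKernel_le_minKernel hl ht F x y) (hf y)

theorem exists_nat_ofReal_heat_le_eLpNorm_act (hW : ∀ x, 0 ≤ W x) (F : Finset V) (x : V) :
    ∃ j : ℕ, ∀ s, 0 ≤ s → ENNReal.ofReal (G.heat 0 F s W x)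
      ≤ eLpNorm (G.act 0 s fun y => min (j : ℝ) (W y)) ∞ G.vol := by
  obtain ⟨j, hj⟩ := exists_nat_ge (∑ y ∈ F, W y)
  refine ⟨j, fun s hs => ?_⟩
  rw [heat_congr (g := fun y => min (j : ℝ) (W y)) s fun y hy =>
    (min_eq_right ((Finset.single_le_sum (fun z _ => hW z) hy).trans hj)).symm]
  exact ofReal_heat_le_eLpNorm_act hs (fun y => le_min j.cast_nonneg (hW y))
    (fun y => min_le_left _ _) F x

theorem katoBound_of_kato_le (hκ : 0 ≤ κ) (hW : ∀ x, 0 ≤ W x)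
    (h : G.kato T W ≤ ENNReal.ofReal κ) : G.KatoBound T W κ := by
  intro F x t ht
  obtain ⟨j, hj⟩ := exists_nat_ofReal_heat_le_eLpNorm_act (G := G) hW F x
  have hint : IntegrableOn (fun s => G.heat 0 F s W x) (Set.Ioc 0 t) :=
    (intervalIntegrable_iff_integrableOn_Ioc_of_le ht.1).1
      ((continuous_heat W x).intervalIntegrable 0 t)
  have hnonneg : 0 ≤ᵐ[volume.restrict (Set.Ioc 0 t)] fun s => G.heat 0 F s W x := by
    filter_upwards [ae_restrict_mem measurableSet_Ioc] with s hs
    exact heat_nonneg hs.1.le (fun y _ => hW y) x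
  rw [← ENNReal.ofReal_le_ofReal_iff hκ, heatInt, intervalIntegral.integral_of_le ht.1,
    ofReal_integral_eq_lintegral_ofReal hint hnonneg]
  calc ∫⁻ s in Set.Ioc 0 t, ENNReal.ofReal (G.heat 0 F s W x)
      ≤ ∫⁻ s in Set.Ioc 0 T, ENNReal.ofReal (G.heat 0 F s W x) :=
        lintegral_mono_set (Set.Ioc_subset_Ioc_right ht.2)
    _ ≤ ∫⁻ s in Set.Ioc 0 T, eLpNorm (G.act 0 s fun y => min (j : ℝ) (W y)) ∞ G.vol :=
        setLIntegral_mono' measurableSet_Ioc fun s hs => hj s hs.1.le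
    _ ≤ G.kato T W := le_iSup (fun j : ℕ =>
        ∫⁻ s in Set.Ioc 0 T, eLpNorm (G.act 0 s fun y => min (j : ℝ) (W y)) ∞ G.vol) j
    _ ≤ ENNReal.ofReal κ := h

end OperatorNorms

section ExponentialKato

variable {V : Type*} {G : MWG V} {U W : V → ℝ} {F : Finset V} {T c t : ℝ}

theorem one_div_one_sub_half_le_exp {s : ℝ} (hs : 0 ≤ s) :
    1 / (1 - 1 / 2 * (1 - Real.exp (-(s / 4)))) ≤ Real.exp (s / 2) := by
  set q := Real.exp (-(s / 4)) with hq
  have hq_pos : 0 < q := Real.exp_pos _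
  have hq_le : q ≤ 1 := Real.exp_le_one_iff.2 (by linarith)
  have hcancel : Real.exp (s / 2) * (q * q) = 1 := by
    rw [hq, ← Real.exp_add, ← Real.exp_add, Real.exp_eq_one_iff]
    ring
  rw [div_le_iff₀ (by linarith), ← hcancel]
  gcongr
  nlinarith

theorem exp_mul_one_sub_two_mul_half (s : ℝ) :
    Real.exp (s / 4) * (1 - 2 * (1 / 2 * (1 - Real.exp (-(s / 4))))) = 1 := by
  have hcancel : Real.exp (s / 4) * Real.exp (-(s / 4)) = 1 := by
    rw [← Real.exp_add, add_neg_cancel, Real.exp_zero]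
  linear_combination hcancel

theorem KatoBound.heat_one_le_exp (h : G.KatoBound T W (1 / 2 * (1 - Real.exp (-(c * T / 4)))))
    (hT : 0 < T) (hc : 0 ≤ c) (hW : ∀ x, 0 ≤ W x) (hU : ∀ x, c - W x ≤ U x) (ht : 0 ≤ t)
    (x : V) : G.heat U F t (fun _ => 1) x ≤ Real.exp (c * (T - t) / 2) := by
  have hcT : 0 ≤ c * T := mul_nonneg hc hT.le
  have hexp_le : Real.exp (-(c * T / 4)) ≤ 1 := Real.exp_le_one_iff.2 (by linarith)
  have hexp_pos := Real.exp_pos (-(c * T / 4))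
  have hfloor_le : (⌊t / T⌋₊ : ℝ) * T ≤ t := (le_div_iff₀ hT).1 (Nat.floor_le (by positivity))
  have hle_floor : t ≤ (⌊t / T⌋₊ + 1) * T :=
    (div_le_iff₀ hT).1 (Nat.lt_floor_add_one (t / T)).le
  calc G.heat U F t (fun _ => 1) x
      ≤ Real.exp (-(c * t))
          * (1 / (1 - 1 / 2 * (1 - Real.exp (-(c * T / 4))))) ^ (⌊t / T⌋₊ + 1) :=
        h.heat_one_le_pow hT.le hW (by linarith) (by linarith) hU _ ht hle_floor x
    _ ≤ Real.exp (-(c * t)) * Real.exp (c * T / 2) ^ (⌊t / T⌋₊ + 1) := by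
        gcongr
        · exact one_div_nonneg.2 (by linarith)
        · exact one_div_one_sub_half_le_exp hcT
    _ = Real.exp (-(c * t) + (⌊t / T⌋₊ + 1) * (c * T / 2)) := by
        rw [← Real.exp_nat_mul, ← Real.exp_add, Nat.cast_add_one]
    _ ≤ Real.exp (c * (T - t) / 2) :=
        Real.exp_le_exp.2 (by linarith [mul_le_mul_of_nonneg_left hfloor_le hc])

theorem KatoBound.coercive_exp (h : G.KatoBound T W (1 / 2 * (1 - Real.exp (-(c * T / 4)))))
    (hT : 0 < T) (hc : 0 ≤ c) (hW : ∀ x, 0 ≤ W x) (hU : ∀ x, c - W x ≤ U x) :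
    G.Coercive U (1 + c / 4) 4 := by
  refine h.coercive hT hW hc (by positivity) (by linarith [Real.exp_pos (-(c * T / 4))]) ?_ hU
  rw [div_mul_eq_mul_div, exp_mul_one_sub_two_mul_half]

theorem KatoBound.half_mul_ip_le_exp
    (h : G.KatoBound T W (1 / 2 * (1 - Real.exp (-(c * T / 4))))) (hT : 0 < T) (hc : 0 ≤ c)
    (hW : ∀ x, 0 ≤ W x) (hU : ∀ x, c - W x ≤ U x) {φ : V → ℝ} (hφ : φ.support.Finite) :
    c / 2 * G.ip φ φ
      ≤ 1 / 2 * G.ip (fun x => -G.lap φ x) φ + G.ip (fun x => U x * φ x) φ := by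
  refine h.half_mul_ip_le hT hW (c := c / 4) (by linarith)
    (by linarith [Real.exp_pos (-(c * T / 4))]) ?_ hU hφ
  rw [div_mul_eq_mul_div, exp_mul_one_sub_two_mul_half]

theorem katoBound_mul_negPart_sub [MeasurableSpace V] [DiscreteMeasurableSpace V] [Countable V]
    {ρ : V → ℝ} {K a : ℝ} (hK : 0 ≤ K) (hT : 0 ≤ T) (ha : 0 < a)
    (h : G.kato T (fun x => (ρ x - K)⁻)
      ≤ ENNReal.ofReal (1 / (2 * a) * (1 - Real.exp (-(a * K * T / 4))))) :
    G.KatoBound T (fun x => a * (ρ x - K)⁻) (1 / 2 * (1 - Real.exp (-(a * K * T / 4)))) := by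
  have hexp_le : Real.exp (-(a * K * T / 4)) ≤ 1 :=
    Real.exp_le_one_iff.2 (neg_nonpos.2 (by positivity))
  have hbound := (katoBound_of_kato_le
    (mul_nonneg (by positivity) (by linarith)) (fun x => negPart_nonneg (ρ x - K)) h).const_smul
    ha.le
  have hconst : a * (1 / (2 * a) * (1 - Real.exp (-(a * K * T / 4))))
      = 1 / 2 * (1 - Real.exp (-(a * K * T / 4))) := by
    field_simp
  rwa [hconst] at hbound

end ExponentialKato

end MWG

theorem mainTheorem10_general {V : Type*} [Countable V] [MeasurableSpace V]
    [DiscreteMeasurableSpace V] (G : MWG V) {K T a : ℝ} (hK : 0 ≤ K) (hT : 0 < T) (ha : 0 < a)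
    {ρ : V → ℝ}
    (hkato : G.kato T (fun x => (ρ x - K)⁻)
      ≤ ENNReal.ofReal (1 / (2 * a) * (1 - Real.exp (-(a * K * T / 4))))) :
    (∀ f : V → ℝ, f.support.Finite → a * K / 2 * G.ip f f
      ≤ 1 / 2 * G.ip (fun x => -G.lap f x) f + G.ip (fun x => a * ρ x * f x) f) ∧
    G.Generates (fun x => a * ρ x) (G.semigroup fun x => a * ρ x) ∧
    ∀ t : ℝ, 0 ≤ t → ∀ p : ℝ≥0∞, 1 ≤ p →
      G.OpNormLE (fun x => a * ρ x) t p (Real.exp (a * K * (T - t) / 2)) := by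
  have hW : ∀ x, 0 ≤ a * (ρ x - K)⁻ := fun x => mul_nonneg ha.le (negPart_nonneg _)
  have hlow : ∀ x, a * K - a * (ρ x - K)⁻ ≤ a * ρ x := fun x => by
    rw [← mul_sub]
    exact mul_le_mul_of_nonneg_left (by linarith [neg_le_negPart (ρ x - K)]) ha.le
  have haK : 0 ≤ a * K := mul_nonneg ha.le hK
  have hbound := MWG.katoBound_mul_negPart_sub hK hT.le ha hkato
  have hcoercive := hbound.coercive_exp hT haK hW hlow
  exact ⟨fun f hf => hbound.half_mul_ip_le_exp hT haK hW hlow hf, hcoercive.generates_semigroup,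
    fun t ht p hp => hcoercive.opNormLE ht (Real.exp_pos _).le
      (fun F x => hbound.heat_one_le_exp hT haK hW hlow ht x) hp⟩

theorem mainTheorem10 {V : Type*} [Countable V] [MeasurableSpace V] [DiscreteMeasurableSpace V]
    (G : MWG V) (K T : ℝ) (hK : 0 < K) (hT : 0 < T) (n : ℝ≥0∞) (hn : 0 < n) (ρ : V → ℝ)
    (hCD : G.CD ρ n) :
    (G.kato T (fun x => (ρ x - K)⁻) ≤ ENNReal.ofReal (1 / 2 * (1 - Real.exp (-(K * T / 4)))) →
      G.SpectrallyPositive (K / 2) n ρ ∧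
      G.Generates ρ (G.semigroup ρ) ∧
      (∀ t : ℝ, 0 < t → ∀ p : ℝ≥0∞, 1 ≤ p → ∃ C : ℝ, G.OpNormLE ρ t p C) ∧
      (∀ t : ℝ, 0 < t → G.OpNormLE ρ t ∞ (Real.exp (K * (T - t) / 2)))) ∧
    (G.kato T (fun x => (ρ x - K)⁻) ≤ ENNReal.ofReal (1 / 4 * (1 - Real.exp (-(K * T / 2)))) →
      G.Generates (fun x => 2 * ρ x) (G.semigroup (fun x => 2 * ρ x)) ∧
      (∀ t : ℝ, 0 < t →
        G.OpNormLE (fun x => 2 * ρ x) t ∞ (Real.exp (K * (T - t))))) := by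
  refine ⟨fun hkato => ?_, fun hkato => ?_⟩
  · obtain ⟨hform, hgen, hnorm⟩ := mainTheorem10_general G hK.le hT one_pos (ρ := ρ)
      (by simpa only [one_mul, mul_one] using hkato)
    simp only [one_mul] at hform hgen hnorm
    exact ⟨⟨hCD, hform⟩, hgen, fun t ht p hp => ⟨_, hnorm t ht.le p hp⟩,
      fun t ht => hnorm t ht.le ∞ le_top⟩
  · obtain ⟨-, hgen, hnorm⟩ := mainTheorem10_general G hK.le hT two_pos (ρ := ρ)
      (hkato.trans_eq (by ring_nf))
    refine ⟨hgen, fun t ht => ?_⟩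
    convert hnorm t ht.le ∞ le_top using 2
    ring
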